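/- Let $M$ be a smooth, Hausdorff, paracompact manifold of finite dimension $m$ without boundary. A local vectorfield on $M$ is a smooth vectorfield $X$ on an open (possibly empty) subset $\mathrm{dom}\,X\subset M$; its maximal local flow is denoted by $Fl^X_t$. A local diffeomorphism on $M$ is a smooth diffeomorphism $\varphi:U\to U'$ between open subsets of $M$; composites $\varphi\circ\psi$ are defined on $\psi^{-1}(\mathrm{dom}\,\varphi)$, and $\varphi^*Y=T\varphi^{-1}\circ Y\circ\varphi$ is the local vectorfield with domain $\varphi^{-1}(\mathrm{dom}\,Y)$. Let $\mathcal V$ be any set of local vectorfields on $M$. (a) A set $\mathcal W$ of local vectorfields is stable if $(Fl^X_t)^*Y\in\mathcal W$ for all $X,Y\in\mathcal W$ and all $t$; $\mathcal S(\mathcal V)$ is the smallest stable set containing $\mathcal V$. The distribution $H$ spanned by $\mathcal S(\mathcal V)$ is given by $H_y=\mathrm{span}\{X(y): X\in\mathcal S(\mathcal V),\ y\in\mathrm{dom}\,X\}\subset T_yM$ for $y \in M$. (b) A pseudo-group is a set of local diffeomorphisms that contains $\mathrm{Id}_M$ and is closed under composition and inversion; $G_{\mathcal V}$ is the smallest pseudo-group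 containing $Fl^X_t$ for all $X\in\mathcal V$ and $t\in\mathbb R$. The orbit of $x\in M$ is $\{\varphi(x):\varphi\in G_{\mathcal V},\ x\in\mathrm{dom}\,\varphi\}$. (c) An integral manifold of $H$ is a pair $(N,i)$ where $N$ is a connected (non-empty) smooth, Hausdorff, paracompact manifold of some finite dimension and $i:N\to M$ is an injective immersion with $T_pi(T_pN)=H_{i(p)}$ for all $p\in N$. It is maximal if no integral manifold $(P,j)$ of $H$ satisfies $i(N)\subsetneq j(P)$. Theorem. For every $x\in M$ the $G_{\mathcal V}$-orbit through $x$ is the maximal integral manifold through $x$ of the distribution $H$ spanned by $\mathcal S(\mathcal V)$. That is, there is a maximal integral manifold $(L,i)$ of $H$ such that $i(L)$ is the $G_{\mathcal V}$-orbit of $x$, and $x \in i(L)$; every integral manifold $(P,j)$ of $H$ with $x\in j(P)$ satisfies $j(P)\subset i(L)$; and for every maximal integral manifold $(P,j)$ of $H$ with $x\in j(P)$ there is a diffeomorphism $\Phi:P\to L$ with $i\circ\Phi=j$. -/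

import Mathlib

open Set
open scoped Manifold ContDiff

universe u v

namespace SingularFoliation

section LocalObjects

variable (m : ℕ) (M : Type u) [TopologicalSpace M] [ChartedSpace (EuclideanSpace ℝ (Fin m)) M]

/-- A local diffeomorphism on `M`: a smooth diffeomorphism from an open subset (`source`) of `M`
onto an open subset (`target`) of `M`. The composite `φ ∘ ψ`, with domain `ψ ⁻¹(source φ)`, is
`ψ.trans φ`; the inverse is `φ.symm`. Values outside `source` and `target` carry no meaning. -/
abbrev LocalDiffeo : Type u := PartialDiffeomorph (𝓡 m) (𝓡 m) M M ∞

/-- The identity of `M` as a local diffeomorphism. -/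
noncomputable def LocalDiffeo.id : LocalDiffeo m M :=
  (Diffeomorph.refl (𝓡 m) M ∞).toPartialDiffeomorph

/-- A local vector field on `M`: a smooth vector field on an open subset `dom` of `M` (possibly
empty). It is stored with the value `0` outside `dom`, so that two local vector fields are equal
if and only if they have the same domain and the same values on it. -/
@[ext]
structure LocalVectorField [IsManifold (𝓡 m) ∞ M] where
  /-- the domain of definition -/
  dom : Set M
  /-- the values -/
  val : (x : M) → TangentSpace (𝓡 m) x
  isOpen_dom : IsOpen dom
  contMDiffOn_val : ContMDiffOn (𝓡 m) (𝓡 m).tangent ∞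
    (fun x => (⟨x, val x⟩ : TangentBundle (𝓡 m) M)) dom
  val_eq_zero : ∀ x, x ∉ dom → val x = 0

end LocalObjects

variable {m : ℕ} {M : Type u} [TopologicalSpace M] [ChartedSpace (EuclideanSpace ℝ (Fin m)) M]

section Flows

/-- The differential of a local diffeomorphism is invertible on its source. -/
theorem mfderiv_isInvertible (φ : LocalDiffeo m M) {x : M} (hx : x ∈ φ.source) :
    (mfderiv (𝓡 m) (𝓡 m) φ x).IsInvertible := by
  have h : IsLocalDiffeomorphAt (𝓡 m) (𝓡 m) ∞ φ x := ⟨φ, hx, Set.eqOn_refl _ _⟩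
  exact ⟨h.mfderivToContinuousLinearEquiv (by simp), rfl⟩

variable [IsManifold (𝓡 m) ∞ M]

/-- `FlowsTo X t x y`: the maximal integral curve of `X` starting at `x` is defined at time `t`
and its value there is `y`; that is, `(t, x)` is in the domain of the maximal local flow `Fl^X`
and `Fl^X(t, x) = y`. -/
def FlowsTo (X : LocalVectorField m M) (t : ℝ) (x y : M) : Prop :=
  ∃ (γ : ℝ → M) (a b : ℝ), a < 0 ∧ 0 < b ∧ t ∈ Ioo a b ∧ γ 0 = x ∧ γ t = y ∧
    (∀ s ∈ Ioo a b, γ s ∈ X.dom) ∧ IsMIntegralCurveOn γ X.val (Ioo a b)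

/-- `IsFlowAt X t φ`: the local diffeomorphism `φ` is the time-`t` map `Fl^X_t` of the maximal
local flow of `X`, with its full domain of definition. -/
def IsFlowAt (X : LocalVectorField m M) (t : ℝ) (φ : LocalDiffeo m M) : Prop :=
  φ.source = {x | ∃ y, FlowsTo X t x y} ∧ ∀ x ∈ φ.source, FlowsTo X t x (φ x)

open Classical in
/-- The pullback `φ^*Y = Tφ⁻¹ ∘ Y ∘ φ` of a local vector field along a local diffeomorphism,
with domain `φ⁻¹(dom Y)`. -/
noncomputable def pullback (φ : LocalDiffeo m M) (Y : LocalVectorField m M) :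
    LocalVectorField m M where
  dom := φ.source ∩ φ ⁻¹' Y.dom
  val x := if x ∈ φ.source ∩ φ ⁻¹' Y.dom then
      (mfderiv (𝓡 m) (𝓡 m) φ x).inverse (Y.val (φ x)) else 0
  isOpen_dom := φ.contMDiffOn.continuousOn.isOpen_inter_preimage φ.open_source Y.isOpen_dom
  contMDiffOn_val := by
    intro x hx
    have hφ : ContMDiffAt (𝓡 m) (𝓡 m) ∞ φ x :=
      (φ.contMDiffOn x hx.1).contMDiffAt (φ.open_source.mem_nhds hx.1)
    have hY : ContMDiffAt (𝓡 m) (𝓡 m).tangent ∞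
        (fun y => (⟨y, Y.val y⟩ : TangentBundle (𝓡 m) M)) (φ x) :=
      (Y.contMDiffOn_val _ hx.2).contMDiffAt (Y.isOpen_dom.mem_nhds hx.2)
    have key := ContMDiffAt.mpullback_vectorField_preimage (m := ∞) hY hφ
      (mfderiv_isInvertible φ hx.1) (by simp)
    refine key.contMDiffWithinAt.congr (fun y hy => ?_) ?_
    · simp only [VectorField.mpullback_apply, if_pos hy]
    · simp only [VectorField.mpullback_apply, if_pos hx]
  val_eq_zero x hx := if_neg hx

/-- A set of local vector fields is stable if it contains `(Fl^X_t)^* Y` for all its elements `X`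
and `Y` and all `t`. -/
def IsStable (W : Set (LocalVectorField m M)) : Prop :=
  ∀ X ∈ W, ∀ Y ∈ W, ∀ (t : ℝ) (φ : LocalDiffeo m M), IsFlowAt X t φ → pullback φ Y ∈ W

/-- `S(V)`: the minimal stable set of local vector fields containing `V`. -/
def stableHull (V : Set (LocalVectorField m M)) : Set (LocalVectorField m M) :=
  ⋂₀ {W | IsStable W ∧ V ⊆ W}

/-- A set of local diffeomorphisms is a pseudo-group if it contains the identity and is closed
under composition and inversion. -/
structure IsPseudogroup (G : Set (LocalDiffeo m M)) : Prop where
  id_mem : LocalDiffeo.id m M ∈ G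
  comp_mem : ∀ φ ∈ G, ∀ ψ ∈ G, ψ.trans φ ∈ G
  inv_mem : ∀ φ ∈ G, φ.symm ∈ G

/-- `G_V`: the smallest pseudo-group of local diffeomorphisms that contains the flows `Fl^X_t` of
all vector fields `X` in `V`. -/
def flowPseudogroup (V : Set (LocalVectorField m M)) : Set (LocalDiffeo m M) :=
  ⋂₀ {G | IsPseudogroup G ∧ ∀ X ∈ V, ∀ (t : ℝ) (φ : LocalDiffeo m M), IsFlowAt X t φ → φ ∈ G}

/-- The orbit through `x` of a set `G` of local diffeomorphisms. -/
def orbit (G : Set (LocalDiffeo m M)) (x : M) : Set M :=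
  {y | ∃ φ ∈ G, x ∈ φ.source ∧ φ x = y}

end Flows

section Distributions

variable (m M) in
/-- A (possibly singular) distribution on `M`: a linear subspace of each tangent space. -/
abbrev Distribution : Type u := (x : M) → Submodule ℝ (TangentSpace (𝓡 m) x)

/-- The distribution spanned by a set of local vector fields. -/
noncomputable def spannedBy [IsManifold (𝓡 m) ∞ M] (V : Set (LocalVectorField m M)) : Distribution m M :=
  fun x => Submodule.span ℝ {w | ∃ X ∈ V, x ∈ X.dom ∧ X.val x = w}

/-- `(N, i)` is an integral manifold of `H`: `N` is a connected (smooth, Hausdorff, paracompact)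
manifold of some dimension `n`, `i : N → M` is an injective immersion, and the image of
`T_p i` is `H_{i(p)}` for every `p`. -/
structure IsIntegralManifold (H : Distribution m M) (n : ℕ) {N : Type v} [TopologicalSpace N]
    [ChartedSpace (EuclideanSpace ℝ (Fin n)) N] (i : N → M) : Prop where
  isManifold : IsManifold (𝓡 n) ∞ N
  t2 : T2Space N
  paracompact : ParacompactSpace N
  connected : ConnectedSpace N
  injective : Function.Injective i
  contMDiff : ContMDiff (𝓡 n) (𝓡 m) ∞ i
  injective_mfderiv : ∀ p, Function.Injective (mfderiv (𝓡 n) (𝓡 m) i p)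
  range_mfderiv : ∀ p, (mfderiv (𝓡 n) (𝓡 m) i p).range = H (i p)

/-- `(N, i)` is a maximal integral manifold of `H`: an integral manifold that is not contained in
any strictly larger one. -/
structure IsMaximalIntegralManifold (H : Distribution m M) (n : ℕ) {N : Type u}
    [TopologicalSpace N] [ChartedSpace (EuclideanSpace ℝ (Fin n)) N] (i : N → M) : Prop where
  isIntegralManifold : IsIntegralManifold H n i
  maximal : ∀ (k : ℕ) (P : Type u) [TopologicalSpace P]
    [ChartedSpace (EuclideanSpace ℝ (Fin k)) P] (j : P → M),
    IsIntegralManifold H k j → range i ⊆ range j → range j = range i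

end Distributions

end SingularFoliation

/-! Let H be the distribution spanned by S(V). For Y in V and g in G_V the flow lines of g^*Y are
those of g⁻¹ ∘ Fl^Y_t ∘ g, so the pullback g^*Y moves points inside G_V-orbits. The fields that are
germwise such pullbacks form a stable set containing V (`isLocallyPullback_of_mem_stableHull`), and
G_V preserves H (`preservesDistribution_of_mem`). Hence the pullbacks alone span H
(`spannedBy_stableHull`), and the rank of H is constant on each orbit.

An integral disc through a point is built one dimension at a time. While its dimension is below the
rank, some pullback is transverse to it, and sweeping the disc along the flow of that pullback keeps
it tangent to H and inside the orbit (`IsOrbitPlaque.exists_prod`). At full rank, tangent means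
integral.

The rank may jump off the orbit, so Frobenius does not apply; local uniqueness comes from
`exists_local_factorization`. Let P be a transverse coordinate vanishing on the disc. Its
derivatives along the spanning fields vanish on the disc too, hence are bounded by a multiple of
|P|, and Gronwall forces P = 0 along any map that starts on the disc and is tangent to the span of
those fields. Such maps therefore factor smoothly through the disc, and the discs form a smooth
atlas on the orbit. The leaf topology is Hausdorff because the inclusion is continuous and
injective, connected because flow lines of V lift continuously (`connectedComponent_eq_of_flowsTo`),
and paracompact by Poincaré–Volterra (`secondCountableTopology_of_injective`).

By the same factorization an integral manifold meets every orbit in an open set, so, being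
connected, it lies in one orbit; and the bijection over M between two integral manifolds with the
same image is smooth both ways.

Smooth dependence of flows on initial values, used throughout, comes from the inverse function
theorem in the Banach space C([0,1], E). -/

open Filter Topology

/-! ### Inverse function theorem with smoothness on a whole neighbourhood -/

section InverseFunction

variable {E F : Type*} [NormedAddCommGroup E] [NormedSpace ℝ E] [CompleteSpace E]
  [NormedAddCommGroup F] [NormedSpace ℝ F]

/-- The inverse function theorem for smooth maps, with a local inverse that is smooth on its whole
domain. -/
theorem exists_openPartialHomeomorph_contDiffAt {f : E → F} {a : E} {f' : E ≃L[ℝ] F}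
    (hf : ∀ᶠ x in 𝓝 a, ContDiffAt ℝ ∞ f x) (hf' : HasFDerivAt f (f' : E →L[ℝ] F) a) :
    ∃ e : OpenPartialHomeomorph E F, a ∈ e.source ∧ (∀ x, e x = f x) ∧
      (∀ x ∈ e.source, ContDiffAt ℝ ∞ f x) ∧ ∀ y ∈ e.target, ContDiffAt ℝ ∞ e.symm y := by
  have hfa := hf.self_of_nhds
  set e₀ := hfa.toOpenPartialHomeomorph f hf' (by simp) with he₀
  have hcont : ContinuousAt (fderiv ℝ f) a := (hfa.fderiv_right (m := 0) (by simp)).continuousAt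
  -- Invertible operators form an open set, so the derivative stays invertible near `a`. On the
  -- smaller source the inverse is then smooth at every point of the target, not just at `f a`.
  have hinv : ∀ᶠ x in 𝓝 a, fderiv ℝ f x ∈ range ((↑) : (E ≃L[ℝ] F) → E →L[ℝ] F) := by
    apply hcont.eventually_mem
    rw [hf'.fderiv]
    exact ContinuousLinearEquiv.nhds f'
  obtain ⟨W, hW, hWo, haW⟩ := eventually_nhds_iff.mp (hf.and hinv)
  refine ⟨e₀.restrOpen W hWo, ⟨hfa.mem_toOpenPartialHomeomorph_source hf' (by simp), haW⟩,
    fun x => rfl, fun x hx => (hW x hx.2).1, fun y hy => ?_⟩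
  have hy' := (e₀.restrOpen W hWo).map_target hy
  obtain ⟨g, hg⟩ := (hW _ hy'.2).2
  refine (e₀.restrOpen W hWo).contDiffAt_symm (f₀' := g) hy ?_ (hW _ hy'.2).1
  rw [hg]
  exact ((hW _ hy'.2).1.differentiableAt (by simp)).hasFDerivAt

end InverseFunction

/-! ### Superposition operators on spaces of continuous functions -/

section Superposition

variable {K : Type*} [TopologicalSpace K] [CompactSpace K]
  {E F : Type*} [NormedAddCommGroup E] [NormedSpace ℝ E] [NormedAddCommGroup F] [NormedSpace ℝ F]

variable (K E F) in
/-- Pointwise application of a continuous family of operators to a continuous function. -/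
noncomputable def ContinuousMap.pointwiseApply : C(K, E →L[ℝ] F) →L[ℝ] C(K, E) →L[ℝ] C(K, F) :=
  LinearMap.mkContinuous₂
    (LinearMap.mk₂ ℝ (fun (A : C(K, E →L[ℝ] F)) (h : C(K, E)) => (⟨fun r => A r (h r), by fun_prop⟩ : C(K, F)))
      (fun _ _ _ => by ext; simp) (fun _ _ _ => by ext; simp) (fun _ _ _ => by ext; simp)
      (fun _ _ _ => by ext; simp)) 1
    (fun A h => by
      rw [one_mul, ContinuousMap.norm_le _ (by positivity)]
      intro r
      exact ((A r).le_opNorm _).trans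
        (mul_le_mul (A.norm_coe_le_norm r) (h.norm_coe_le_norm r) (norm_nonneg _) (norm_nonneg A)))

/-- The superposition operator of a `C¹` map is differentiable on the space of continuous
functions. -/
theorem hasFDerivAt_superposition {X : E → F} (hX : ContDiff ℝ 1 X) (f : C(K, E)) :
    HasFDerivAt (fun g : C(K, E) => (⟨X, hX.continuous⟩ : C(E, F)).comp g)
      (ContinuousMap.pointwiseApply K E F
        ((⟨fderiv ℝ X, hX.continuous_fderiv (by simp)⟩ : C(E, E →L[ℝ] F)).comp f)) f := by
  set DX : C(E, E →L[ℝ] F) := ⟨fderiv ℝ X, hX.continuous_fderiv (by simp)⟩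
  have hc : Continuous fun g : C(K, E) => DX.comp g := ContinuousMap.continuous_postcomp DX
  rw [hasFDerivAt_iff_isLittleO, Asymptotics.isLittleO_iff]
  intro ε hε
  obtain ⟨δ, hδ, H⟩ := (Metric.continuousAt_iff (f := fun g : C(K, E) => DX.comp g) (a := f)).mp
    hc.continuousAt ε hε
  filter_upwards [Metric.ball_mem_nhds f hδ] with g hg
  rw [ContinuousMap.norm_le _ (by positivity)]
  intro r
  -- Points of this segment are values at `r` of the functions `f + θ • (g - f)`, which stay within
  -- `δ` of `f`. This makes the estimate uniform in `r`, so the mean value inequality gives a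
  -- little-o in the sup norm.
  have hseg : ∀ x ∈ segment ℝ (f r) (g r), ‖fderiv ℝ X x - fderiv ℝ X (f r)‖ ≤ ε := by
    intro x hx
    rw [segment_eq_image'] at hx
    obtain ⟨θ, hθ, rfl⟩ := hx
    have h1 : dist (f + θ • (g - f)) f < δ := by
      rw [dist_eq_norm, add_sub_cancel_left, norm_smul, Real.norm_of_nonneg hθ.1]
      calc θ * ‖g - f‖ ≤ 1 * ‖g - f‖ := by gcongr; exact hθ.2
        _ < δ := by rw [one_mul, ← dist_eq_norm]; exact hg
    have h2 := (ContinuousMap.dist_apply_le_dist r).trans (H h1).le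
    rw [dist_eq_norm] at h2
    exact h2
  have := (convex_segment (𝕜 := ℝ) (f r) (g r)).norm_image_sub_le_of_norm_hasFDerivWithin_le'
    (f := X) (f' := fderiv ℝ X) (φ := fderiv ℝ X (f r)) (C := ε)
    (fun x _ => ((hX.differentiable (by simp)) x).hasFDerivAt.hasFDerivWithinAt) hseg
    (left_mem_segment ℝ _ _) (right_mem_segment ℝ _ _)
  refine this.trans ?_
  gcongr
  exact (g - f).norm_coe_le_norm r

/-- The superposition operator of a `Cⁿ` map is `Cⁿ` on the space of continuous functions. -/
theorem ContDiff.contDiff_superposition {K : Type*} [TopologicalSpace K] [CompactSpace K]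
    {E F : Type u} [NormedAddCommGroup E] [NormedSpace ℝ E] [NormedAddCommGroup F]
    [NormedSpace ℝ F] {X : E → F} (n : ℕ) (hX : ContDiff ℝ n X) :
    ContDiff ℝ n fun g : C(K, E) => (⟨X, hX.continuous⟩ : C(E, F)).comp g := by
  -- The derivative is again a superposition operator, by `fderiv ℝ X`, followed by a continuous
  -- linear map. Its codomain is `E →L[ℝ] F`, so `F` has to vary; the common universe of `E` and `F`
  -- keeps this codomain in the same universe.
  induction n generalizing F with
  | zero =>
    exact contDiff_zero.mpr (ContinuousMap.continuous_postcomp _)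
  | succ n ih =>
    have h1 : ContDiff ℝ 1 X := hX.of_le (by simp)
    have hD : ContDiff ℝ n (fderiv ℝ X) := hX.fderiv_right (by simp)
    push_cast
    rw [contDiff_succ_iff_hasFDerivAt]
    exact ⟨_, (ContinuousMap.pointwiseApply K E F).contDiff.comp (ih hD),
      hasFDerivAt_superposition h1⟩

theorem ContDiff.contDiff_infty_superposition {K : Type*} [TopologicalSpace K] [CompactSpace K]
    {E F : Type u} [NormedAddCommGroup E] [NormedSpace ℝ E] [NormedAddCommGroup F]
    [NormedSpace ℝ F] {X : E → F} (hX : ContDiff ℝ ∞ X) :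
    ContDiff ℝ ∞ fun g : C(K, E) => (⟨X, hX.continuous⟩ : C(E, F)).comp g :=
  contDiff_infty.mpr fun n => (hX.of_le (by exact_mod_cast le_top)).contDiff_superposition n

end Superposition

/-! ### Smooth dependence of flows on time and initial value, in a normed space -/

section LocalFlow

variable {E : Type u} [NormedAddCommGroup E] [NormedSpace ℝ E]

/-- A map which is smooth near a point agrees near that point with a globally smooth map. -/
theorem exists_contDiff_eventuallyEq [FiniteDimensional ℝ E] {F : Type*} [NormedAddCommGroup F]
    [NormedSpace ℝ F] {X : E → F} {x₀ : E} (hX : ∀ᶠ x in 𝓝 x₀, ContDiffAt ℝ ∞ X x) :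
    ∃ Y : E → F, ContDiff ℝ ∞ Y ∧ Y =ᶠ[𝓝 x₀] X := by
  obtain ⟨r, hr, H⟩ := Metric.eventually_nhds_iff_ball.mp hX
  let ρ : ContDiffBump x₀ := ⟨r / 3, r / 2, by positivity, by linarith⟩
  refine ⟨fun x => ρ x • X x, contDiff_iff_contDiffAt.mpr fun x => ?_, ?_⟩
  · by_cases hx : x ∈ Metric.ball x₀ r
    · exact ρ.contDiffAt.smul (H x hx)
    · have hx' : x ∈ (Metric.closedBall x₀ (r / 2))ᶜ := by
        simp only [Metric.mem_ball, mem_compl_iff, Metric.mem_closedBall] at hx ⊢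
        linarith
      refine (contDiffAt_const (c := (0 : F))).congr_of_eventuallyEq ?_
      filter_upwards [Metric.isClosed_closedBall.isOpen_compl.mem_nhds hx'] with z hz
      rw [ρ.zero_of_le_dist, zero_smul]
      simp only [mem_compl_iff, Metric.mem_closedBall, not_le] at hz
      exact hz.le
  · filter_upwards [ρ.eventuallyEq_one] with x hx
    simp [hx]

variable (E) in
/-- The constant functions, as a continuous linear map. -/
noncomputable def constCLM (K : Type*) [TopologicalSpace K] [CompactSpace K] : E →L[ℝ] C(K, E) :=
  LinearMap.mkContinuous
    { toFun := ContinuousMap.const K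
      map_add' := fun _ _ => rfl
      map_smul' := fun _ _ => rfl } 1 (fun x => by
        rw [one_mul, ContinuousMap.norm_le _ (norm_nonneg _)]
        exact fun _ => le_rfl)

@[simp]
theorem constCLM_apply {K : Type*} [TopologicalSpace K] [CompactSpace K] (x : E) (r : K) :
    constCLM E K x r = x := rfl

theorem continuous_comp_projIcc {E : Type*} [TopologicalSpace E] (f : C(Icc (0 : ℝ) 1, E)) :
    Continuous fun s => f (projIcc 0 1 zero_le_one s) :=
  f.continuous.comp continuous_projIcc

variable (E) in
/-- Integration from `0`, as a continuous linear operator on continuous functions on `[0, 1]`. -/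
noncomputable def primitiveCLM : C(Icc (0 : ℝ) 1, E) →L[ℝ] C(Icc (0 : ℝ) 1, E) :=
  LinearMap.mkContinuous
    { toFun := fun f => ⟨fun r => ∫ s in (0 : ℝ)..r, f (projIcc 0 1 zero_le_one s),
        (intervalIntegral.continuous_primitive
          (fun a b => (continuous_comp_projIcc f).intervalIntegrable a b) 0).comp
          continuous_subtype_val⟩
      map_add' := fun f g => by
        ext r
        exact intervalIntegral.integral_add ((continuous_comp_projIcc f).intervalIntegrable _ _)
          ((continuous_comp_projIcc g).intervalIntegrable _ _)
      map_smul' := fun c f => by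
        ext r
        exact intervalIntegral.integral_smul _ _ } 1 (fun f => by
      rw [one_mul, ContinuousMap.norm_le _ (norm_nonneg _)]
      intro r
      refine (intervalIntegral.norm_integral_le_of_norm_le_const
        (fun s _ => f.norm_coe_le_norm _)).trans ?_
      rw [sub_zero, abs_of_nonneg r.2.1]
      exact mul_le_of_le_one_right (norm_nonneg _) r.2.2)

theorem primitiveCLM_apply (f : C(Icc (0 : ℝ) 1, E)) (r : Icc (0 : ℝ) 1) :
    primitiveCLM E f r = ∫ s in (0 : ℝ)..r, f (projIcc 0 1 zero_le_one s) := rfl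

/-- The Picard operator in `((t, x), f)`, whose zeros are the solutions of `f' = t X(f)`,
`f 0 = x` on `[0, 1]`. -/
noncomputable def picardDefect (X : C(E, E)) (q : (ℝ × E) × C(Icc (0 : ℝ) 1, E)) :
    C(Icc (0 : ℝ) 1, E) :=
  q.2 - constCLM E _ q.1.2 - q.1.1 • primitiveCLM E (X.comp q.2)

/-- Rescaling time by `t`, of either sign, moves the integral curve to the fixed interval [0, 1] and
turns `t` into a parameter; the fundamental theorem of calculus does the rest. -/
theorem picardDefect_eq_zero {X : C(E, E)} [CompleteSpace E] {t : ℝ} {f : ℝ → E}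
    {A : C(Icc (0 : ℝ) 1, E)}
    (hA : ∀ r, A r = f (r * t)) (hf : ∀ r ∈ Icc (0 : ℝ) 1, HasDerivAt f (X (f (r * t))) (r * t)) :
    picardDefect X ((t, f 0), A) = 0 := by
  ext r
  have hd : ∀ s ∈ uIcc (0 : ℝ) r,
      HasDerivAt (fun s => f (s * t)) (t • X (A (projIcc 0 1 zero_le_one s))) s := by
    intro s hs
    rw [uIcc_of_le r.2.1] at hs
    have hs' : s ∈ Icc (0 : ℝ) 1 := ⟨hs.1, hs.2.trans r.2.2⟩
    rw [hA, projIcc_of_mem _ hs']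
    have := (hf s hs').scomp s (hasDerivAt_mul_const (x := s) t)
    exact this
  have hi : IntervalIntegrable (fun s => t • X (A (projIcc 0 1 zero_le_one s)))
      MeasureTheory.volume 0 r :=
    ((continuous_comp_projIcc (X.comp A)).const_smul t).intervalIntegrable _ _
  have key := intervalIntegral.integral_eq_sub_of_hasDerivAt hd hi
  rw [intervalIntegral.integral_smul] at key
  simp only [picardDefect, ContinuousMap.sub_apply, ContinuousMap.smul_apply, constCLM_apply,
    primitiveCLM_apply, ContinuousMap.comp_apply, ContinuousMap.zero_apply]
  rw [key, hA]
  simp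

theorem contDiff_picardDefect {X : E → E} (hX : ContDiff ℝ ∞ X) :
    ContDiff ℝ ∞ (picardDefect (⟨X, hX.continuous⟩ : C(E, E))) := by
  unfold picardDefect
  have h := hX.contDiff_infty_superposition (K := Icc (0 : ℝ) 1)
  have h1 : ContDiff ℝ ∞ fun q : (ℝ × E) × C(Icc (0 : ℝ) 1, E) =>
      primitiveCLM E ((⟨X, hX.continuous⟩ : C(E, E)).comp q.2) :=
    (primitiveCLM E).contDiff.comp (h.comp contDiff_snd)
  have h2 : ContDiff ℝ ∞ fun q : (ℝ × E) × C(Icc (0 : ℝ) 1, E) =>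
      constCLM E (Icc (0 : ℝ) 1) q.1.2 :=
    ((constCLM E (Icc (0 : ℝ) 1)).comp ((ContinuousLinearMap.snd ℝ ℝ E).comp
      (ContinuousLinearMap.fst ℝ (ℝ × E) C(Icc (0 : ℝ) 1, E)))).contDiff
  exact (contDiff_snd.sub h2).sub ((contDiff_fst.comp contDiff_fst).smul h1)

/-- At `t = 0` the nonlinear term carries the factor zero, so the partial derivative in the curve
variable is the identity and the derivative of the superposition operator never has to be computed.
-/
theorem hasFDerivAt_picardDefect {X : E → E} (hX : ContDiff ℝ ∞ X) (x : E)
    (f : C(Icc (0 : ℝ) 1, E)) :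
    HasFDerivAt (picardDefect (⟨X, hX.continuous⟩ : C(E, E)))
      (ContinuousLinearMap.snd ℝ (ℝ × E) _ - ((constCLM E (Icc (0 : ℝ) 1)).comp
        (ContinuousLinearMap.snd ℝ ℝ E) + (ContinuousLinearMap.fst ℝ ℝ E).smulRight
          (primitiveCLM E ((⟨X, hX.continuous⟩ : C(E, E)).comp f))).comp
            (ContinuousLinearMap.fst ℝ (ℝ × E) _)) ((0, x), f) := by
  unfold picardDefect
  have h := hX.contDiff_infty_superposition (K := Icc (0 : ℝ) 1)
  have h1 : DifferentiableAt ℝ (fun q : (ℝ × E) × C(Icc (0 : ℝ) 1, E) =>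
      primitiveCLM E ((⟨X, hX.continuous⟩ : C(E, E)).comp q.2)) ((0, x), f) :=
    ((primitiveCLM E).contDiff.comp (h.comp contDiff_snd)).differentiable (by simp) _
  have h2 := ((constCLM E (Icc (0 : ℝ) 1)).comp ((ContinuousLinearMap.snd ℝ ℝ E).comp
    (ContinuousLinearMap.fst ℝ (ℝ × E) C(Icc (0 : ℝ) 1, E)))).hasFDerivAt (x := ((0, x), f))
  have h3 := ((ContinuousLinearMap.fst ℝ ℝ E).comp
    (ContinuousLinearMap.fst ℝ (ℝ × E) C(Icc (0 : ℝ) 1, E))).hasFDerivAt (x := ((0, x), f))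
  refine ((hasFDerivAt_snd.sub h2).sub (h3.smul h1.hasFDerivAt)).congr_fderiv ?_
  ext q <;> simp

/-- The local flow of a smooth vector field on a normed space is smooth. -/
theorem ContDiff.exists_smooth_localFlow [CompleteSpace E] {X : E → E} (hX : ContDiff ℝ ∞ X)
    (x₀ : E) :
    ∃ F : ℝ × E → E, ∀ᶠ p in 𝓝 ((0 : ℝ), x₀), ContDiffAt ℝ ∞ F p ∧ F (0, p.2) = p.2 ∧
      HasDerivAt (fun s => F (s, p.2)) (X (F p)) p.1 := by
  classical
  obtain ⟨ε, hε, a, r, L, K, hr, hpl⟩ :=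
    IsPicardLindelof.of_contDiffAt_one ((hX.of_le (by simp)).contDiffAt (x := x₀))
  obtain ⟨α, hα, hαc⟩ := (hpl 0).exists_forall_mem_closedBall_eq_hasDerivWithinAt_continuousOn
  simp only [zero_sub, zero_add] at hα hαc
  have hrange : ∀ᶠ p in 𝓝 ((0 : ℝ), x₀), p.1 ∈ Ioo (-ε) ε ∧ p.2 ∈ Metric.ball x₀ r :=
    (isOpen_Ioo.prod Metric.isOpen_ball).mem_nhds
      ⟨⟨by simpa using hε, hε⟩, Metric.mem_ball_self (by exact_mod_cast hr)⟩
  have hder : ∀ p : ℝ × E, p.1 ∈ Ioo (-ε) ε → p.2 ∈ Metric.ball x₀ r →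
      HasDerivAt (fun s => α (p.2, s)) (X (α (p.2, p.1))) p.1 := fun p h1 h2 =>
    ((hα p.2 (Metric.ball_subset_closedBall h2)).2 p.1 (Ioo_subset_Icc_self h1)).hasDerivAt
      (Icc_mem_nhds h1.1 h1.2)
  have hmul : ∀ {t s : ℝ}, t ∈ Ioo (-ε) ε → s ∈ Icc (0 : ℝ) 1 → s * t ∈ Ioo (-ε) ε := by
    intro t s ht hs
    rw [mem_Ioo, ← abs_lt] at ht ⊢
    rw [abs_mul, abs_of_nonneg hs.1]
    exact (mul_le_of_le_one_left (abs_nonneg _) hs.2).trans_lt ht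
  let A : ℝ × E → C(Icc (0 : ℝ) 1, E) := fun p =>
    if h : p.1 ∈ Ioo (-ε) ε ∧ p.2 ∈ Metric.ball x₀ r then
      ⟨fun s => α (p.2, s * p.1), continuous_iff_continuousAt.mpr fun s =>
        ContinuousAt.comp (g := fun t => α (p.2, t))
          (hder (s * p.1, p.2) (hmul h.1 s.2) h.2).continuousAt (by fun_prop)⟩
    else 0
  have hA : ∀ p : ℝ × E, p.1 ∈ Ioo (-ε) ε → p.2 ∈ Metric.ball x₀ r →
      ∀ s, A p s = α (p.2, s * p.1) := by
    intro p h1 h2 s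
    simp only [A, dif_pos (And.intro h1 h2), ContinuousMap.coe_mk]
  have hα0 : α (x₀, 0) = x₀ := (hα x₀ (Metric.mem_closedBall_self r.2)).1
  -- The local inverse below only recognizes solutions close to the constant curve `x₀`, so
  -- closeness is needed in the sup norm. It follows from joint continuity of `α`, since scaling the
  -- time by `s ∈ [0, 1]` does not leave the ball.
  have hAt : Tendsto A (𝓝 ((0 : ℝ), x₀)) (𝓝 (constCLM E _ x₀)) := by
    rw [Metric.tendsto_nhds]
    intro η hη
    have hc : ContinuousAt (fun p : ℝ × E => α (p.2, p.1)) (0, x₀) := by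
      refine ContinuousAt.comp (g := α) (hαc.continuousAt ?_) (by fun_prop)
      exact prod_mem_nhds (Metric.closedBall_mem_nhds _ (by exact_mod_cast hr))
        (Icc_mem_nhds (by simpa using hε) hε)
    have hc' := Metric.tendsto_nhds.mp hc (η / 2) (by positivity)
    simp only [hα0] at hc'
    obtain ⟨δ, hδ, H⟩ := Metric.eventually_nhds_iff_ball.mp (hc'.and hrange)
    filter_upwards [Metric.ball_mem_nhds _ hδ] with p hp
    refine ((ContinuousMap.dist_le (by positivity)).mpr fun s => ?_).trans_lt (half_lt_self hη)
    have hps := (H p hp).2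
    rw [hA p hps.1 hps.2, constCLM_apply]
    refine (H (s * p.1, p.2) ?_).1.le
    rw [Metric.mem_ball, Prod.dist_eq, max_lt_iff] at hp ⊢
    refine ⟨?_, hp.2⟩
    have h1 := hp.1
    simp only [Real.dist_eq, sub_zero] at h1 ⊢
    rw [abs_mul, abs_of_nonneg s.2.1]
    exact (mul_le_of_le_one_left (abs_nonneg _) s.2.2).trans_lt h1
  have hzero : ∀ᶠ p in 𝓝 ((0 : ℝ), x₀),
      picardDefect (⟨X, hX.continuous⟩ : C(E, E)) (p, A p) = 0 := by
    filter_upwards [hrange] with p hp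
    have h0 := (hα p.2 (Metric.ball_subset_closedBall hp.2)).1
    have := picardDefect_eq_zero (X := ⟨X, hX.continuous⟩) (t := p.1) (f := fun s => α (p.2, s))
      (A := A p) (hA p hp.1 hp.2)
      (fun s hs => hder (s * p.1, p.2) (hmul hp.1 hs) hp.2)
    rwa [h0] at this
  -- the inverse function theorem for `(p, f) ↦ (p, picardDefect X (p, f))`
  let f₀ : C(Icc (0 : ℝ) 1, E) := constCLM E _ x₀
  let B : ℝ × E →L[ℝ] C(Icc (0 : ℝ) 1, E) := (constCLM E (Icc (0 : ℝ) 1)).comp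
        (ContinuousLinearMap.snd ℝ ℝ E) + (ContinuousLinearMap.fst ℝ ℝ E).smulRight
          (primitiveCLM E ((⟨X, hX.continuous⟩ : C(E, E)).comp f₀))
  -- The derivative `(p, f) ↦ (p, f - B p)` is triangular with identities on the diagonal, hence
  -- invertible.
  let Θ' := ContinuousLinearEquiv.skewProd (ContinuousLinearEquiv.refl ℝ (ℝ × E))
    (ContinuousLinearEquiv.refl ℝ C(Icc (0 : ℝ) 1, E)) (-B)
  have hΘ : ContDiff ℝ ∞ fun q : (ℝ × E) × C(Icc (0 : ℝ) 1, E) =>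
      (q.1, picardDefect (⟨X, hX.continuous⟩ : C(E, E)) q) :=
    contDiff_fst.prodMk (contDiff_picardDefect hX)
  have hΘ' : HasFDerivAt (fun q : (ℝ × E) × C(Icc (0 : ℝ) 1, E) =>
      (q.1, picardDefect (⟨X, hX.continuous⟩ : C(E, E)) q))
      (Θ' : (ℝ × E) × C(Icc (0 : ℝ) 1, E) →L[ℝ] (ℝ × E) × C(Icc (0 : ℝ) 1, E)) ((0, x₀), f₀) := by
    refine (hasFDerivAt_fst.prodMk (hasFDerivAt_picardDefect hX x₀ f₀)).congr_fderiv ?_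
    ext q <;> simp [Θ', B]
  obtain ⟨e, hes, he, -, hsymm⟩ := exists_openPartialHomeomorph_contDiffAt
    (Eventually.of_forall fun q => hΘ.contDiffAt) hΘ'
  have hpair : Tendsto (fun p => (p, A p)) (𝓝 ((0 : ℝ), x₀)) (𝓝 ((0, x₀), f₀)) :=
    tendsto_id.prodMk_nhds hAt
  -- Since `(p, A p)` is sent to `(p, 0)`, the smooth local inverse recovers `A p` from `p`.
  -- Evaluating the curve at 1 then gives back `α (p.2, p.1)`.
  have hsol : ∀ᶠ p in 𝓝 ((0 : ℝ), x₀), (p, (0 : C(Icc (0 : ℝ) 1, E))) ∈ e.target ∧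
      e.symm (p, 0) = (p, A p) := by
    filter_upwards [hpair.eventually (e.open_source.mem_nhds hes), hzero] with p h1 h2
    have h3 := he (p, A p)
    simp only [h2] at h3
    rw [← h3]
    exact ⟨e.map_source h1, e.left_inv h1⟩
  let ev : C(Icc (0 : ℝ) 1, E) →L[ℝ] E := ContinuousMap.evalCLM ℝ (⟨1, by simp⟩ : Icc (0 : ℝ) 1)
  refine ⟨fun p => α (p.2, p.1), ?_⟩
  filter_upwards [hrange, (hsol.and hrange).eventually_nhds] with p hp hs
  refine ⟨?_, (hα p.2 (Metric.ball_subset_closedBall hp.2)).1, hder p hp.1 hp.2⟩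
  have h1 : ContDiffAt ℝ ∞ (fun p : ℝ × E => ev (e.symm (p, 0)).2) p :=
    ev.contDiff.contDiffAt.comp p (contDiff_snd.contDiffAt.comp p
      ((hsymm _ hs.self_of_nhds.1.1).comp p (contDiffAt_id.prodMk contDiffAt_const)))
  refine h1.congr_of_eventuallyEq ?_
  filter_upwards [hs] with q hq
  rw [hq.1.2]
  change _ = A q ⟨1, _⟩
  rw [hA q hq.2.1 hq.2.2, one_mul]

/-- The local flow of a vector field which is smooth near a point is smooth near that point. -/
theorem exists_smooth_localFlow [FiniteDimensional ℝ E] {X : E → E} {x₀ : E}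
    (hX : ∀ᶠ x in 𝓝 x₀, ContDiffAt ℝ ∞ X x) :
    ∃ F : ℝ × E → E, ∀ᶠ p in 𝓝 ((0 : ℝ), x₀), ContDiffAt ℝ ∞ F p ∧ F (0, p.2) = p.2 ∧
      HasDerivAt (fun s => F (s, p.2)) (X (F p)) p.1 := by
  have : CompleteSpace E := FiniteDimensional.complete ℝ E
  obtain ⟨Y, hY, hYX⟩ := exists_contDiff_eventuallyEq hX
  obtain ⟨F, hF⟩ := hY.exists_smooth_localFlow x₀
  refine ⟨F, ?_⟩
  have hc : Tendsto F (𝓝 (0, x₀)) (𝓝 x₀) := by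
    have := hF.self_of_nhds.1.continuousAt.tendsto
    rwa [hF.self_of_nhds.2.1] at this
  filter_upwards [hF, hc.eventually hYX] with p hp hq
  exact ⟨hp.1, hp.2.1, hq ▸ hp.2.2⟩

end LocalFlow

/-! ### Local factorization of tangent maps through an immersion -/

section Plaques

variable {E E' F C : Type*} [NormedAddCommGroup E] [NormedSpace ℝ E] [NormedAddCommGroup E']
  [NormedSpace ℝ E'] [NormedAddCommGroup F] [NormedSpace ℝ F] [NormedAddCommGroup C]
  [NormedSpace ℝ C] {ι : Type*} [Fintype ι]

/-- Coefficients with respect to linearly independent continuous fields are locally bounded. -/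
theorem exists_norm_coeff_le [FiniteDimensional ℝ F] {X : ι → F → F} {y : F}
    (hX : ∀ i, ContinuousAt (X i) y) (hli : LinearIndependent ℝ fun i => X i y) :
    ∃ K : ℝ, 0 ≤ K ∧ ∀ᶠ z in 𝓝 y, ∀ c : ι → ℝ, ‖c‖ ≤ K * ‖∑ i, c i • X i z‖ := by
  let A : F → (ι → ℝ) →L[ℝ] F := fun z =>
    ∑ i, (ContinuousLinearMap.proj (R := ℝ) (φ := fun _ : ι => ℝ) i).smulRight (X i z)
  have hA : ∀ z c, A z c = ∑ i, c i • X i z := by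
    intro z c
    simp [A]
  have hAc : ContinuousAt A y := by
    refine tendsto_finsetSum _ fun i _ => ?_
    exact ((ContinuousLinearMap.smulRightL ℝ (ι → ℝ) F
      (ContinuousLinearMap.proj (R := ℝ) (φ := fun _ : ι => ℝ) i)).continuous.continuousAt).comp
      (hX i)
  have hker : (A y).ker = ⊥ := by
    rw [LinearMap.ker_eq_bot']
    intro c hc
    have hc' : ∑ i, c i • X i y = 0 := by rw [← hA]; exact hc
    ext i
    exact Fintype.linearIndependent_iff.mp hli c hc' i
  obtain ⟨K, hK0, hK⟩ := LinearMap.exists_antilipschitzWith (A y : (ι → ℝ) →ₗ[ℝ] F) hker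
  have hK' : ∀ c, ‖c‖ ≤ K * ‖A y c‖ := fun c => by
    simpa using hK.le_mul_dist c 0
  have hKpos : (0 : ℝ) < K := by exact_mod_cast hK0
  -- Moving `A y` by less than `1 / (2 * K)` in operator norm costs at most half of its lower bound,
  -- hence the factor 2.
  refine ⟨2 * K, by positivity, ?_⟩
  have h1 : ∀ᶠ z in 𝓝 y, dist (A z) (A y) < 1 / (2 * K) :=
    Metric.tendsto_nhds.mp hAc _ (by positivity)
  filter_upwards [h1] with z hz c
  rw [← hA]
  have h2 : ‖A y c‖ ≤ ‖A z c‖ + 1 / (2 * K) * ‖c‖ := by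
    have h3 : ‖(A z - A y) c‖ ≤ 1 / (2 * K) * ‖c‖ :=
      ((A z - A y).le_opNorm c).trans (by rw [dist_eq_norm] at hz; gcongr)
    have h4 : A y c = A z c - (A z - A y) c := by simp
    rw [h4]
    exact (norm_sub_le _ _).trans (by gcongr)
  have h5 := (hK' c).trans (mul_le_mul_of_nonneg_left h2 hKpos.le)
  have h6 : (K : ℝ) * (‖A z c‖ + 1 / (2 * K) * ‖c‖) = K * ‖A z c‖ + ‖c‖ / 2 := by
    field_simp
  linarith

/-- Straightening: an immersion is, up to a local diffeomorphism, the inclusion of a factor. -/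
theorem exists_straightening [FiniteDimensional ℝ E] [FiniteDimensional ℝ F] {f : E → F} {a : E}
    (hf : ∀ᶠ e in 𝓝 a, ContDiffAt ℝ ∞ f e) (hinj : Function.Injective (fderiv ℝ f a)) :
    ∃ (C : Submodule ℝ F) (Φ : OpenPartialHomeomorph (E × C) F), (a, 0) ∈ Φ.source ∧
      (∀ e, Φ (e, 0) = f e) ∧ (∀ q ∈ Φ.source, ContDiffAt ℝ ∞ Φ q) ∧
      ∀ z ∈ Φ.target, ContDiffAt ℝ ∞ Φ.symm z := by
  have : CompleteSpace E := FiniteDimensional.complete ℝ E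
  -- The straightening map is `(e, c) ↦ f e + c` with `c` in a complement of the tangent space, so
  -- its derivative at `(a, 0)` is bijective.
  obtain ⟨C, hC⟩ := Submodule.exists_isCompl (fderiv ℝ f a).range
  have : CompleteSpace C := FiniteDimensional.complete ℝ C
  let L : E × C →ₗ[ℝ] F := (fderiv ℝ f a : E →ₗ[ℝ] F).coprod C.subtype
  have hL : Function.Bijective L := by
    constructor
    · rw [← LinearMap.ker_eq_bot, LinearMap.ker_coprod_of_disjoint_range _ _
        (by rw [Submodule.range_subtype]; exact hC.disjoint), LinearMap.ker_eq_bot.mpr hinj,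
        Submodule.ker_subtype, Submodule.prod_bot]
    · rw [← LinearMap.range_eq_top, LinearMap.range_coprod, Submodule.range_subtype]
      exact hC.sup_eq_top
  let L' : (E × C) ≃L[ℝ] F := (LinearEquiv.ofBijective L hL).toContinuousLinearEquiv
  have hd : HasFDerivAt (fun q : E × C => f q.1 + (q.2 : F)) (L' : E × C →L[ℝ] F) (a, 0) := by
    have h1 : HasFDerivAt (fun q : E × C => f q.1)
        ((fderiv ℝ f a).comp (ContinuousLinearMap.fst ℝ E C)) (a, 0) :=
      HasFDerivAt.comp (g := f) (a, (0 : C))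
        (hf.self_of_nhds.differentiableAt (by simp)).hasFDerivAt hasFDerivAt_fst
    have h2 : HasFDerivAt (fun q : E × C => (q.2 : F))
        (C.subtypeL.comp (ContinuousLinearMap.snd ℝ E C)) (a, 0) :=
      (C.subtypeL.comp (ContinuousLinearMap.snd ℝ E C)).hasFDerivAt
    refine (h1.add h2).congr_fderiv ?_
    ext q
    · rfl
    · rfl
  have hs : ∀ᶠ q in 𝓝 (a, (0 : C)), ContDiffAt ℝ ∞ (fun q : E × C => f q.1 + (q.2 : F)) q := by
    have : Tendsto (fun q : E × C => q.1) (𝓝 (a, (0 : C))) (𝓝 a) := continuous_fst.continuousAt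
    filter_upwards [this.eventually hf] with q hq
    exact (ContDiffAt.comp (g := f) q hq contDiffAt_fst).add
      (C.subtypeL.contDiff.contDiffAt.comp q contDiffAt_snd)
  obtain ⟨Φ, h1, h2, h3, h4⟩ := exists_openPartialHomeomorph_contDiffAt hs hd
  refine ⟨C, Φ, h1, fun e => by simp [h2], fun q hq => ?_, h4⟩
  have : (Φ : E × C → F) = fun q => f q.1 + (q.2 : F) := funext h2
  rw [this]
  exact h3 q hq

/-- A function which vanishes on the leaf and whose derivatives along fields tangent to the leaf
grow at most linearly in the function itself vanishes along curves tangent to the fields. -/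
theorem eventually_eq_zero_of_fderiv_le {P : F → C} {f' : E' → F} {a' : E'} {D : F → Submodule ℝ F}
    (hf' : ∀ᶠ e in 𝓝 a', ContDiffAt ℝ ∞ f' e) (hP : ∀ᶠ z in 𝓝 (f' a'), DifferentiableAt ℝ P z)
    (h0 : P (f' a') = 0) {K : ℝ} (hK0 : 0 ≤ K)
    (hK : ∀ᶠ z in 𝓝 (f' a'), ∀ w ∈ D z, ‖fderiv ℝ P z w‖ ≤ K * ‖w‖ * ‖P z‖)
    (hD : ∀ᶠ e in 𝓝 a', ∀ v, fderiv ℝ f' e v ∈ D (f' e)) :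
    ∀ᶠ e in 𝓝 a', P (f' e) = 0 := by
  have hc : Tendsto f' (𝓝 a') (𝓝 (f' a')) := hf'.self_of_nhds.continuousAt
  have hbd : ∀ᶠ e in 𝓝 a', ‖fderiv ℝ f' e‖ < ‖fderiv ℝ f' a'‖ + 1 :=
    (hf'.self_of_nhds.fderiv_right (m := 0) (by simp)).continuousAt.norm.eventually
      (gt_mem_nhds (lt_add_one _))
  obtain ⟨δ, hδ, H⟩ := Metric.eventually_nhds_iff_ball.mp
    (((hf'.and hbd).and (hc.eventually (hP.and hK))).and hD)
  filter_upwards [Metric.ball_mem_nhds _ hδ] with e he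
  set M := ‖fderiv ℝ f' a'‖ + 1
  let c : ℝ → E' := fun t => a' + t • (e - a')
  have hcd : ∀ t, HasDerivAt c (e - a') t := fun t => by
    simpa [c] using ((hasDerivAt_id t).smul_const (e - a')).const_add a'
  have hcm : ∀ t ∈ Icc (0 : ℝ) 1, c t ∈ Metric.ball a' δ := by
    intro t ht
    rw [mem_ball_iff_norm] at he ⊢
    simp only [c, add_sub_cancel_left, norm_smul, Real.norm_of_nonneg ht.1]
    exact (mul_le_of_le_one_left (norm_nonneg _) ht.2).trans_lt he
  have hu : ∀ t ∈ Icc (0 : ℝ) 1, HasDerivAt (fun t => P (f' (c t)))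
      (fderiv ℝ P (f' (c t)) (fderiv ℝ f' (c t) (e - a'))) t := by
    intro t ht
    have h := H _ (hcm t ht)
    exact h.1.2.1.hasFDerivAt.comp_hasDerivAt t
      ((h.1.1.1.differentiableAt (by simp)).hasFDerivAt.comp_hasDerivAt t (hcd t))
  -- Gronwall along the straight segment from `a'` to `e`: the function starts at zero and its
  -- derivative is bounded by a constant times its own norm.
  have key := eq_zero_of_abs_deriv_le_mul_abs_self_of_eq_zero_right
    (f := fun t => P (f' (c t))) (K := K * (M * ‖e - a'‖)) (a := 0) (b := 1)
    (fun t ht => (hu t ht).continuousAt.continuousWithinAt)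
    (fun t ht => (hu t (Ico_subset_Icc_self ht)).hasDerivWithinAt)
    (by simpa [c] using h0)
    (fun t ht => by
      have h := H _ (hcm t (Ico_subset_Icc_self ht))
      refine (h.1.2.2 _ (h.2 _)).trans ?_
      gcongr
      exact (ContinuousLinearMap.le_opNorm _ _).trans (by gcongr; exact h.1.1.2.le))
    1 (by simp)
  simpa [c] using key

/-- Let `f` be an immersion whose tangent spaces contain fields `X i`, linearly independent at
`f a`. A smooth map `f'` through `f a` with tangent spaces in the span of the `X i` factors locally
through `f`. -/
theorem exists_local_factorization [FiniteDimensional ℝ E] [FiniteDimensional ℝ F]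
    {X : ι → F → F} {f : E → F} {f' : E' → F} {a : E} {a' : E'}
    (hf : ∀ᶠ e in 𝓝 a, ContDiffAt ℝ ∞ f e) (hf' : ∀ᶠ e in 𝓝 a', ContDiffAt ℝ ∞ f' e)
    (h0 : f' a' = f a) (hinj : Function.Injective (fderiv ℝ f a))
    (hX : ∀ i, ContDiffAt ℝ 1 (X i) (f a)) (hli : LinearIndependent ℝ fun i => X i (f a))
    (htan : ∀ᶠ e in 𝓝 a, ∀ i, X i (f e) ∈ (fderiv ℝ f e).range)
    (hspan : ∀ᶠ e in 𝓝 a', ∀ v, fderiv ℝ f' e v ∈ Submodule.span ℝ (range fun i => X i (f' e))) :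
    ∃ g : E' → E, g a' = a ∧ ∀ᶠ e in 𝓝 a', ContDiffAt ℝ ∞ g e ∧ f (g e) = f' e := by
  obtain ⟨C, Φ, ha, hΦf, hΦ, hΦs⟩ := exists_straightening hf hinj
  have hΦa : Φ (a, 0) = f a := hΦf a
  have hat : f a ∈ Φ.target := hΦa ▸ Φ.map_source ha
  have hsa : Φ.symm (f a) = (a, 0) := by rw [← hΦa, Φ.left_inv ha]
  -- The transverse coordinate of the straightening: in `Φ.target`, a zero of `P` is a value of `f`.
  let P : F → C := fun z => (Φ.symm z).2
  have hP : ∀ z ∈ Φ.target, ContDiffAt ℝ ∞ P z := fun z hz => contDiffAt_snd.comp z (hΦs z hz)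
  have hPf : ∀ᶠ e in 𝓝 a, P (f e) = 0 := by
    have : Tendsto (fun e : E => (e, (0 : C))) (𝓝 a) (𝓝 (a, 0)) :=
      (Continuous.prodMk_left 0).continuousAt
    filter_upwards [this.eventually (Φ.open_source.mem_nhds ha)] with e he
    simp only [P]
    rw [← hΦf, Φ.left_inv he]
  -- the derivatives of `P` along the fields vanish on the image of `f`
  have hvan : ∀ᶠ e in 𝓝 a, ∀ i, fderiv ℝ P (f e) (X i (f e)) = 0 := by
    have hfc : Tendsto f (𝓝 a) (𝓝 (f a)) := hf.self_of_nhds.continuousAt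
    filter_upwards [hf, htan, hPf.eventually_nhds, hfc.eventually (Φ.open_target.mem_nhds hat)]
      with e h1 h2 h3 h4 i
    obtain ⟨w, hw⟩ := h2 i
    have h5 : HasFDerivAt (P ∘ f) ((fderiv ℝ P (f e)).comp (fderiv ℝ f e)) e :=
      ((hP _ h4).differentiableAt (by simp)).hasFDerivAt.comp e
        (h1.differentiableAt (by simp)).hasFDerivAt
    have h6 : HasFDerivAt (P ∘ f) (0 : E →L[ℝ] C) e :=
      (hasFDerivAt_const (0 : C) e).congr_of_eventuallyEq h3
    have h7 := congrArg (fun T : E →L[ℝ] C => T w) (h5.unique h6)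
    change fderiv ℝ P (f e) (fderiv ℝ f e w) = 0 at h7
    rw [← hw]
    exact h7
  -- In straightened coordinates the derivative of `P` along `X i` is C¹, hence locally Lipschitz,
  -- and vanishes at the projection of a point to the plaque. The distance from the point to this
  -- projection is exactly `‖P z‖`.
  have hlip : ∀ i, ∃ K : ℝ, 0 ≤ K ∧ ∀ᶠ z in 𝓝 (f a), ‖fderiv ℝ P z (X i z)‖ ≤ K * ‖P z‖ := by
    intro i
    have h1 : ContDiffAt ℝ 1 (fun z => fderiv ℝ P z (X i z)) (f a) :=
      ((hP _ hat).fderiv_right (m := 1) 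
      (WithTop.coe_le_coe.mpr (le_top : (2 : ℕ∞) ≤ ⊤))).clm_apply (hX i)
    have h2 : ContDiffAt ℝ 1 (fun q => fderiv ℝ P (Φ q) (X i (Φ q))) (a, 0) := by
      have := (hΦ _ ha).of_le (m := 1) (by simp)
      exact ContDiffAt.comp (g := fun z => fderiv ℝ P z (X i z)) _ (by rwa [hΦa]) this
    obtain ⟨K, t, ht, hK⟩ := h2.exists_lipschitzOnWith
    refine ⟨K, K.2, ?_⟩
    have hs : Tendsto Φ.symm (𝓝 (f a)) (𝓝 (a, 0)) := hsa ▸ (hΦs _ hat).continuousAt.tendsto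
    have hs1 : Tendsto (fun z => (Φ.symm z).1) (𝓝 (f a)) (𝓝 a) :=
      (continuous_fst.tendsto _).comp hs
    have hs2 : Tendsto (fun z => ((Φ.symm z).1, (0 : C))) (𝓝 (f a)) (𝓝 (a, 0)) :=
      hs1.prodMk_nhds tendsto_const_nhds
    filter_upwards [Φ.open_target.mem_nhds hat, hs.eventually ht, hs2.eventually ht,
      hs1.eventually hvan] with z h3 h4 h5 h6
    have h7 := hK.dist_le_mul _ h4 _ h5
    simp only [Φ.right_inv h3, hΦf, h6 i, dist_zero_right] at h7
    refine h7.trans_eq ?_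
    rw [Prod.dist_eq, dist_self, dist_zero_right, max_eq_right (norm_nonneg _)]
  choose Kl hKl0 hKl using hlip
  obtain ⟨Kc, hKc0, hKc⟩ := exists_norm_coeff_le (fun i => (hX i).continuousAt) hli
  -- The bounds for the single fields pass to their span because the coefficients of `w` are
  -- controlled by `‖w‖`.
  have hbound : ∀ᶠ z in 𝓝 (f a), ∀ w ∈ Submodule.span ℝ (range fun i => X i z),
      ‖fderiv ℝ P z w‖ ≤ (Kc * ∑ i, Kl i) * ‖w‖ * ‖P z‖ := by
    filter_upwards [eventually_all.mpr hKl, hKc] with z h1 h2 w hw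
    obtain ⟨c, rfl⟩ := (Submodule.mem_span_range_iff_exists_fun ℝ).mp hw
    rw [map_sum]
    calc ‖∑ i, fderiv ℝ P z (c i • X i z)‖
        ≤ ∑ i, ‖fderiv ℝ P z (c i • X i z)‖ := norm_sum_le _ _
      _ ≤ ∑ i, (Kc * ‖∑ i, c i • X i z‖) * (Kl i * ‖P z‖) := by
          refine Finset.sum_le_sum fun i _ => ?_
          rw [map_smul, norm_smul]
          exact mul_le_mul ((norm_le_pi_norm c i).trans (h2 c)) (h1 i) (norm_nonneg _)
            (by positivity)
      _ = _ := by rw [← Finset.mul_sum, ← Finset.sum_mul]; ring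
  have hzero : ∀ᶠ e in 𝓝 a', P (f' e) = 0 := by
    refine eventually_eq_zero_of_fderiv_le (K := Kc * ∑ i, Kl i)
      (D := fun z => Submodule.span ℝ (range fun i => X i z)) hf' ?_ ?_
      (mul_nonneg hKc0 (Finset.sum_nonneg fun i _ => hKl0 i)) (h0 ▸ hbound) hspan
    · rw [h0]
      filter_upwards [Φ.open_target.mem_nhds hat] with z hz
      exact (hP z hz).differentiableAt (by simp)
    · rw [h0]
      exact hPf.self_of_nhds
  have hf'c : Tendsto f' (𝓝 a') (𝓝 (f a)) := h0 ▸ hf'.self_of_nhds.continuousAt.tendsto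
  refine ⟨fun e => (Φ.symm (f' e)).1, by simp only [h0, hsa], ?_⟩
  filter_upwards [hzero, hf', hf'c.eventually (Φ.open_target.mem_nhds hat)] with e h1 h2 h3
  refine ⟨contDiffAt_fst.comp e ((hΦs _ h3).comp e h2), ?_⟩
  rw [← hΦf]
  have h4 : ((Φ.symm (f' e)).1, (0 : C)) = Φ.symm (f' e) := Prod.ext rfl h1.symm
  rw [h4, Φ.right_inv h3]

end Plaques

/-! ### Uniqueness of integral curves and the groupoid laws of the flow -/

namespace SingularFoliation

variable {m : ℕ} {M : Type u} [TopologicalSpace M] [ChartedSpace (EuclideanSpace ℝ (Fin m)) M]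
  [IsManifold (𝓡 m) ∞ M]

section Groupoid

theorem LocalVectorField.contMDiffAt_val (X : LocalVectorField m M) {x : M} (hx : x ∈ X.dom) :
    ContMDiffAt (𝓡 m) (𝓡 m).tangent ∞
      (fun x => (⟨x, X.val x⟩ : TangentBundle (𝓡 m) M)) x :=
  (X.contMDiffOn_val x hx).contMDiffAt (X.isOpen_dom.mem_nhds hx)

/-- Integral curves of a local vector field are unique. -/
theorem eqOn_of_isMIntegralCurveOn [T2Space M] {X : LocalVectorField m M} {γ γ' : ℝ → M}
    {a b t₀ : ℝ} (ht₀ : t₀ ∈ Ioo a b) (hdom : ∀ t ∈ Ioo a b, γ t ∈ X.dom)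
    (hγ : IsMIntegralCurveOn γ X.val (Ioo a b)) (hγ' : IsMIntegralCurveOn γ' X.val (Ioo a b))
    (h : γ t₀ = γ' t₀) : EqOn γ γ' (Ioo a b) := by
  intro t ht
  -- Agreement at one time is transported along the interval. Near a time of agreement the curves
  -- agree by local uniqueness; near a time of disagreement they disagree because `M` is Hausdorff.
  -- So the implication holds in both directions between nearby times.
  refine (isPreconnected_Ioo (a := a) (b := b)).induction₂'
    (P := fun s s' => γ s = γ' s → γ s' = γ' s') (fun s hs => ?_)
    (fun _ _ _ _ _ _ h1 h2 h => h2 (h1 h)) ht₀ ht h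
  have hsn := isOpen_Ioo.mem_nhds hs
  rw [isOpen_Ioo.nhdsWithin_eq hs]
  by_cases heq : γ s = γ' s
  · have := isMIntegralCurveAt_eventuallyEq_of_contMDiffAt_boundaryless (t₀ := s)
      ((X.contMDiffAt_val (hdom s hs)).of_le (by simp)) (hγ.isMIntegralCurveAt hsn)
      (hγ'.isMIntegralCurveAt hsn) heq
    filter_upwards [this] with s' hs'
    exact ⟨fun _ => hs', fun _ => heq⟩
  · have h1 := (hγ.isMIntegralCurveAt hsn).continuousAt
    have h2 := (hγ'.isMIntegralCurveAt hsn).continuousAt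
    filter_upwards [(h1.tendsto.prodMk_nhds h2.tendsto).eventually
      (isClosed_diagonal.isOpen_compl.mem_nhds heq)] with s' hs'
    exact ⟨fun h => absurd h heq, fun h => absurd h hs'⟩

variable {X Y : LocalVectorField m M} {x y z : M} {s t : ℝ}

theorem FlowsTo.mem_dom (h : FlowsTo X t x y) : x ∈ X.dom := by
  obtain ⟨γ, a, b, ha, hb, -, rfl, -, hd, -⟩ := h
  exact hd 0 ⟨ha, hb⟩

theorem FlowsTo.mem_dom_right (h : FlowsTo X t x y) : y ∈ X.dom := by
  obtain ⟨γ, a, b, -, -, ht, -, rfl, hd, -⟩ := h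
  exact hd t ht

theorem FlowsTo.unique [T2Space M] (h : FlowsTo X t x y) (h' : FlowsTo X t x z) : y = z := by
  obtain ⟨γ, a, b, ha, hb, ht, h0, rfl, hd, hγ⟩ := h
  obtain ⟨γ', a', b', ha', hb', ht', h0', rfl, hd', hγ'⟩ := h'
  have hsub : Ioo (max a a') (min b b') ⊆ Ioo a b :=
    Ioo_subset_Ioo (le_max_left _ _) (min_le_left _ _)
  have hsub' : Ioo (max a a') (min b b') ⊆ Ioo a' b' :=
    Ioo_subset_Ioo (le_max_right _ _) (min_le_right _ _)
  exact eqOn_of_isMIntegralCurveOn (t₀ := 0) ⟨max_lt ha ha', lt_min hb hb'⟩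
    (fun s hs => hd s (hsub hs)) (hγ.mono hsub) (hγ'.mono hsub') (h0.trans h0'.symm)
    ⟨max_lt ht.1 ht'.1, lt_min ht.2 ht'.2⟩

theorem FlowsTo.symm (h : FlowsTo X t x y) : FlowsTo X (-t) y x := by
  obtain ⟨γ, a, b, ha, hb, ht, rfl, rfl, hd, hγ⟩ := h
  refine ⟨γ ∘ (· + t), a - t, b - t, by linarith [ht.1], by linarith [ht.2],
    ⟨by linarith, by linarith⟩, by simp, by simp,
    fun s hs => hd _ ⟨by linarith [hs.1], by linarith [hs.2]⟩, (hγ.comp_add t).mono fun s hs => ?_⟩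
  exact ⟨by linarith [hs.1], by linarith [hs.2]⟩

/-- The first curve is glued to the second one shifted by `s`. Both intervals contain `s`, so their
union is an interval, and uniqueness gives agreement on the overlap. -/
theorem FlowsTo.trans [T2Space M] (h : FlowsTo X s x y) (h' : FlowsTo X t y z) :
    FlowsTo X (s + t) x z := by
  classical
  obtain ⟨γ, a, b, ha, hb, hs, h0, hy, hd, hγ⟩ := h
  obtain ⟨γ', a', b', ha', hb', ht, h0', rfl, hd', hγ'⟩ := h'
  set δ : ℝ → M := γ' ∘ (· + -s) with hδ
  have hδd : ∀ r ∈ Ioo (a' + s) (b' + s), δ r ∈ X.dom :=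
    fun r hr => hd' _ ⟨by linarith [hr.1], by linarith [hr.2]⟩
  have hδγ : IsMIntegralCurveOn δ X.val (Ioo (a' + s) (b' + s)) :=
    (hγ'.comp_add (-s)).mono fun r hr => ⟨by linarith [hr.1], by linarith [hr.2]⟩
  have hover : ∀ r, r ∈ Ioo a b → r ∈ Ioo (a' + s) (b' + s) → γ r = δ r := by
    intro r hr hr'
    have hsub : Ioo (max a (a' + s)) (min b (b' + s)) ⊆ Ioo a b :=
      Ioo_subset_Ioo (le_max_left _ _) (min_le_left _ _)
    have hsub' : Ioo (max a (a' + s)) (min b (b' + s)) ⊆ Ioo (a' + s) (b' + s) :=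
      Ioo_subset_Ioo (le_max_right _ _) (min_le_right _ _)
    refine eqOn_of_isMIntegralCurveOn (t₀ := s)
      ⟨max_lt hs.1 (by linarith), lt_min hs.2 (by linarith)⟩
      (fun s hs => hd s (hsub hs)) (hγ.mono hsub) (hδγ.mono hsub') ?_
      ⟨max_lt hr.1 hr'.1, lt_min hr.2 hr'.2⟩
    simp [hδ, hy, h0']
  have hcov : ∀ r ∈ Ioo (min a (a' + s)) (max b (b' + s)),
      r ∈ Ioo a b ∨ r ∈ Ioo (a' + s) (b' + s) := by
    intro r hr
    rcases lt_or_ge r s with hrs | hrs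
    · rcases min_lt_iff.mp hr.1 with h | h
      · exact Or.inl ⟨h, by linarith [hs.2]⟩
      · exact Or.inr ⟨h, by linarith⟩
    · rcases lt_max_iff.mp hr.2 with h | h
      · exact Or.inl ⟨by linarith [hs.1], h⟩
      · exact Or.inr ⟨by linarith, h⟩
  set σ : ℝ → M := fun r => if r ∈ Ioo a b then γ r else δ r with hσ
  have hσ1 : EqOn σ γ (Ioo a b) := fun r hr => if_pos hr
  have hσ2 : EqOn σ δ (Ioo (a' + s) (b' + s)) := by
    intro r hr
    by_cases hr' : r ∈ Ioo a b
    · rw [hσ1 hr', hover r hr' hr]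
    · exact if_neg hr'
  have hst : s + t ∈ Ioo (a' + s) (b' + s) := ⟨by linarith [ht.1], by linarith [ht.2]⟩
  refine ⟨σ, min a (a' + s), max b (b' + s), min_lt_of_left_lt ha, lt_max_of_lt_left hb,
    ⟨min_lt_of_right_lt hst.1, lt_max_of_lt_right hst.2⟩, ?_, ?_, ?_, ?_⟩
  · rw [hσ1 ⟨ha, hb⟩, h0]
  · rw [hσ2 hst]
    simp [hδ]
  · intro r hr
    rcases hcov r hr with h | h
    · rw [hσ1 h]; exact hd r h
    · rw [hσ2 h]; exact hδd r h
  · refine IsMIntegralCurveAt.isMIntegralCurveOn fun r hr => ?_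
    have aux : ∀ {τ : ℝ → M} {U : Set ℝ}, IsOpen U → EqOn σ τ U → IsMIntegralCurveOn τ X.val U →
        r ∈ U → IsMIntegralCurveAt σ X.val r := by
      intro τ U hU he hτ hrU
      rw [isMIntegralCurveAt_iff]
      refine ⟨U, hU.mem_nhds hrU, fun q hq => ?_⟩
      rw [he hq]
      exact (hτ q hq).congr_of_eventuallyEq (eventually_mem_nhdsWithin.mono he) (he hq)
    rcases hcov r hr with h | h
    · exact aux isOpen_Ioo hσ1 hγ h
    · exact aux isOpen_Ioo hσ2 hδγ h

/-- Flow lines of a restriction of a vector field are flow lines. -/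
theorem FlowsTo.mono (hdom : Y.dom ⊆ X.dom) (hval : ∀ x ∈ Y.dom, Y.val x = X.val x)
    (h : FlowsTo Y t x y) : FlowsTo X t x y := by
  obtain ⟨γ, a, b, ha, hb, ht, h0, h1, hd, hγ⟩ := h
  refine ⟨γ, a, b, ha, hb, ht, h0, h1, fun s hs => hdom (hd s hs), fun s hs => ?_⟩
  rw [← hval _ (hd s hs)]
  exact hγ s hs

theorem FlowsTo.zero_eq [T2Space M] (h : FlowsTo X 0 x y) : y = x := by
  obtain ⟨γ, a, b, ha, hb, ht, h0, h1, hd, hγ⟩ := h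
  rw [← h0, ← h1]

theorem IsFlowAt.mem_source {φ : LocalDiffeo m M} (h : IsFlowAt X t φ) (hxy : FlowsTo X t x y) :
    x ∈ φ.source := by
  rw [h.1]
  exact ⟨y, hxy⟩

end Groupoid

end SingularFoliation

/-! ### Differentials of diffeomorphisms between open sets -/

section PartialDiffeo

variable {E F H G : Type*} [NormedAddCommGroup E] [NormedSpace ℝ E] [NormedAddCommGroup F]
  [NormedSpace ℝ F] [TopologicalSpace H] [TopologicalSpace G] {I : ModelWithCorners ℝ E H}
  {J : ModelWithCorners ℝ F G} {M N : Type*} [TopologicalSpace M] [ChartedSpace H M]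
  [TopologicalSpace N] [ChartedSpace G N] (φ : PartialDiffeomorph I J M N ∞)

namespace PartialDiffeomorph

theorem contMDiffAt {x : M} (hx : x ∈ φ.source) : ContMDiffAt I J ∞ φ x :=
  (φ.contMDiffOn x hx).contMDiffAt (φ.open_source.mem_nhds hx)

theorem contMDiffAt_symm {y : N} (hy : y ∈ φ.target) : ContMDiffAt J I ∞ φ.symm y :=
  φ.symm.contMDiffAt hy

theorem map_source {x : M} (hx : x ∈ φ.source) : φ x ∈ φ.target := φ.map_source' hx

theorem symm_apply_apply {x : M} (hx : x ∈ φ.source) : φ.symm (φ x) = x := φ.left_inv' hx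

theorem apply_symm_apply {y : N} (hy : y ∈ φ.target) : φ (φ.symm y) = y := φ.right_inv' hy

theorem mfderiv_symm_apply_mfderiv {x : M} (hx : x ∈ φ.source) (v : TangentSpace I x) :
    mfderiv J I φ.symm (φ x) (mfderiv I J φ x v) = v := by
  have h1 : HasMFDerivAt I I (φ.symm ∘ φ) x
      ((mfderiv J I φ.symm (φ x)).comp (mfderiv I J φ x)) :=
    HasMFDerivAt.comp x ((φ.contMDiffAt_symm (φ.map_source hx)).mdifferentiableAt
      (by simp)).hasMFDerivAt ((φ.contMDiffAt hx).mdifferentiableAt (by simp)).hasMFDerivAt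
  have h2 : HasMFDerivAt I I (φ.symm ∘ φ) x (ContinuousLinearMap.id ℝ (TangentSpace I x)) := by
    refine (hasMFDerivAt_id x).congr_of_eventuallyEq ?_
    filter_upwards [φ.open_source.mem_nhds hx] with z hz
    exact φ.symm_apply_apply hz
  exact DFunLike.congr_fun (hasMFDerivAt_unique h1 h2) v

theorem mfderiv_apply_mfderiv_symm {y : N} (hy : y ∈ φ.target) (v : TangentSpace J y) :
    mfderiv I J φ (φ.symm y) (mfderiv J I φ.symm y v) = v :=
  φ.symm.mfderiv_symm_apply_mfderiv hy v

theorem isInvertible_mfderiv {x : M} (hx : x ∈ φ.source) : (mfderiv I J φ x).IsInvertible :=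
  have h : IsLocalDiffeomorphAt I J ∞ φ x := ⟨φ, hx, Set.eqOn_refl _ _⟩
  ⟨h.mfderivToContinuousLinearEquiv (by simp), rfl⟩

theorem mfderiv_inverse_apply {x : M} (hx : x ∈ φ.source) (w : TangentSpace J (φ x)) :
    (mfderiv I J φ x).inverse w = mfderiv J I φ.symm (φ x) w := by
  have := φ.mfderiv_apply_mfderiv_symm (φ.map_source hx) w
  rw [φ.symm_apply_apply hx] at this
  exact (φ.isInvertible_mfderiv hx).inverse_apply_eq.mpr this.symm

end PartialDiffeomorph

end PartialDiffeo

/-! ### Vector fields in charts and short-time flows on a manifold -/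

namespace SingularFoliation

variable {m : ℕ} {M : Type u} [TopologicalSpace M] [ChartedSpace (EuclideanSpace ℝ (Fin m)) M]
  [IsManifold (𝓡 m) ∞ M]

/-- The preferred chart at a point, as a diffeomorphism between open sets. -/
noncomputable def chartDiffeo (m : ℕ) {M : Type u} [TopologicalSpace M]
    [ChartedSpace (EuclideanSpace ℝ (Fin m)) M] [IsManifold (𝓡 m) ∞ M] (x : M) :
    PartialDiffeomorph (𝓡 m) (𝓡 m) M (EuclideanSpace ℝ (Fin m)) ∞ where
  toPartialEquiv := (chartAt (EuclideanSpace ℝ (Fin m)) x).toPartialEquiv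
  open_source := (chartAt (EuclideanSpace ℝ (Fin m)) x).open_source
  open_target := (chartAt (EuclideanSpace ℝ (Fin m)) x).open_target
  contMDiffOn_toFun := contMDiffOn_chart
  contMDiffOn_invFun := contMDiffOn_chart_symm

theorem mem_chartDiffeo_source (x : M) : x ∈ (chartDiffeo m x).source :=
  mem_chart_source _ x

/-- A local vector field in the coordinates of the preferred chart at `x₀`. -/
noncomputable def LocalVectorField.inChart (X : LocalVectorField m M) (x₀ : M)
    (u : EuclideanSpace ℝ (Fin m)) : EuclideanSpace ℝ (Fin m) :=
  (mfderiv (𝓡 m) (𝓡 m) (chartDiffeo m x₀).symm u).inverse (X.val ((chartDiffeo m x₀).symm u))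

theorem LocalVectorField.contDiffAt_inChart (X : LocalVectorField m M) {x₀ : M}
    {u : EuclideanSpace ℝ (Fin m)} (hu : u ∈ (chartDiffeo m x₀).target)
    (hX : (chartDiffeo m x₀).symm u ∈ X.dom) : ContDiffAt ℝ ∞ (X.inChart x₀) u := by
  refine (contMDiffAt_vectorSpace_iff_contDiffAt (V := X.inChart x₀)).mp ?_
  exact ContMDiffAt.mpullback_vectorField_preimage (m := ∞) (X.contMDiffAt_val hX)
    ((chartDiffeo m x₀).contMDiffAt_symm hu) ((chartDiffeo m x₀).symm.isInvertible_mfderiv hu) (by simp)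

theorem LocalVectorField.mfderiv_symm_inChart (X : LocalVectorField m M) {x₀ : M}
    {u : EuclideanSpace ℝ (Fin m)} (hu : u ∈ (chartDiffeo m x₀).target) :
    mfderiv (𝓡 m) (𝓡 m) (chartDiffeo m x₀).symm u (X.inChart x₀ u) =
      X.val ((chartDiffeo m x₀).symm u) :=
  ((chartDiffeo m x₀).symm.isInvertible_mfderiv hu).self_apply_inverse _

theorem LocalVectorField.inChart_apply (X : LocalVectorField m M) {x₀ z : M}
    (hz : z ∈ (chartDiffeo m x₀).source) :
    X.inChart x₀ (chartDiffeo m x₀ z) = mfderiv (𝓡 m) (𝓡 m) (chartDiffeo m x₀) z (X.val z) := by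
  have h1 := (chartDiffeo m x₀).map_source hz
  have h2 := (chartDiffeo m x₀).mfderiv_apply_mfderiv_symm h1 (X.inChart x₀ (chartDiffeo m x₀ z))
  rw [X.mfderiv_symm_inChart h1, (chartDiffeo m x₀).symm_apply_apply hz] at h2
  exact h2.symm

/-- The local flow of a local vector field is smooth. -/
theorem exists_localFlow (X : LocalVectorField m M) {x₀ : M} (hx₀ : x₀ ∈ X.dom) :
    ∃ F : ℝ × M → M, ∀ᶠ p in 𝓝 ((0 : ℝ), x₀),
      ContMDiffAt (𝓘(ℝ, ℝ).prod (𝓡 m)) (𝓡 m) ∞ F p ∧ FlowsTo X p.1 p.2 (F p) := by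
  set c := chartDiffeo m x₀ with hc
  have hx := mem_chartDiffeo_source (m := m) x₀
  have hcx := c.map_source hx
  have hgood : ∀ᶠ u in 𝓝 (c x₀), u ∈ c.target ∧ c.symm u ∈ X.dom := by
    refine (c.open_target.eventually_mem hcx).and ?_
    refine (c.contMDiffAt_symm hcx).continuousAt.eventually_mem (X.isOpen_dom.mem_nhds ?_)
    rwa [c.symm_apply_apply hx]
  obtain ⟨F, hF⟩ := exists_smooth_localFlow (X := X.inChart x₀) (x₀ := c x₀)
    (hgood.mono fun u hu => X.contDiffAt_inChart hu.1 hu.2)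
  have hFc : Tendsto F (𝓝 (0, c x₀)) (𝓝 (c x₀)) := by
    have := hF.self_of_nhds.1.continuousAt.tendsto
    rwa [hF.self_of_nhds.2.1] at this
  -- A product neighbourhood is needed: `FlowsTo` at time `t` asks for the whole curve on an
  -- interval around 0 and `t`, so the estimates must hold for all `s ∈ (-ε, ε)` at the same
  -- starting point.
  obtain ⟨U, hU, W, hW, H⟩ := eventually_prod_iff.mp
    ((nhds_prod_eq (x := (0 : ℝ)) (y := c x₀)) ▸ (hF.and (hFc.eventually hgood)))
  obtain ⟨ε, hε, hUε⟩ := Metric.eventually_nhds_iff_ball.mp hU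
  have hWc : ∀ᶠ z in 𝓝 x₀, z ∈ c.source ∧ W (c z) :=
    (c.open_source.eventually_mem hx).and ((c.contMDiffAt hx).continuousAt.eventually hW)
  refine ⟨fun p => c.symm (F (p.1, c p.2)), ?_⟩
  rw [nhds_prod_eq]
  have hball : ∀ᶠ t in 𝓝 (0 : ℝ), t ∈ Metric.ball (0 : ℝ) ε := Metric.ball_mem_nhds _ hε
  refine (hball.prod_mk hWc).mono ?_
  rintro ⟨t, z⟩ ⟨ht, hz, hWz⟩
  have hHt : ∀ s ∈ Ioo (-ε) ε, _ := fun s hs =>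
    H (hUε s (by rwa [Real.ball_eq_Ioo, zero_sub, zero_add])) hWz
  have ht' : t ∈ Ioo (-ε) ε := by rwa [Real.ball_eq_Ioo, zero_sub, zero_add] at ht
  refine ⟨?_, fun s => c.symm (F (s, c z)), -ε, ε, by linarith, hε, ht', ?_, rfl,
    fun s hs => (hHt s hs).2.2, fun s hs => ?_⟩
  · have h := hHt t ht'
    refine ContMDiffAt.comp (g := c.symm) (t, z) (c.contMDiffAt_symm h.2.1) ?_
    refine ContMDiffAt.comp (g := F) (I' := 𝓘(ℝ, ℝ × EuclideanSpace ℝ (Fin m))) (t, z)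
      h.1.1.contMDiffAt ?_
    exact contMDiffAt_fst.prodMk_space ((c.contMDiffAt hz).comp (t, z) contMDiffAt_snd)
  · have h := hHt 0 ⟨by linarith, hε⟩
    simp only
    rw [h.1.2.1, c.symm_apply_apply hz]
  · have h := hHt s hs
    have h1 := h.1.2.2
    have h2 : HasMFDerivAt 𝓘(ℝ, ℝ) (𝓡 m) (c.symm ∘ fun s => F (s, c z)) s
        ((mfderiv (𝓡 m) (𝓡 m) c.symm (F (s, c z))).comp
          (ContinuousLinearMap.smulRight (1 : ℝ →L[ℝ] ℝ) (X.inChart x₀ (F (s, c z))))) :=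
      HasMFDerivAt.comp s ((c.contMDiffAt_symm h.2.1).mdifferentiableAt (by simp)).hasMFDerivAt
        h1.hasFDerivAt.hasMFDerivAt
    refine HasMFDerivAt.hasMFDerivWithinAt ?_
    refine h2.congr_mfderiv (ContinuousLinearMap.ext fun (r : ℝ) => ?_)
    refine (map_smul (mfderiv (𝓡 m) (𝓡 m) c.symm (F (s, c z))) r
      (X.inChart x₀ (F (s, c z)))).trans ?_
    exact congrArg (fun w => r • w) (X.mfderiv_symm_inChart h.2.1)

end SingularFoliation

/-! ### The flow at all times as a local diffeomorphism -/

namespace SingularFoliation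

variable {m : ℕ} {M : Type u} [TopologicalSpace M] [ChartedSpace (EuclideanSpace ℝ (Fin m)) M]
  [IsManifold (𝓡 m) ∞ M] [T2Space M] {X : LocalVectorField m M} {t : ℝ} {x y : M}

/-- A property of germs which is stable under composition and holds for flows at small times holds
for flows at all times. -/
theorem FlowsTo.exists_of_local {Q : (M → M) → M → Prop}
    (hcomp : ∀ F F' z, Q F z → Q F' (F z) → Q (F' ∘ F) z)
    (hcont : ∀ F z, Q F z → ContinuousAt F z)
    (hloc : ∀ z ∈ X.dom, ∀ᶠ p in 𝓝 ((0 : ℝ), z),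
      ∃ F, Q F p.2 ∧ ∀ᶠ w in 𝓝 p.2, FlowsTo X p.1 w (F w))
    (h : FlowsTo X t x y) : ∃ F, Q F x ∧ ∀ᶠ w in 𝓝 x, FlowsTo X t w (F w) := by
  have hx := h.mem_dom
  obtain ⟨γ, a, b, ha, hb, ht, rfl, rfl, hd, hγ⟩ := h
  have hflow : ∀ s ∈ Ioo a b, FlowsTo X s (γ 0) (γ s) :=
    fun s hs => ⟨γ, a, b, ha, hb, hs, rfl, rfl, hd, hγ⟩
  -- The set of good times contains 0. A flow germ at time `s₁` followed by a short flow germ at `γ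
  -- s₁` is a flow germ at time `s₂`.
  let S : ℝ → Prop := fun s => ∃ F, Q F (γ 0) ∧ ∀ᶠ w in 𝓝 (γ 0), FlowsTo X s w (F w)
  have hstep : ∀ s₁ ∈ Ioo a b, ∀ s₂ : ℝ,
      (∃ F, Q F (γ s₁) ∧ ∀ᶠ w in 𝓝 (γ s₁), FlowsTo X (s₂ - s₁) w (F w)) → S s₁ → S s₂ := by
    rintro s₁ hs₁ s₂ ⟨F', hQ', hF'⟩ ⟨F, hQ, hF⟩
    have hF0 : F (γ 0) = γ s₁ := hF.self_of_nhds.unique (hflow s₁ hs₁)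
    rw [← hF0] at hQ' hF'
    refine ⟨F' ∘ F, hcomp _ _ _ hQ hQ', ?_⟩
    filter_upwards [hF, (hcont _ _ hQ).eventually hF'] with w h1 h2
    have h3 := h1.trans h2
    rwa [add_sub_cancel] at h3
  have h0 : S 0 := (hloc _ hx).self_of_nhds
  refine (isPreconnected_Ioo (a := a) (b := b)).induction₂' (P := fun s s' => S s → S s')
    (fun s hs => ?_) (fun _ _ _ _ _ _ h1 h2 h => h2 (h1 h)) ⟨ha, hb⟩ ht h0
  rw [isOpen_Ioo.nhdsWithin_eq hs]
  have hc : ContinuousAt γ s := (hγ.isMIntegralCurveAt (isOpen_Ioo.mem_nhds hs)).continuousAt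
  have h1 : Tendsto (fun s' => (s' - s, γ s)) (𝓝 s) (𝓝 (0, γ s)) := by
    have : ContinuousAt (fun s' : ℝ => (s' - s, γ s)) s := by fun_prop
    simpa using this.tendsto
  have h2 : Tendsto (fun s' => (s - s', γ s')) (𝓝 s) (𝓝 (0, γ s)) := by
    have : ContinuousAt (fun s' : ℝ => (s - s', γ s')) s := by fun_prop
    simpa using this.tendsto
  -- Going from `s` to `s'` uses a short flow based at `γ s`, going back one based at `γ s'`. Both
  -- are covered by the hypothesis at `γ s`, as it holds for base points near `γ s`.
  filter_upwards [h1.eventually (hloc _ (hd s hs)), h2.eventually (hloc _ (hd s hs)),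
    isOpen_Ioo.mem_nhds hs] with s' h3 h4 h5
  exact ⟨hstep s hs s' h3, hstep s' h5 s h4⟩

/-- The flow of a local vector field is defined and smooth near each point of its domain. -/
theorem FlowsTo.exists_smooth (h : FlowsTo X t x y) :
    ∃ F : M → M, ContMDiffAt (𝓡 m) (𝓡 m) ∞ F x ∧ ∀ᶠ w in 𝓝 x, FlowsTo X t w (F w) := by
  refine h.exists_of_local (Q := fun F z => ContMDiffAt (𝓡 m) (𝓡 m) ∞ F z)
    (fun F F' z h1 h2 => ContMDiffAt.comp z h2 h1) (fun F z h => h.continuousAt) fun z hz => ?_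
  obtain ⟨F, hF⟩ := exists_localFlow X hz
  filter_upwards [hF.eventually_nhds] with p hp
  refine ⟨fun w => F (p.1, w), ?_, ?_⟩
  · exact ContMDiffAt.comp (g := F) p.2 hp.self_of_nhds.1 (contMDiffAt_const.prodMk contMDiffAt_id)
  · have hc : ContinuousAt (fun w : M => (p.1, w)) p.2 := by fun_prop
    filter_upwards [hc.eventually hp] with w hw
    exact hw.2

open Classical in
/-- The time-`t` map of the maximal local flow, extended by the identity. -/
noncomputable def flowMap (X : LocalVectorField m M) (t : ℝ) (x : M) : M :=
  if h : ∃ y, FlowsTo X t x y then h.choose else x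

theorem FlowsTo.flowMap_eq (h : FlowsTo X t x y) : flowMap X t x = y := by
  have h' : ∃ y, FlowsTo X t x y := ⟨y, h⟩
  rw [flowMap, dif_pos h']
  exact h'.choose_spec.unique h

theorem flowsTo_flowMap (h : ∃ y, FlowsTo X t x y) : FlowsTo X t x (flowMap X t x) := by
  obtain ⟨y, hy⟩ := h
  rwa [hy.flowMap_eq]

theorem isOpen_flow_domain (X : LocalVectorField m M) (t : ℝ) :
    IsOpen {x | ∃ y, FlowsTo X t x y} := by
  rw [isOpen_iff_mem_nhds]
  rintro x ⟨y, h⟩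
  obtain ⟨F, -, hF⟩ := h.exists_smooth
  exact hF.mono fun w hw => ⟨_, hw⟩

theorem contMDiffOn_flowMap (X : LocalVectorField m M) (t : ℝ) :
    ContMDiffOn (𝓡 m) (𝓡 m) ∞ (flowMap X t) {x | ∃ y, FlowsTo X t x y} := by
  rintro x ⟨y, h⟩
  obtain ⟨F, hF', hF⟩ := h.exists_smooth
  exact (hF'.congr_of_eventuallyEq (hF.mono fun w hw => hw.flowMap_eq)).contMDiffWithinAt

/-- The time-`t` map of the maximal local flow, as a local diffeomorphism. -/
noncomputable def flowDiffeo (X : LocalVectorField m M) (t : ℝ) : LocalDiffeo m M where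
  toFun := flowMap X t
  invFun := flowMap X (-t)
  source := {x | ∃ y, FlowsTo X t x y}
  target := {x | ∃ y, FlowsTo X (-t) x y}
  map_source' := fun _ h => ⟨_, (flowsTo_flowMap h).symm⟩
  map_target' := fun x h => ⟨x, by simpa using (flowsTo_flowMap h).symm⟩
  left_inv' := fun _ h => (flowsTo_flowMap h).symm.flowMap_eq
  right_inv' := fun x h => by
    have := (flowsTo_flowMap h).symm
    rw [neg_neg] at this
    exact this.flowMap_eq
  open_source := isOpen_flow_domain X t
  open_target := isOpen_flow_domain X (-t)
  contMDiffOn_toFun := contMDiffOn_flowMap X t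
  contMDiffOn_invFun := contMDiffOn_flowMap X (-t)

theorem isFlowAt_flowDiffeo (X : LocalVectorField m M) (t : ℝ) : IsFlowAt X t (flowDiffeo X t) :=
  ⟨rfl, fun _ h => flowsTo_flowMap h⟩

theorem IsFlowAt.symm {φ : LocalDiffeo m M} (h : IsFlowAt X t φ) : IsFlowAt X (-t) φ.symm := by
  have h1 : ∀ y ∈ φ.target, FlowsTo X (-t) y (φ.symm y) := by
    intro y hy
    have := (h.2 _ (φ.symm.map_source hy)).symm
    rwa [φ.apply_symm_apply hy] at this
  refine ⟨Set.Subset.antisymm (fun y hy => ⟨_, h1 y hy⟩) ?_, h1⟩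
  rintro y ⟨x, hx⟩
  have hx' : FlowsTo X t x y := by simpa using hx.symm
  have hs : x ∈ φ.source := by rw [h.1]; exact ⟨y, hx'⟩
  rw [hx'.unique (h.2 x hs)]
  exact φ.map_source hs

theorem IsFlowAt.apply_eq {φ : LocalDiffeo m M} (h : IsFlowAt X t φ) (hxy : FlowsTo X t x y) :
    φ x = y :=
  (h.2 x (h.mem_source hxy)).unique hxy

end SingularFoliation

/-! ### Pullbacks of vector fields -/

namespace SingularFoliation

variable {m : ℕ} {M : Type u} [TopologicalSpace M] [ChartedSpace (EuclideanSpace ℝ (Fin m)) M]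

section Pullback

theorem hasMFDerivAt_of_mem_source (φ : LocalDiffeo m M) {x : M} (hx : x ∈ φ.source) :
    HasMFDerivAt (𝓡 m) (𝓡 m) φ x (mfderiv (𝓡 m) (𝓡 m) φ x) :=
  ((φ.contMDiffAt hx).mdifferentiableAt (by simp)).hasMFDerivAt

theorem mem_trans_source {φ ψ : LocalDiffeo m M} {x : M} (hx : x ∈ φ.source)
    (hx' : φ x ∈ ψ.source) : x ∈ (φ.trans ψ).source := ⟨hx, hx'⟩

theorem mfderiv_trans_apply {φ ψ : LocalDiffeo m M} {x : M} (hx : x ∈ (φ.trans ψ).source)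
    (v : TangentSpace (𝓡 m) x) :
    mfderiv (𝓡 m) (𝓡 m) (φ.trans ψ) x v =
      mfderiv (𝓡 m) (𝓡 m) ψ (φ x) (mfderiv (𝓡 m) (𝓡 m) φ x v) :=
  DFunLike.congr_fun (HasMFDerivAt.comp x (hasMFDerivAt_of_mem_source ψ hx.2)
    (hasMFDerivAt_of_mem_source φ hx.1)).mfderiv v

/-- `φ` maps the distribution `H` into itself. -/
def PreservesDistribution (H : Distribution m M) (φ : LocalDiffeo m M) : Prop :=
  ∀ x ∈ φ.source, ∀ y, φ x = y → ∀ v ∈ H x, (mfderiv (𝓡 m) (𝓡 m) φ x v : TangentSpace (𝓡 m) y) ∈ H y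

theorem PreservesDistribution.trans {H : Distribution m M} {φ ψ : LocalDiffeo m M}
    (hφ : PreservesDistribution H φ) (hψ : PreservesDistribution H ψ) :
    PreservesDistribution H (φ.trans ψ) := by
  rintro x hx y rfl v hv
  rw [mfderiv_trans_apply hx]
  exact hψ _ hx.2 _ rfl _ (hφ x hx.1 _ rfl v hv)

variable [IsManifold (𝓡 m) ∞ M]

theorem pullback_dom (φ : LocalDiffeo m M) (Y : LocalVectorField m M) :
    (pullback φ Y).dom = φ.source ∩ φ ⁻¹' Y.dom := rfl

theorem pullback_val {φ : LocalDiffeo m M} {Y : LocalVectorField m M} {x : M}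
    (hx : x ∈ (pullback φ Y).dom) :
    (pullback φ Y).val x = mfderiv (𝓡 m) (𝓡 m) φ.symm (φ x) (Y.val (φ x)) :=
  (if_pos hx).trans (φ.mfderiv_inverse_apply hx.1 _)

theorem mfderiv_pullback_val {φ : LocalDiffeo m M} {Y : LocalVectorField m M} {x : M}
    (hx : x ∈ (pullback φ Y).dom) :
    mfderiv (𝓡 m) (𝓡 m) φ x ((pullback φ Y).val x) = Y.val (φ x) := by
  have h : (pullback φ Y).val x = (mfderiv (𝓡 m) (𝓡 m) φ x).inverse (Y.val (φ x)) := if_pos hx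
  rw [h]
  exact (φ.isInvertible_mfderiv hx.1).self_apply_inverse _

theorem eq_pullback_val {φ : LocalDiffeo m M} {Y : LocalVectorField m M} {x : M}
    (hx : x ∈ (pullback φ Y).dom) {v : TangentSpace (𝓡 m) x}
    (hv : mfderiv (𝓡 m) (𝓡 m) φ x v = Y.val (φ x)) : v = (pullback φ Y).val x := by
  rw [pullback_val hx, ← hv]
  exact (φ.mfderiv_symm_apply_mfderiv hx.1 v).symm

/-- A local diffeomorphism maps flow lines of a pulled back vector field to flow lines. -/
theorem FlowsTo.map_pullback {φ : LocalDiffeo m M} {Y : LocalVectorField m M} {t : ℝ} {x y : M}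
    (h : FlowsTo (pullback φ Y) t x y) : FlowsTo Y t (φ x) (φ y) := by
  obtain ⟨γ, a, b, ha, hb, ht, rfl, rfl, hd, hγ⟩ := h
  refine ⟨φ ∘ γ, a, b, ha, hb, ht, rfl, rfl, fun s hs => (hd s hs).2, fun s hs => ?_⟩
  refine (HasMFDerivAt.comp_hasMFDerivWithinAt s (hasMFDerivAt_of_mem_source φ (hd s hs).1)
    (hγ s hs)).congr_mfderiv (ContinuousLinearMap.ext fun (r : ℝ) => ?_)
  refine (map_smul (mfderiv (𝓡 m) (𝓡 m) φ (γ s)) r ((pullback φ Y).val (γ s))).trans ?_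
  exact congrArg (fun w => r • w) (mfderiv_pullback_val (hd s hs))

open Classical in
/-- The restriction of a local vector field to an open set. -/
noncomputable def LocalVectorField.restrict (X : LocalVectorField m M) (U : Set M)
    (hU : IsOpen U) : LocalVectorField m M where
  dom := X.dom ∩ U
  val x := if x ∈ U then X.val x else 0
  isOpen_dom := X.isOpen_dom.inter hU
  contMDiffOn_val := by
    refine (X.contMDiffOn_val.mono inter_subset_left).congr fun x hx => ?_
    simp only [if_pos hx.2]
  val_eq_zero x hx := by
    by_cases h : x ∈ U
    · rw [if_pos h, X.val_eq_zero x fun h' => hx ⟨h', h⟩]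
    · exact if_neg h

theorem LocalVectorField.restrict_val (X : LocalVectorField m M) {U : Set M} {hU : IsOpen U} {x : M}
    (hx : x ∈ U) : (X.restrict U hU).val x = X.val x := if_pos hx

end Pullback

/-! ### Orbits, and invariance of the distribution under the pseudogroup -/

section Pseudogroup

variable [IsManifold (𝓡 m) ∞ M] {V : Set (LocalVectorField m M)}

theorem isPseudogroup_flowPseudogroup (V : Set (LocalVectorField m M)) :
    IsPseudogroup (flowPseudogroup V) where
  id_mem := fun _ hG => hG.1.id_mem
  comp_mem := fun _ hφ _ hψ G hG => hG.1.comp_mem _ (hφ G hG) _ (hψ G hG)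
  inv_mem := fun _ hφ G hG => hG.1.inv_mem _ (hφ G hG)

theorem IsFlowAt.mem_flowPseudogroup {X : LocalVectorField m M} (hX : X ∈ V) {t : ℝ}
    {φ : LocalDiffeo m M} (h : IsFlowAt X t φ) : φ ∈ flowPseudogroup V :=
  fun _ hG => hG.2 X hX t φ h

theorem trans_mem {φ ψ : LocalDiffeo m M} (hφ : φ ∈ flowPseudogroup V)
    (hψ : ψ ∈ flowPseudogroup V) : φ.trans ψ ∈ flowPseudogroup V :=
  (isPseudogroup_flowPseudogroup V).comp_mem _ hψ _ hφ

theorem symm_mem {φ : LocalDiffeo m M} (hφ : φ ∈ flowPseudogroup V) :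
    φ.symm ∈ flowPseudogroup V :=
  (isPseudogroup_flowPseudogroup V).inv_mem _ hφ

/-- An equivalence relation which relates the points of each flow line relates the points of each
orbit. -/
theorem rel_of_mem_flowPseudogroup [T2Space M] {R : M → M → Prop} (hR : Equivalence R)
    (hflow : ∀ X ∈ V, ∀ t x y, FlowsTo X t x y → R x y) {φ : LocalDiffeo m M}
    (hφ : φ ∈ flowPseudogroup V) {x : M} (hx : x ∈ φ.source) : R x (φ x) := by
  refine hφ {φ | ∀ x ∈ φ.source, R x (φ x)} ⟨⟨fun x _ => hR.refl x, ?_, ?_⟩, ?_⟩ x hx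
  · intro φ hφ ψ hψ x hx
    exact hR.trans (hψ x hx.1) (hφ _ hx.2)
  · intro φ hφ x hx
    have := hφ _ (φ.symm.map_source hx)
    rw [φ.apply_symm_apply hx] at this
    exact hR.symm this
  · intro X hX t φ hφ x hx
    exact hflow X hX t _ _ (hφ.2 x hx)

theorem mem_orbit_self (V : Set (LocalVectorField m M)) (x : M) :
    x ∈ orbit (flowPseudogroup V) x :=
  ⟨LocalDiffeo.id m M, (isPseudogroup_flowPseudogroup V).id_mem, mem_univ x, rfl⟩

theorem mem_orbit_trans {x y z : M} (h : y ∈ orbit (flowPseudogroup V) x)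
    (h' : z ∈ orbit (flowPseudogroup V) y) : z ∈ orbit (flowPseudogroup V) x := by
  obtain ⟨φ, hφ, hx, rfl⟩ := h
  obtain ⟨ψ, hψ, hy, rfl⟩ := h'
  exact ⟨φ.trans ψ, trans_mem hφ hψ, ⟨hx, hy⟩, rfl⟩

theorem mem_orbit_symm {x y : M} (h : y ∈ orbit (flowPseudogroup V) x) :
    x ∈ orbit (flowPseudogroup V) y := by
  obtain ⟨φ, hφ, hx, rfl⟩ := h
  exact ⟨φ.symm, symm_mem hφ, φ.map_source hx, φ.symm_apply_apply hx⟩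

theorem isStable_stableHull (V : Set (LocalVectorField m M)) : IsStable (stableHull V) :=
  fun X hX Y hY t φ hφ W hW => hW.1 X (hX W hW) Y (hY W hW) t φ hφ

theorem subset_stableHull (V : Set (LocalVectorField m M)) : V ⊆ stableHull V :=
  fun _ hX _ hW => hW.2 hX

/-- The inverse of a time-`t` flow of a vector field in a stable set preserves the distribution
spanned by the stable set. -/
theorem IsStable.preservesDistribution_symm {W : Set (LocalVectorField m M)} (hW : IsStable W)
    {X : LocalVectorField m M} (hX : X ∈ W) {t : ℝ} {φ : LocalDiffeo m M} (h : IsFlowAt X t φ) :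
    PreservesDistribution (spannedBy W) φ.symm := by
  rintro y hy x rfl v hv
  have hx : φ.symm y ∈ φ.source := φ.symm.map_source hy
  -- The differential of φ⁻¹ takes the value of Y at y to the value of φ^*Y at φ⁻¹(y), and stability
  -- puts φ^*Y in W.
  have hle : spannedBy W y ≤ (spannedBy W (φ.symm y)).comap
      (mfderiv (𝓡 m) (𝓡 m) φ.symm y : TangentSpace (𝓡 m) y →ₗ[ℝ] TangentSpace (𝓡 m) _) := by
    refine Submodule.span_le.mpr ?_
    rintro w ⟨Y, hY, hyY, rfl⟩
    have hd : φ.symm y ∈ (pullback φ Y).dom := ⟨hx, by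
      rw [mem_preimage, φ.apply_symm_apply hy]; exact hyY⟩
    refine Submodule.subset_span ⟨pullback φ Y, hW X hX Y hY t φ h, hd, ?_⟩
    rw [pullback_val hd, φ.apply_symm_apply hy]
    rfl
  exact hle hv

/-- The pseudogroup of `V` preserves the distribution spanned by the stable hull of `V`. -/
theorem preservesDistribution_of_mem [T2Space M] {φ : LocalDiffeo m M}
    (hφ : φ ∈ flowPseudogroup V) :
    PreservesDistribution (spannedBy (stableHull V)) φ := by
  set H := spannedBy (stableHull V)
  -- Invariance under the inverse is carried along so that the set is closed under inversion. For a
  -- flow map itself, use that it is the inverse of the time `-t` map.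
  refine (hφ {φ | PreservesDistribution H φ ∧ PreservesDistribution H φ.symm}
    ⟨⟨?_, ?_, ?_⟩, ?_⟩).1
  · have : PreservesDistribution H (LocalDiffeo.id m M) := by
      rintro x - y rfl v hv
      have h1 : mfderiv (𝓡 m) (𝓡 m) (LocalDiffeo.id m M) x v = v :=
        DFunLike.congr_fun (mfderiv_id (I := 𝓡 m) (x := x)) v
      rw [h1]
      exact hv
    exact ⟨this, this⟩
  · exact fun φ hφ ψ hψ => ⟨hψ.1.trans hφ.1, hφ.2.trans hψ.2⟩
  · exact fun φ hφ => ⟨hφ.2, hφ.1⟩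
  · intro X hX t φ hφ
    exact ⟨(isStable_stableHull V).preservesDistribution_symm (subset_stableHull V hX) hφ.symm,
      (isStable_stableHull V).preservesDistribution_symm (subset_stableHull V hX) hφ⟩

end Pseudogroup

/-! ### The stable hull consists germwise of pullbacks -/

section Germs

variable [IsManifold (𝓡 m) ∞ M] [T2Space M] {V : Set (LocalVectorField m M)}

/-- The pullbacks of the vector fields in `V` along the pseudogroup of `V`. -/
def pullbacks (V : Set (LocalVectorField m M)) : Set (LocalVectorField m M) :=
  {Z | ∃ g ∈ flowPseudogroup V, ∃ Y ∈ V, Z = pullback g Y}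

/-- The local vector fields which are germwise pullbacks of vector fields in `V` along the
pseudogroup of `V`. -/
def IsLocallyPullback (V : Set (LocalVectorField m M)) (Z : LocalVectorField m M) : Prop :=
  ∀ x ∈ Z.dom, ∃ Y ∈ pullbacks V, x ∈ Y.dom ∧ ∀ᶠ z in 𝓝 x, Z.val z = Y.val z

/-- The flow of a pullback of a vector field in `V` is given by elements of the pseudogroup. -/
theorem exists_mem_flowPseudogroup_of_mem_pullbacks {Z : LocalVectorField m M}
    (hZ : Z ∈ pullbacks V) (t : ℝ) :
    ∃ h ∈ flowPseudogroup V, ∀ x y, FlowsTo Z t x y → x ∈ h.source ∧ h x = y := by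
  obtain ⟨g, hg, Y, hY, rfl⟩ := hZ
  -- The flow of g^*Y is conjugate by g to the flow of Y, so each of its flow lines is traced by g⁻¹
  -- ∘ Fl^Y_t ∘ g.
  refine ⟨(g.trans (flowDiffeo Y t)).trans g.symm, trans_mem (trans_mem hg
    ((isFlowAt_flowDiffeo Y t).mem_flowPseudogroup hY)) (symm_mem hg), fun x y h => ?_⟩
  have h1 := (isFlowAt_flowDiffeo Y t).apply_eq h.map_pullback
  have h2 := (isFlowAt_flowDiffeo Y t).mem_source h.map_pullback
  have h3 : g.trans (flowDiffeo Y t) x = g y := h1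
  have h4 : y ∈ g.source := h.mem_dom_right.1
  refine ⟨mem_trans_source ⟨h.mem_dom.1, h2⟩ ?_, ?_⟩
  · rw [h3]
    exact g.map_source h4
  · change g.symm (g.trans (flowDiffeo Y t) x) = y
    rw [h3, g.symm_apply_apply h4]

/-- The flow of a vector field which is germwise a pullback of vector fields in `V` is germwise
given by elements of the pseudogroup. -/
theorem IsLocallyPullback.exists_eventuallyEq {X : LocalVectorField m M}
    (hX : IsLocallyPullback V X) {t : ℝ} {φ : LocalDiffeo m M} (hφ : IsFlowAt X t φ) {x : M}
    (hx : x ∈ φ.source) :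
    ∃ h ∈ flowPseudogroup V, x ∈ h.source ∧ φ =ᶠ[𝓝 x] h := by
  have key : ∃ F, (∃ h ∈ flowPseudogroup V, x ∈ h.source ∧ F =ᶠ[𝓝 x] h) ∧
      ∀ᶠ w in 𝓝 x, FlowsTo X t w (F w) := by
    refine (hφ.2 x hx).exists_of_local
      (Q := fun F z => ∃ h ∈ flowPseudogroup V, z ∈ h.source ∧ F =ᶠ[𝓝 z] h) ?_ ?_ ?_
    · rintro F F' z ⟨h, hh, hz, hF⟩ ⟨h', hh', hz', hF'⟩
      rw [hF.eq_of_nhds] at hz' hF'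
      refine ⟨h.trans h', trans_mem hh hh', ⟨hz, hz'⟩, ?_⟩
      filter_upwards [hF, (h.contMDiffAt hz).continuousAt.eventually hF'] with w h1 h2
      rw [Function.comp_apply, h1, h2]
      rfl
    · rintro F z ⟨h, hh, hz, hF⟩
      exact (h.contMDiffAt hz).continuousAt.congr hF.symm
    · intro z hz
      obtain ⟨Z, hZ, hzZ, hZX⟩ := hX z hz
      -- On `U` the field equals a single pullback `Z`. Short flow lines of the restriction to `U`
      -- are flow lines both of `X` and of `Z`, and the latter are given by the pseudogroup.
      obtain ⟨U, hU, hUo, hzU⟩ := eventually_nhds_iff.mp (hZX.and (Z.isOpen_dom.mem_nhds hzZ))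
      obtain ⟨F, hF⟩ := exists_localFlow (X.restrict U hUo) (x₀ := z) ⟨hz, hzU⟩
      filter_upwards [hF.eventually_nhds] with p hp
      obtain ⟨h, hh, hflow⟩ := exists_mem_flowPseudogroup_of_mem_pullbacks hZ p.1
      have hres : ∀ᶠ w in 𝓝 p.2, FlowsTo (X.restrict U hUo) p.1 w (F (p.1, w)) := by
        have hc : ContinuousAt (fun w : M => (p.1, w)) p.2 := by fun_prop
        exact (hc.eventually hp).mono fun w hw => hw.2
      have hresZ : ∀ᶠ w in 𝓝 p.2, w ∈ h.source ∧ h w = F (p.1, w) := by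
        filter_upwards [hres] with w hw
        refine hflow _ _ (FlowsTo.mono (Y := X.restrict U hUo) (fun q hq => (hU q hq.2).2)
          (fun q hq => ?_) hw)
        rw [X.restrict_val hq.2, (hU q hq.2).1]
      refine ⟨h, ⟨h, hh, hresZ.self_of_nhds.1, EventuallyEq.rfl⟩, ?_⟩
      filter_upwards [hres, hresZ] with w h1 h2
      rw [h2.2]
      exact h1.mono inter_subset_left fun q (hq : q ∈ X.dom ∩ U) => X.restrict_val hq.2
  obtain ⟨F, ⟨h, hh, hxh, hF⟩, hF'⟩ := key
  refine ⟨h, hh, hxh, ?_⟩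
  filter_upwards [hF, hF'] with w h1 h2
  rw [hφ.apply_eq h2, h1]

/-- Every vector field in the stable hull of `V` is germwise a pullback of a vector field in `V`
along the pseudogroup of `V`. -/
theorem isLocallyPullback_of_mem_stableHull {Z : LocalVectorField m M} (hZ : Z ∈ stableHull V) :
    IsLocallyPullback V Z := by
  refine hZ {Z | IsLocallyPullback V Z} ⟨?_, ?_⟩
  · intro X hX Z hZ t φ hφ x hx
    obtain ⟨h, hh, hxh, hφh⟩ := hX.exists_eventuallyEq hφ hx.1
    obtain ⟨_, ⟨g, hg, Y, hY, rfl⟩, hd, hval⟩ := hZ (φ x) hx.2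
    -- Near `x` the flow map φ agrees with h in the pseudogroup, and Z agrees near φ(x) with g^*Y;
    -- hence φ^*Z agrees near x with (g ∘ h)^*Y.
    refine ⟨pullback (h.trans g) Y, ⟨_, trans_mem hh hg, Y, hY, rfl⟩, ?_, ?_⟩
    · rw [hφh.eq_of_nhds] at hd
      exact ⟨mem_trans_source hxh hd.1, hd.2⟩
    · have hdg : ∀ᶠ z in 𝓝 x, φ z ∈ (pullback g Y).dom :=
        (φ.contMDiffAt hx.1).continuousAt.eventually_mem ((pullback g Y).isOpen_dom.mem_nhds hd)
      filter_upwards [hφh.eventuallyEq_nhds, h.open_source.mem_nhds hxh, hdg,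
        (pullback φ Z).isOpen_dom.mem_nhds hx,
        (φ.contMDiffAt hx.1).continuousAt.eventually hval] with z h1 h2 h3 h4 h5
      have h6 : z ∈ (h.trans g).source := mem_trans_source h2 (by rw [← h1.eq_of_nhds]; exact h3.1)
      refine eq_pullback_val ⟨h6, ?_⟩ ?_
      · change g (h z) ∈ Y.dom
        rw [← h1.eq_of_nhds]
        exact h3.2
      · rw [mfderiv_trans_apply h6, ← h1.mfderiv_eq, ← h1.eq_of_nhds]
        have h7 := mfderiv_pullback_val h4
        rw [h5] at h7
        refine (congrArg (mfderiv (𝓡 m) (𝓡 m) g (φ z)) h7).trans ?_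
        refine (mfderiv_pullback_val h3).trans ?_
        change Y.val (g (φ z)) = Y.val (g (h z))
        rw [h1.eq_of_nhds]
  · intro Y hY x hx
    have hd : (pullback (LocalDiffeo.id m M) Y).dom = Y.dom := by
      rw [pullback_dom]
      exact Set.univ_inter _
    refine ⟨pullback (LocalDiffeo.id m M) Y, ⟨_, (isPseudogroup_flowPseudogroup V).id_mem, Y, hY,
      rfl⟩, by rwa [hd], ?_⟩
    filter_upwards [Y.isOpen_dom.mem_nhds hx] with z hz
    exact eq_pullback_val (hd ▸ hz) (DFunLike.congr_fun (mfderiv_id (I := 𝓡 m) (x := z)) _)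

/-- The distribution spanned by the stable hull of `V` is spanned by the pullbacks of the vector
fields in `V` along the pseudogroup of `V`. -/
theorem spannedBy_stableHull (V : Set (LocalVectorField m M)) :
    spannedBy (stableHull V) = spannedBy (pullbacks V) := by
  funext x
  refine le_antisymm (Submodule.span_le.mpr ?_) (Submodule.span_le.mpr ?_)
  · rintro w ⟨Z, hZ, hx, rfl⟩
    obtain ⟨Y, hY, hxY, hval⟩ := isLocallyPullback_of_mem_stableHull hZ x hx
    exact Submodule.subset_span ⟨Y, hY, hxY, hval.self_of_nhds.symm⟩
  · rintro w ⟨_, ⟨g, hg, Y, hY, rfl⟩, hx, rfl⟩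
    have h := preservesDistribution_of_mem (symm_mem hg) (g x) (g.map_source hx.1) x
      (g.symm_apply_apply hx.1) (Y.val (g x))
      (Submodule.subset_span ⟨Y, subset_stableHull V hY, hx.2, rfl⟩)
    rw [pullback_val hx]
    exact h

end Germs

end SingularFoliation

/-! ### Maps tangent to a distribution and local uniqueness of integral manifolds -/

namespace SingularFoliation

variable {m : ℕ} {M : Type u} [TopologicalSpace M] [ChartedSpace (EuclideanSpace ℝ (Fin m)) M]
  {E E' : Type*} [NormedAddCommGroup E] [NormedSpace ℝ E] [NormedAddCommGroup E'] [NormedSpace ℝ E']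

/-- `f` is smooth near `a` and tangent to the distribution `H`. -/
structure IsTangentAt (H : Distribution m M) (f : E → M) (a : E) : Prop where
  contMDiffAt : ∀ᶠ e in 𝓝 a, ContMDiffAt 𝓘(ℝ, E) (𝓡 m) ∞ f e
  tangent : ∀ᶠ e in 𝓝 a, ∀ v, mfderiv 𝓘(ℝ, E) (𝓡 m) f e v ∈ H (f e)

theorem IsTangentAt.continuousAt {H : Distribution m M} {f : E → M} {a : E}
    (h : IsTangentAt H f a) : ContinuousAt f a := h.contMDiffAt.self_of_nhds.continuousAt

variable [IsManifold (𝓡 m) ∞ M]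

section ChartExpression

variable {f : E → M} {e : E} {x₀ : M}

theorem contDiffAt_chart_comp (hf : ContMDiffAt 𝓘(ℝ, E) (𝓡 m) ∞ f e)
    (he : f e ∈ (chartDiffeo m x₀).source) : ContDiffAt ℝ ∞ (fun e => chartDiffeo m x₀ (f e)) e :=
  contMDiffAt_iff_contDiffAt.mp (((chartDiffeo m x₀).contMDiffAt he).comp e hf)

theorem fderiv_chart_comp (hf : ContMDiffAt 𝓘(ℝ, E) (𝓡 m) ∞ f e)
    (he : f e ∈ (chartDiffeo m x₀).source) (v : E) :
    fderiv ℝ (fun e => chartDiffeo m x₀ (f e)) e v =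
      mfderiv (𝓡 m) (𝓡 m) (chartDiffeo m x₀) (f e) (mfderiv 𝓘(ℝ, E) (𝓡 m) f e v) := by
  rw [← mfderiv_eq_fderiv]
  exact DFunLike.congr_fun (mfderiv_comp e
    (((chartDiffeo m x₀).contMDiffAt he).mdifferentiableAt (by simp))
    (hf.mdifferentiableAt (by simp))) v

theorem mfderiv_chart_injective {z : M} (hz : z ∈ (chartDiffeo m x₀).source) :
    Function.Injective (mfderiv (𝓡 m) (𝓡 m) (chartDiffeo m x₀) z) :=
  ((chartDiffeo m x₀).isInvertible_mfderiv hz).injective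

end ChartExpression

variable {H : Distribution m M} {f : E → M} {a : E}

/-- An immersion at a point is an immersion nearby. -/
theorem IsTangentAt.eventually_injective [FiniteDimensional ℝ E] (hf : IsTangentAt H f a)
    (hinj : Function.Injective (mfderiv 𝓘(ℝ, E) (𝓡 m) f a)) :
    ∀ᶠ e in 𝓝 a, Function.Injective (mfderiv 𝓘(ℝ, E) (𝓡 m) f e) := by
  set c := chartDiffeo m (f a)
  have hs : ∀ᶠ e in 𝓝 a, f e ∈ c.source :=
    hf.continuousAt.eventually_mem (c.open_source.mem_nhds (mem_chartDiffeo_source _))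
  have hc : ContinuousAt (fderiv ℝ fun e => c (f e)) a :=
    ((contDiffAt_chart_comp hf.contMDiffAt.self_of_nhds hs.self_of_nhds).fderiv_right
      (m := 0) (by simp)).continuousAt
  have hinj' : Function.Injective (fderiv ℝ (fun e => c (f e)) a) := by
    intro v w hvw
    rw [fderiv_chart_comp hf.contMDiffAt.self_of_nhds hs.self_of_nhds,
      fderiv_chart_comp hf.contMDiffAt.self_of_nhds hs.self_of_nhds] at hvw
    exact hinj (mfderiv_chart_injective hs.self_of_nhds hvw)
  filter_upwards [hc.eventually_mem (ContinuousLinearMap.isOpen_injective.mem_nhds hinj'),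
    hf.contMDiffAt, hs] with e h1 h2 h3 v w hvw
  exact h1 ((fderiv_chart_comp h2 h3 v).trans
    ((congrArg (mfderiv (𝓡 m) (𝓡 m) c (f e)) hvw).trans (fderiv_chart_comp h2 h3 w).symm))

/-- A tangent immersion of the dimension of the distribution is an integral manifold. -/
theorem IsTangentAt.eventually_range_eq [FiniteDimensional ℝ E] (hf : IsTangentAt H f a)
    (hinj : Function.Injective (mfderiv 𝓘(ℝ, E) (𝓡 m) f a))
    (hrank : ∀ᶠ e in 𝓝 a, Module.finrank ℝ (H (f e)) = Module.finrank ℝ E) :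
    ∀ᶠ e in 𝓝 a, (mfderiv 𝓘(ℝ, E) (𝓡 m) f e).range = H (f e) := by
  filter_upwards [hf.tangent, hf.eventually_injective hinj, hrank] with e h1 h2 h3
  have : FiniteDimensional ℝ (TangentSpace (𝓡 m) (f e)) :=
    inferInstanceAs (FiniteDimensional ℝ (EuclideanSpace ℝ (Fin m)))
  refine Submodule.eq_of_le_of_finrank_eq ?_ ?_
  · rintro w ⟨v, rfl⟩
    exact h1 v
  · rw [h3]
    exact LinearMap.finrank_range_of_inj h2

/-- Finitely many fields spanning a distribution at a point. -/
theorem exists_basis_fields (D : Set (LocalVectorField m M)) (x : M) :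
    ∃ (b : Finset (EuclideanSpace ℝ (Fin m))) (Z : b → LocalVectorField m M),
      (∀ i, Z i ∈ D ∧ x ∈ (Z i).dom) ∧
      LinearIndependent ℝ (fun i => ((Z i).val x : EuclideanSpace ℝ (Fin m))) ∧
      b.card = Module.finrank ℝ (spannedBy D x) := by
  let s : Set (EuclideanSpace ℝ (Fin m)) := {w | ∃ X ∈ D, x ∈ X.dom ∧ X.val x = w}
  obtain ⟨b, hbs, hspan, hli⟩ := exists_linearIndependent ℝ s
  have hfin : b.Finite := hli.setFinite
  have hmem : ∀ i : hfin.toFinset, ∃ X ∈ D, x ∈ X.dom ∧ X.val x = (i : EuclideanSpace ℝ (Fin m)) :=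
    fun i => hbs (hfin.mem_toFinset.mp i.2)
  choose Z hZ hx hZx using hmem
  have hli' : LinearIndependent ℝ (fun i : hfin.toFinset => (i : EuclideanSpace ℝ (Fin m))) :=
    hli.comp (fun i : hfin.toFinset => (⟨i, hfin.mem_toFinset.mp i.2⟩ : b))
      (fun i j hij => Subtype.ext (congrArg (fun q : b => (q : EuclideanSpace ℝ (Fin m))) hij))
  refine ⟨hfin.toFinset, Z, fun i => ⟨hZ i, hx i⟩, ?_, ?_⟩
  · rw [funext hZx]
    exact hli'
  · have h1 := finrank_span_eq_card hli'
    have h2 : range (fun i : hfin.toFinset => (i : EuclideanSpace ℝ (Fin m))) = b := by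
      rw [Subtype.range_coe_subtype]
      ext w
      simp
    rw [h2, hspan, Fintype.card_coe] at h1
    exact h1.symm

/-- Local uniqueness of integral manifolds: a map which is tangent to a distribution spanned by
local vector fields factors locally through an integral manifold of the same rank. -/
theorem exists_factorization {D : Set (LocalVectorField m M)} [FiniteDimensional ℝ E]
    (hf : IsTangentAt (spannedBy D) f a)
    (hinj : Function.Injective (mfderiv 𝓘(ℝ, E) (𝓡 m) f a))
    (hrank : ∀ᶠ e in 𝓝 a, Module.finrank ℝ (spannedBy D (f e)) = Module.finrank ℝ E)
    {f' : E' → M} {a' : E'} (hf' : IsTangentAt (spannedBy D) f' a')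
    (hrank' : ∀ᶠ e in 𝓝 a', Module.finrank ℝ (spannedBy D (f' e)) = Module.finrank ℝ E)
    (h0 : f' a' = f a) :
    ∃ g : E' → E, g a' = a ∧ ∀ᶠ e in 𝓝 a', ContDiffAt ℝ ∞ g e ∧ f (g e) = f' e := by
  set c := chartDiffeo m (f a) with hc
  have hxs : f a ∈ c.source := mem_chartDiffeo_source _
  have hs : ∀ᶠ e in 𝓝 a, f e ∈ c.source :=
    hf.continuousAt.eventually_mem (c.open_source.mem_nhds hxs)
  have hs' : ∀ᶠ e in 𝓝 a', f' e ∈ c.source :=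
    hf'.continuousAt.eventually_mem (c.open_source.mem_nhds (h0 ▸ hxs))
  obtain ⟨b, Z, hZ, hli, hcard⟩ := exists_basis_fields D (f a)
  rw [hrank.self_of_nhds] at hcard
  have hdom : ∀ᶠ z in 𝓝 (f a), ∀ i, z ∈ (Z i).dom :=
    eventually_all.mpr fun i => (Z i).isOpen_dom.mem_nhds (hZ i).2
  have hval : ∀ z ∈ c.source, ∀ i, (Z i).inChart (f a) (c z) =
      mfderiv (𝓡 m) (𝓡 m) c z ((Z i).val z) := fun z hz i => (Z i).inChart_apply hz
  have hX : ∀ i, ContDiffAt ℝ ∞ ((Z i).inChart (f a)) (c (f a)) := fun i =>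
    (Z i).contDiffAt_inChart (c.map_source hxs) (by
      rw [← hc, c.symm_apply_apply hxs]; exact (hZ i).2)
  have hli' : LinearIndependent ℝ fun i => (Z i).inChart (f a) (c (f a)) := by
    have h1 : LinearIndependent ℝ (fun i => (Z i).val (f a)) := hli
    have h2 := h1.map' (mfderiv (𝓡 m) (𝓡 m) c (f a) :
        TangentSpace (𝓡 m) (f a) →ₗ[ℝ] TangentSpace (𝓡 m) (c (f a)))
      (LinearMap.ker_eq_bot.mpr (mfderiv_chart_injective hxs))
    have h3 : (fun i => (Z i).inChart (f a) (c (f a))) =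
        fun i => mfderiv (𝓡 m) (𝓡 m) c (f a) ((Z i).val (f a)) := funext fun i => hval _ hxs i
    rw [h3]
    exact h2
  have hli_nhds : ∀ᶠ u in 𝓝 (c (f a)), LinearIndependent ℝ fun i => (Z i).inChart (f a) u := by
    have h1 : ContinuousAt (fun u i => (Z i).inChart (f a) u) (c (f a)) :=
      continuousAt_pi.mpr fun i => (hX i).continuousAt
    exact h1.eventually_mem (isOpen_setOfPred_linearIndependent.mem_nhds hli')
  have hcf' : Tendsto (fun e => c (f' e)) (𝓝 a') (𝓝 (c (f a))) := by
    have := (contDiffAt_chart_comp hf'.contMDiffAt.self_of_nhds hs'.self_of_nhds).continuousAt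
    rw [ContinuousAt, h0] at this
    exact this
  have hf'c : Tendsto f' (𝓝 a') (𝓝 (f a)) := h0 ▸ hf'.continuousAt.tendsto
  have key : ∃ g : E' → E, g a' = a ∧
      ∀ᶠ e in 𝓝 a', ContDiffAt ℝ ∞ g e ∧ c (f (g e)) = c (f' e) := by
    refine exists_local_factorization (f := fun e => c (f e))
      (f' := fun e => c (f' e)) (a := a) (a' := a') (X := fun i => (Z i).inChart (f a))
      ?_ ?_ (by rw [h0]) ?_ (fun i => (hX i).of_le (by simp)) hli' ?_ ?_
    · filter_upwards [hs, hf.contMDiffAt] with e h1 h2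
      exact contDiffAt_chart_comp h2 h1
    · filter_upwards [hs', hf'.contMDiffAt] with e h1 h2
      exact contDiffAt_chart_comp h2 h1
    · intro v w hvw
      rw [fderiv_chart_comp hf.contMDiffAt.self_of_nhds hxs,
        fderiv_chart_comp hf.contMDiffAt.self_of_nhds hxs] at hvw
      exact hinj (mfderiv_chart_injective hxs hvw)
    · filter_upwards [hs, hf.contMDiffAt, hf.eventually_range_eq hinj hrank,
        hf.continuousAt.eventually hdom] with e h1 h2 h3 h4 i
      have h5 : (Z i).val (f e) ∈ (mfderiv 𝓘(ℝ, E) (𝓡 m) f e).range :=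
        h3 ▸ Submodule.subset_span ⟨Z i, (hZ i).1, h4 i, rfl⟩
      obtain ⟨v, hv⟩ := h5
      refine ⟨v, ?_⟩
      refine (fderiv_chart_comp h2 h1 v).trans ?_
      rw [hval _ h1]
      exact congrArg _ hv
    · filter_upwards [hs', hf'.contMDiffAt, hf'.tangent, hrank', hcf'.eventually hli_nhds,
        hf'c.eventually hdom] with e h1 h2 h3 h4 h5 h6 v
      have : FiniteDimensional ℝ (TangentSpace (𝓡 m) (f' e)) :=
        inferInstanceAs (FiniteDimensional ℝ (EuclideanSpace ℝ (Fin m)))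
      let T : TangentSpace (𝓡 m) (f' e) →ₗ[ℝ] EuclideanSpace ℝ (Fin m) :=
        (mfderiv (𝓡 m) (𝓡 m) c (f' e)).toLinearMap
      have hXT : (fun i => (Z i).inChart (f a) (c (f' e))) = T ∘ fun i => (Z i).val (f' e) :=
        funext fun i => hval _ h1 i
      have h7 : LinearIndependent ℝ fun i => (Z i).val (f' e) := by
        rw [hXT] at h5
        exact h5.of_comp T
      -- The fields stay independent near `f a`, and along `f'` their number equals the rank, so
      -- they span the distribution there. Elsewhere the rank may be larger; the rank conditions
      -- concern only points on `f` and `f'`.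
      have h8 : Submodule.span ℝ (range fun i => (Z i).val (f' e)) = spannedBy D (f' e) := by
        refine Submodule.eq_of_le_of_finrank_eq (Submodule.span_le.mpr ?_) ?_
        · rintro w ⟨i, rfl⟩
          exact Submodule.subset_span ⟨Z i, (hZ i).1, h6 i, rfl⟩
        · rw [finrank_span_eq_card h7, h4, Fintype.card_coe, hcard]
      have h9 := h3 v
      rw [← h8] at h9
      have h10 := Submodule.mem_map_of_mem (f := T) h9
      rw [Submodule.map_span, ← range_comp, ← hXT] at h10
      rw [fderiv_chart_comp h2 h1]
      exact h10
  obtain ⟨g, hg0, hg⟩ := key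
  refine ⟨g, hg0, ?_⟩
  have hgc : Tendsto g (𝓝 a') (𝓝 a) := hg0 ▸ hg.self_of_nhds.1.continuousAt.tendsto
  filter_upwards [hg, hgc.eventually hs, hs'] with e h1 h2 h3
  refine ⟨h1.1, ?_⟩
  rw [← c.symm_apply_apply h2, h1.2, c.symm_apply_apply h3]

end SingularFoliation

/-! ### Integral discs inside an orbit -/

namespace SingularFoliation

variable {m : ℕ} {M : Type u} [TopologicalSpace M] [ChartedSpace (EuclideanSpace ℝ (Fin m)) M]
  {E : Type*} [NormedAddCommGroup E] [NormedSpace ℝ E]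

theorem finiteDimensional_tangentSpace (x : M) : FiniteDimensional ℝ (TangentSpace (𝓡 m) x) :=
  inferInstanceAs (FiniteDimensional ℝ (EuclideanSpace ℝ (Fin m)))

variable [IsManifold (𝓡 m) ∞ M] [T2Space M]

/-- Curves of flow lines are integral curves. -/
theorem hasMFDerivAt_of_eventually_flowsTo {Z : LocalVectorField m M} {c : ℝ → M} {s : ℝ} {w : M}
    (h : ∀ᶠ r in 𝓝 s, FlowsTo Z r w (c r)) :
    HasMFDerivAt 𝓘(ℝ, ℝ) (𝓡 m) c s ((1 : ℝ →L[ℝ] ℝ).smulRight (Z.val (c s))) := by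
  obtain ⟨γ, a, b, ha, hb, hs, rfl, h1, hd, hγ⟩ := h.self_of_nhds
  have h2 : c =ᶠ[𝓝 s] γ := by
    filter_upwards [h, isOpen_Ioo.mem_nhds hs] with r hr hr'
    exact hr.unique ⟨γ, a, b, ha, hb, hr', rfl, rfl, hd, hγ⟩
  have h3 := ((hγ s hs).hasMFDerivAt (isOpen_Ioo.mem_nhds hs)).congr_of_eventuallyEq h2
  rw [← h1]
  exact h3

variable {V : Set (LocalVectorField m M)} {x y : M}

/-- An element of the pseudogroup joining `x` to `y` has an injective differential that carries the
distribution at `x` into that at `y`. Orbits being symmetric, equality of ranks follows. -/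
theorem finrank_le_of_mem_orbit (h : y ∈ orbit (flowPseudogroup V) x) :
    Module.finrank ℝ (spannedBy (stableHull V) x) ≤
      Module.finrank ℝ (spannedBy (stableHull V) y) := by
  obtain ⟨φ, hφ, hx, rfl⟩ := h
  have := finiteDimensional_tangentSpace (m := m) (φ x)
  let T : TangentSpace (𝓡 m) x →ₗ[ℝ] TangentSpace (𝓡 m) (φ x) := (mfderiv (𝓡 m) (𝓡 m) φ x)
  have hT : Function.Injective T := (φ.isInvertible_mfderiv hx).injective
  rw [(Submodule.equivMapOfInjective T hT (spannedBy (stableHull V) x)).finrank_eq]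
  refine Submodule.finrank_mono ?_
  rintro w ⟨v, hv, rfl⟩
  exact preservesDistribution_of_mem hφ x hx _ rfl v hv

/-- The rank of the distribution is constant along orbits. -/
theorem finrank_eq_of_mem_orbit (h : y ∈ orbit (flowPseudogroup V) x) :
    Module.finrank ℝ (spannedBy (stableHull V) y) =
      Module.finrank ℝ (spannedBy (stableHull V) x) :=
  le_antisymm (finrank_le_of_mem_orbit (mem_orbit_symm h)) (finrank_le_of_mem_orbit h)

/-- An immersion tangent to the distribution and with values in the orbit. -/
structure IsOrbitPlaque (V : Set (LocalVectorField m M)) (x : M) (f : E → M) : Prop where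
  apply_zero : f 0 = x
  tangent : IsTangentAt (spannedBy (stableHull V)) f 0
  mem_orbit : ∀ᶠ e in 𝓝 (0 : E), f e ∈ orbit (flowPseudogroup V) x
  injective : Function.Injective (mfderiv 𝓘(ℝ, E) (𝓡 m) f 0)

/-- The derivative of `(s, e) ↦ F (s, f e)` for the flow `F` of a pullback of a field in `V`. -/
theorem tangent_flow_comp {Z : LocalVectorField m M} (hZ : Z ∈ pullbacks V) {F : ℝ × M → M}
    {f : E → M} {s : ℝ} {e : E}
    (hF : ∀ᶠ p in 𝓝 (s, f e), ContMDiffAt (𝓘(ℝ, ℝ).prod (𝓡 m)) (𝓡 m) ∞ F p ∧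
      FlowsTo Z p.1 p.2 (F p))
    (hf : ContMDiffAt 𝓘(ℝ, E) (𝓡 m) ∞ f e)
    (hft : ∀ v, mfderiv 𝓘(ℝ, E) (𝓡 m) f e v ∈ spannedBy (stableHull V) (f e)) :
    ContMDiffAt 𝓘(ℝ, ℝ × E) (𝓡 m) ∞ (fun q : ℝ × E => F (q.1, f q.2)) (s, e) ∧
    (∀ v : ℝ × E, mfderiv 𝓘(ℝ, ℝ × E) (𝓡 m) (fun q : ℝ × E => F (q.1, f q.2)) (s, e) v ∈
      spannedBy (stableHull V) (F (s, f e))) ∧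
    (∀ σ : ℝ, mfderiv 𝓘(ℝ, ℝ × E) (𝓡 m) (fun q : ℝ × E => F (q.1, f q.2)) (s, e) (σ, (0 : E)) =
      σ • Z.val (F (s, f e))) ∧
    (∀ v : E, mfderiv 𝓘(ℝ, ℝ × E) (𝓡 m) (fun q : ℝ × E => F (q.1, f q.2)) (s, e) ((0 : ℝ), v) =
      mfderiv 𝓘(ℝ, E) (𝓡 m) (fun e => F (s, f e)) e v) ∧
    F (s, f e) ∈ orbit (flowPseudogroup V) (f e) := by
  have hsm : ContMDiffAt 𝓘(ℝ, ℝ × E) (𝓡 m) ∞ (fun q : ℝ × E => F (q.1, f q.2)) (s, e) := by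
    refine ContMDiffAt.comp (g := F) (s, e) hF.self_of_nhds.1 (ContMDiffAt.prodMk ?_ ?_)
    · exact contDiff_fst.contMDiff.contMDiffAt
    · exact ContMDiffAt.comp (g := f) (s, e) hf contDiff_snd.contMDiff.contMDiffAt
  have hD := (hsm.mdifferentiableAt (by simp)).hasMFDerivAt
  set D := mfderiv 𝓘(ℝ, ℝ × E) (𝓡 m) (fun q : ℝ × E => F (q.1, f q.2)) (s, e) with hDdef
  -- For fixed `s` the map `F (s, ·)` agrees near `f e` with an element of the pseudogroup, so its
  -- differential preserves the distribution and its values stay in the orbit.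
  obtain ⟨h, hh, hflow⟩ := exists_mem_flowPseudogroup_of_mem_pullbacks hZ s
  have hw : ∀ᶠ w in 𝓝 (f e), w ∈ h.source ∧ h w = F (s, w) := by
    have hc : ContinuousAt (fun w : M => (s, w)) (f e) := by fun_prop
    exact (hc.eventually hF).mono fun w hw => hflow _ _ hw.2
  have h1 : ∀ σ : ℝ, D (σ, (0 : E)) = σ • Z.val (F (s, f e)) := by
    intro σ
    have hr : ∀ᶠ r in 𝓝 s, FlowsTo Z r (f e) (F (r, f e)) := by
      have hc : ContinuousAt (fun r : ℝ => (r, f e)) s := by fun_prop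
      exact (hc.eventually hF).mono fun w hw => hw.2
    have h2 := hasMFDerivAt_of_eventually_flowsTo hr
    have h3 : HasMFDerivAt 𝓘(ℝ, ℝ) 𝓘(ℝ, ℝ × E) (fun r : ℝ => (r, e)) s
        (ContinuousLinearMap.inl ℝ ℝ E) := (hasFDerivAt_prodMk_left s e).hasMFDerivAt
    exact DFunLike.congr_fun (hasMFDerivAt_unique (HasMFDerivAt.comp s hD h3) h2) σ
  have h2 : ∀ v : E, D ((0 : ℝ), v) = mfderiv 𝓘(ℝ, E) (𝓡 m) (fun e => F (s, f e)) e v := by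
    intro v
    have h3 : HasMFDerivAt 𝓘(ℝ, E) 𝓘(ℝ, ℝ × E) (fun e : E => (s, e)) e
        (ContinuousLinearMap.inr ℝ ℝ E) := (hasFDerivAt_prodMk_right s e).hasMFDerivAt
    exact (DFunLike.congr_fun (HasMFDerivAt.comp e hD h3).mfderiv v).symm
  have h3 : ∀ v : E, mfderiv 𝓘(ℝ, E) (𝓡 m) (fun e => F (s, f e)) e v =
      mfderiv (𝓡 m) (𝓡 m) h (f e) (mfderiv 𝓘(ℝ, E) (𝓡 m) f e v) := by
    intro v
    have h4 : (fun e => F (s, f e)) =ᶠ[𝓝 e] h ∘ f := by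
      filter_upwards [hf.continuousAt.eventually hw] with e' he'
      exact he'.2.symm
    rw [h4.mfderiv_eq]
    exact DFunLike.congr_fun (HasMFDerivAt.comp e (hasMFDerivAt_of_mem_source h hw.self_of_nhds.1)
      (hf.mdifferentiableAt (by simp)).hasMFDerivAt).mfderiv v
  refine ⟨hsm, fun v => ?_, h1, h2, ⟨h, hh, hw.self_of_nhds.1, hw.self_of_nhds.2⟩⟩
  have h4 : D v = D (v.1, (0 : E)) + D ((0 : ℝ), v.2) :=
    (congrArg D (Prod.ext (add_zero _).symm (zero_add _).symm :
      v = (v.1, (0 : E)) + ((0 : ℝ), v.2))).trans (map_add D _ _)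
  rw [h4, h1, h2, h3]
  refine Submodule.add_mem _ (Submodule.smul_mem _ _ ?_) ?_
  · rw [spannedBy_stableHull]
    exact Submodule.subset_span ⟨Z, hZ, hF.self_of_nhds.2.mem_dom_right, rfl⟩
  · exact preservesDistribution_of_mem hh _ hw.self_of_nhds.1 _ hw.self_of_nhds.2 _ (hft v.2)

/-- A plaque whose dimension is less than the rank of the distribution can be enlarged. -/
theorem IsOrbitPlaque.exists_prod [FiniteDimensional ℝ E] {f : E → M} (hf : IsOrbitPlaque V x f)
    (hlt : Module.finrank ℝ E < Module.finrank ℝ (spannedBy (stableHull V) x)) :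
    ∃ f' : ℝ × E → M, IsOrbitPlaque V x f' := by
  obtain ⟨rfl, hft, hfo, hfi⟩ := hf
  -- If every pullback were tangent to the plaque at its centre, the distribution there would have
  -- at most the dimension of the plaque, because pullbacks span it. The chosen `Z` is transverse,
  -- and `(s, e) ↦ F (s, f e)` is the enlarged plaque.
  obtain ⟨Z, hZ, hxZ, hZr⟩ : ∃ Z ∈ pullbacks V, f 0 ∈ Z.dom ∧
      Z.val (f 0) ∉ (mfderiv 𝓘(ℝ, E) (𝓡 m) f 0).range := by
    by_contra! hcon
    have hle : spannedBy (stableHull V) (f 0) ≤ (mfderiv 𝓘(ℝ, E) (𝓡 m) f 0).range := by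
      rw [spannedBy_stableHull]
      refine Submodule.span_le.mpr ?_
      rintro w ⟨Z, hZ, hx, rfl⟩
      exact hcon Z hZ hx
    have := finiteDimensional_tangentSpace (m := m) (f 0)
    have h1 := Submodule.finrank_mono hle
    have h2 : Module.finrank ℝ (mfderiv 𝓘(ℝ, E) (𝓡 m) f 0).range = Module.finrank ℝ E :=
      LinearMap.finrank_range_of_inj hfi
    omega
  obtain ⟨F, hF⟩ := exists_localFlow Z hxZ
  have hΨ : Tendsto (fun q : ℝ × E => (q.1, f q.2)) (𝓝 (0, 0)) (𝓝 (0, f 0)) := by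
    have h1 : Tendsto (fun q : ℝ × E => f q.2) (𝓝 (0, 0)) (𝓝 (f 0)) :=
      hft.continuousAt.tendsto.comp (continuous_snd.tendsto _)
    exact (continuous_fst.tendsto (0, 0)).prodMk_nhds h1
  have hsnd : Tendsto (fun q : ℝ × E => q.2) (𝓝 (0, 0)) (𝓝 0) := continuous_snd.tendsto _
  have hall := (((hΨ.eventually hF.eventually_nhds).and (hsnd.eventually hft.contMDiffAt)).and
    (hsnd.eventually hft.tangent)).mono fun q h => tangent_flow_comp hZ h.1.1 h.1.2 h.2
  have hF0 : (fun e => F (0, f e)) =ᶠ[𝓝 0] f := by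
    have hc : ContinuousAt (fun w : M => ((0 : ℝ), w)) (f 0) := by fun_prop
    filter_upwards [hft.continuousAt.eventually (hc.eventually hF)] with e he
    exact he.2.zero_eq
  refine ⟨fun q => F (q.1, f q.2), hF0.self_of_nhds, ⟨hall.mono fun q hq => hq.1,
    hall.mono fun q hq => hq.2.1⟩, ?_, ?_⟩
  · filter_upwards [hall, hsnd.eventually hfo] with q h1 h2
    exact mem_orbit_trans h2 h1.2.2.2.2
  · obtain ⟨-, -, h1, h2, -⟩ := hall.self_of_nhds
    have h3 : ∀ v : E, mfderiv 𝓘(ℝ, E) (𝓡 m) (fun e => F (0, f e)) 0 v =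
        mfderiv 𝓘(ℝ, E) (𝓡 m) f 0 v := fun v =>
      DFunLike.congr_fun (hF0.mfderiv_eq (I := 𝓘(ℝ, E)) (I' := 𝓡 m)) v
    have hZ0 : (Z.val (F (0, f 0)) : EuclideanSpace ℝ (Fin m)) = Z.val (f 0) :=
      congrArg (fun z => (Z.val z : EuclideanSpace ℝ (Fin m))) hF0.self_of_nhds
    refine (injective_iff_map_eq_zero (mfderiv 𝓘(ℝ, ℝ × E) (𝓡 m)
      (fun q : ℝ × E => F (q.1, f q.2)) (0, 0))).mpr ?_
    rintro ⟨σ, v⟩ hσv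
    have h4 : ((σ, v) : ℝ × E) = (σ, 0) + (0, v) := by simp
    have h5 : (σ • Z.val (f 0) + mfderiv 𝓘(ℝ, E) (𝓡 m) f 0 v : EuclideanSpace ℝ (Fin m)) = 0 := by
      have h6 := hσv
      rw [h4] at h6
      have h7 := (map_add (mfderiv 𝓘(ℝ, ℝ × E) (𝓡 m)
        (fun q : ℝ × E => F (q.1, f q.2)) (0, 0)) (σ, (0 : E)) ((0 : ℝ), v)).symm.trans h6
      rw [← hZ0]
      exact (congrArg₂ (fun w w' : EuclideanSpace ℝ (Fin m) => w + w') (h1 σ)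
        ((h2 v).trans (h3 v))).symm.trans h7
    -- A kernel vector with `σ ≠ 0` would express `Z` as a tangent vector of the plaque.
    have hσ : σ = 0 := by
      by_contra hne
      refine hZr ⟨-σ⁻¹ • v, ?_⟩
      refine (map_smul (mfderiv 𝓘(ℝ, E) (𝓡 m) f 0) (-σ⁻¹) v).trans ?_
      have h8 : (mfderiv 𝓘(ℝ, E) (𝓡 m) f 0 v : EuclideanSpace ℝ (Fin m)) = -(σ • Z.val (f 0)) :=
        eq_neg_of_add_eq_zero_right h5
      refine (congrArg (fun w : EuclideanSpace ℝ (Fin m) => -σ⁻¹ • w) h8).trans ?_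
      change -σ⁻¹ • -(σ • (Z.val (f 0) : EuclideanSpace ℝ (Fin m))) = Z.val (f 0)
      rw [neg_smul_neg, smul_smul, inv_mul_cancel₀ hne, one_smul]
    subst hσ
    have hv : v = 0 := by
      refine (injective_iff_map_eq_zero (mfderiv 𝓘(ℝ, E) (𝓡 m) f 0)).mp hfi v ?_
      have h9 := h5
      rw [zero_smul] at h9
      exact (zero_add _).symm.trans h9
    rw [hv]
    rfl

/-- Plaques of all dimensions up to the rank of the distribution. -/
theorem exists_isOrbitPlaque_of_le (V : Set (LocalVectorField m M)) (x : M) (k : ℕ)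
    (hk : k ≤ Module.finrank ℝ (spannedBy (stableHull V) x)) :
    ∃ (E : Type) (_ : NormedAddCommGroup E) (_ : NormedSpace ℝ E) (_ : FiniteDimensional ℝ E)
      (f : E → M), Module.finrank ℝ E = k ∧ IsOrbitPlaque V x f := by
  induction k with
  | zero =>
    refine ⟨EuclideanSpace ℝ (Fin 0), inferInstance, inferInstance, inferInstance, fun _ => x,
      by simp, rfl, ⟨Eventually.of_forall fun _ => contMDiffAt_const,
        Eventually.of_forall fun e v => ?_⟩, Eventually.of_forall fun _ => mem_orbit_self V x, ?_⟩
    · rw [mfderiv_const]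
      exact Submodule.zero_mem _
    · exact fun v w _ => Subsingleton.elim (α := EuclideanSpace ℝ (Fin 0)) v w
  | succ k ih =>
    obtain ⟨E, _, _, _, f, hE, hf⟩ := ih (by omega)
    obtain ⟨f', hf'⟩ := hf.exists_prod (by omega)
    exact ⟨ℝ × E, inferInstance, inferInstance, inferInstance, f', by simp [hE, add_comm], hf'⟩

/-- Every point lies on a plaque of the dimension of the distribution. -/
theorem exists_isOrbitPlaque (V : Set (LocalVectorField m M)) (x : M) {n : ℕ}
    (hn : Module.finrank ℝ (spannedBy (stableHull V) x) = n) :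
    ∃ f : EuclideanSpace ℝ (Fin n) → M, IsOrbitPlaque V x f := by
  obtain ⟨E, _, _, _, f, hE, hf⟩ := exists_isOrbitPlaque_of_le V x n hn.ge
  let L : EuclideanSpace ℝ (Fin n) ≃L[ℝ] E := ContinuousLinearEquiv.ofFinrankEq (by simp [hE])
  have hL : Tendsto L (𝓝 0) (𝓝 0) := by simpa using L.continuous.tendsto 0
  have hLd : ∀ e, ContMDiffAt 𝓘(ℝ, EuclideanSpace ℝ (Fin n)) 𝓘(ℝ, E) ∞ L e :=
    fun e => L.contDiff.contMDiff.contMDiffAt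
  have hder : ∀ e, ContMDiffAt 𝓘(ℝ, E) (𝓡 m) ∞ f (L e) → ∀ v,
      mfderiv 𝓘(ℝ, EuclideanSpace ℝ (Fin n)) (𝓡 m) (f ∘ L) e v =
        mfderiv 𝓘(ℝ, E) (𝓡 m) f (L e) (L v) := by
    intro e he v
    exact DFunLike.congr_fun (HasMFDerivAt.comp e (he.mdifferentiableAt (by simp)).hasMFDerivAt
      L.hasFDerivAt.hasMFDerivAt).mfderiv v
  refine ⟨f ∘ L, ?_, ⟨?_, ?_⟩, ?_, ?_⟩
  · rw [Function.comp_apply, map_zero, hf.apply_zero]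
  · filter_upwards [hL.eventually hf.tangent.contMDiffAt] with e he
    exact ContMDiffAt.comp e he (hLd e)
  · filter_upwards [hL.eventually hf.tangent.contMDiffAt, hL.eventually hf.tangent.tangent]
      with e he he' v
    rw [hder e he]
    exact he' _
  · exact hL.eventually hf.mem_orbit
  · intro v w hvw
    have h0 : L 0 = 0 := map_zero L
    have hs : ContMDiffAt 𝓘(ℝ, E) (𝓡 m) ∞ f (L 0) := by
      rw [h0]; exact hf.tangent.contMDiffAt.self_of_nhds
    have hi : Function.Injective (mfderiv 𝓘(ℝ, E) (𝓡 m) f (L 0)) := by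
      rw [h0]; exact hf.injective
    exact L.injective (hi ((hder 0 hs v).symm.trans (hvw.trans (hder 0 hs w))))

end SingularFoliation

/-! ### Integral immersions in coordinates and lifts to integral manifolds -/

namespace SingularFoliation

variable {m : ℕ} {M : Type u} [TopologicalSpace M] [ChartedSpace (EuclideanSpace ℝ (Fin m)) M]
  {E E' : Type*} [NormedAddCommGroup E] [NormedSpace ℝ E] [NormedAddCommGroup E'] [NormedSpace ℝ E']

/-- `f` is an immersion at `e` whose tangent space is given by the distribution `H`. -/
structure IsIntegralAt (H : Distribution m M) (f : E → M) (e : E) : Prop where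
  contMDiffAt : ContMDiffAt 𝓘(ℝ, E) (𝓡 m) ∞ f e
  injective : Function.Injective (mfderiv 𝓘(ℝ, E) (𝓡 m) f e)
  range_eq : (mfderiv 𝓘(ℝ, E) (𝓡 m) f e).range = H (f e)

variable {H : Distribution m M} {f : E → M} {e : E}

theorem IsIntegralAt.finrank_eq (h : IsIntegralAt H f e) :
    Module.finrank ℝ (H (f e)) = Module.finrank ℝ E := by
  rw [← h.range_eq]
  exact LinearMap.finrank_range_of_inj h.injective

theorem IsIntegralAt.congr {f' : E → M} (h : IsIntegralAt H f e) (hff' : f' =ᶠ[𝓝 e] f) :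
    IsIntegralAt H f' e := by
  obtain ⟨h1, h2, h3⟩ := h
  have h4 : f' e = f e := hff'.self_of_nhds
  have h5 : ∀ v, (mfderiv 𝓘(ℝ, E) (𝓡 m) f' e v : EuclideanSpace ℝ (Fin m)) =
      mfderiv 𝓘(ℝ, E) (𝓡 m) f e v := fun v =>
    DFunLike.congr_fun (hff'.mfderiv_eq (I := 𝓘(ℝ, E)) (I' := 𝓡 m)) v
  refine ⟨h1.congr_of_eventuallyEq hff', fun v w hvw => h2 ((h5 v).symm.trans (hvw.trans (h5 w))), ?_⟩
  ext w
  have h6 : (w ∈ H (f' e)) ↔ (show EuclideanSpace ℝ (Fin m) from w) ∈ H (f e) := by rw [h4]; rfl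
  rw [h6, ← h3]
  exact ⟨fun ⟨v, hv⟩ => ⟨v, (h5 v).symm.trans hv⟩, fun ⟨v, hv⟩ => ⟨v, (h5 v).trans hv⟩⟩

theorem isTangentAt_of_eventually (h : ∀ᶠ e in 𝓝 e, IsIntegralAt H f e) : IsTangentAt H f e :=
  ⟨h.mono fun _ he => he.contMDiffAt, h.mono fun _ he v => he.range_eq ▸ ⟨v, rfl⟩⟩

section Immersion

variable {n : ℕ} {N : Type v} [TopologicalSpace N] [ChartedSpace (EuclideanSpace ℝ (Fin n)) N]
  {i : N → M} (c : PartialDiffeomorph (𝓡 n) (𝓡 n) N (EuclideanSpace ℝ (Fin n)) ∞)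

variable (n) in
/-- `i : N → M` is an immersion at `p` whose tangent space is given by `H`. -/
structure IsImmersedAt (H : Distribution m M) (i : N → M) (p : N) : Prop where
  contMDiffAt : ContMDiffAt (𝓡 n) (𝓡 m) ∞ i p
  injective : Function.Injective (mfderiv (𝓡 n) (𝓡 m) i p)
  range_eq : (mfderiv (𝓡 n) (𝓡 m) i p).range = H (i p)

theorem IsImmersedAt.finrank_eq {p : N} (h : IsImmersedAt n H i p) :
    Module.finrank ℝ (H (i p)) = n := by
  rw [← h.range_eq]
  exact (LinearMap.finrank_range_of_inj h.injective).trans (finrank_euclideanSpace_fin (𝕜 := ℝ))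

/-- Composing with a local diffeomorphism changes neither smoothness nor the image of the
differential. One direction reads given integral manifolds in charts; the other makes a leaf
immersed, as its charts are integral by construction. -/
theorem isImmersedAt_iff_comp_symm {u : EuclideanSpace ℝ (Fin n)} (hu : u ∈ c.target) :
    IsImmersedAt n H i (c.symm u) ↔ IsIntegralAt H (i ∘ c.symm) u := by
  have hs := c.contMDiffAt_symm hu
  have hu' : c.symm u ∈ c.source := c.symm.map_source hu
  have hsm : ContMDiffAt (𝓡 n) (𝓡 m) ∞ i (c.symm u) ↔
      ContMDiffAt (𝓡 n) (𝓡 m) ∞ (i ∘ c.symm) u := by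
    refine ⟨fun h => h.comp u hs, fun h => ?_⟩
    have h1 : ContMDiffAt (𝓡 n) (𝓡 m) ∞ ((i ∘ c.symm) ∘ c) (c.symm u) := by
      refine ContMDiffAt.comp (c.symm u) ?_ (c.contMDiffAt hu')
      rw [c.apply_symm_apply hu]
      exact h
    refine h1.congr_of_eventuallyEq ?_
    filter_upwards [c.open_source.mem_nhds hu'] with p hp
    exact congrArg i (c.symm_apply_apply hp).symm
  have hd (h : ContMDiffAt (𝓡 n) (𝓡 m) ∞ i (c.symm u)) (v : EuclideanSpace ℝ (Fin n)) :
      mfderiv (𝓡 n) (𝓡 m) (i ∘ c.symm) u v =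
        mfderiv (𝓡 n) (𝓡 m) i (c.symm u) (mfderiv (𝓡 n) (𝓡 n) c.symm u v) :=
    DFunLike.congr_fun (HasMFDerivAt.comp u (h.mdifferentiableAt (by simp)).hasMFDerivAt
      (hs.mdifferentiableAt (by simp)).hasMFDerivAt).mfderiv v
  obtain ⟨T, hT⟩ := c.symm.isInvertible_mfderiv hu
  have hT' : ∀ v, mfderiv (𝓡 n) (𝓡 n) c.symm u v = T v := fun v => DFunLike.congr_fun hT.symm v
  have hd' (h : ContMDiffAt (𝓡 n) (𝓡 m) ∞ i (c.symm u)) (w : TangentSpace (𝓡 n) (c.symm u)) :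
      mfderiv (𝓡 n) (𝓡 m) i (c.symm u) w = mfderiv (𝓡 n) (𝓡 m) (i ∘ c.symm) u (T.symm w) := by
    refine Eq.trans ?_ (hd h _).symm
    rw [hT', T.apply_symm_apply]
  constructor
  · rintro ⟨h1, h2, h3⟩
    refine ⟨hsm.mp h1, fun v w hvw => ?_, Eq.trans ?_ h3⟩
    · have h4 := h2 ((hd h1 v).symm.trans (hvw.trans (hd h1 w)))
      rw [hT', hT'] at h4
      exact T.injective h4
    · ext w
      exact ⟨fun ⟨v, hv⟩ => ⟨_, (hd h1 v).symm.trans hv⟩, fun ⟨v, hv⟩ => ⟨_, (hd' h1 v).symm.trans hv⟩⟩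
  · rintro ⟨h1, h2, h3⟩
    have h1 := hsm.mpr h1
    refine ⟨h1, fun v w hvw => ?_, Eq.trans ?_ h3⟩
    · exact T.symm.injective (h2 ((hd' h1 v).symm.trans (hvw.trans (hd' h1 w))))
    · ext w
      exact ⟨fun ⟨v, hv⟩ => ⟨_, (hd' h1 v).symm.trans hv⟩, fun ⟨v, hv⟩ => ⟨_, (hd h1 v).symm.trans hv⟩⟩

variable [IsManifold (𝓡 n) ∞ N]

theorem isIntegralAt_chart_symm (hi : ∀ p, IsImmersedAt n H i p) {p : N}
    {u : EuclideanSpace ℝ (Fin n)} (hu : u ∈ (chartDiffeo n p).target) :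
    IsIntegralAt H (i ∘ (chartDiffeo n p).symm) u :=
  (isImmersedAt_iff_comp_symm _ hu).mp (hi _)

variable [IsManifold (𝓡 m) ∞ M]

/-- An immersion is locally injective. -/
theorem exists_injOn_of_injective_mfderiv [FiniteDimensional ℝ E]
    (hf : ∀ᶠ e in 𝓝 e, ContMDiffAt 𝓘(ℝ, E) (𝓡 m) ∞ f e)
    (hinj : Function.Injective (mfderiv 𝓘(ℝ, E) (𝓡 m) f e)) : ∀ᶠ s in (𝓝 e).smallSets, InjOn f s := by
  have hs : f e ∈ (chartDiffeo m (f e)).source := mem_chartDiffeo_source _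
  have hs' : ∀ᶠ e' in 𝓝 e, f e' ∈ (chartDiffeo m (f e)).source :=
    hf.self_of_nhds.continuousAt.eventually_mem ((chartDiffeo m (f e)).open_source.mem_nhds hs)
  have hinj' : Function.Injective (fderiv ℝ (fun e' => chartDiffeo m (f e) (f e')) e) := by
    intro v w hvw
    rw [fderiv_chart_comp hf.self_of_nhds hs, fderiv_chart_comp hf.self_of_nhds hs] at hvw
    exact hinj (mfderiv_chart_injective hs hvw)
  obtain ⟨C, Φ, ha, hΦf, -, -⟩ := exists_straightening
    ((hf.and hs').mono fun e' he' => contDiffAt_chart_comp he'.1 he'.2) hinj'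
  have hc : ContinuousAt (fun e' : E => (e', (0 : C))) e := by fun_prop
  have hev := hc.eventually_mem (Φ.open_source.mem_nhds ha)
  refine Filter.eventually_smallSets.mpr ⟨_, hev, fun t ht a hat b hbt hab => ?_⟩
  have h1 : Φ (a, 0) = Φ (b, 0) := by rw [hΦf, hΦf, hab]
  exact congrArg Prod.fst (Φ.injOn (ht hat) (ht hbt) h1)

/-- Maps tangent to a distribution lift locally to its integral manifolds. -/
theorem exists_lift {D : Set (LocalVectorField m M)} (hi : ∀ p, IsImmersedAt n (spannedBy D) i p)
    {f : E → M} {a : E} (hf : IsTangentAt (spannedBy D) f a)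
    (hrank : ∀ᶠ e in 𝓝 a, Module.finrank ℝ (spannedBy D (f e)) = n) {p : N} (hp : f a = i p) :
    ∃ g : E → N, g a = p ∧ ∀ᶠ e in 𝓝 a, ContMDiffAt 𝓘(ℝ, E) (𝓡 n) ∞ g e ∧ i (g e) = f e := by
  set c := chartDiffeo n p
  have hps : p ∈ c.source := mem_chartDiffeo_source p
  have hc : ∀ᶠ u in 𝓝 (c p), u ∈ c.target := c.open_target.mem_nhds (c.map_source hps)
  have hint : ∀ᶠ u in 𝓝 (c p), IsIntegralAt (spannedBy D) (i ∘ c.symm) u :=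
    hc.mono fun u hu => isIntegralAt_chart_symm hi hu
  obtain ⟨g, hg, hg'⟩ := exists_factorization (isTangentAt_of_eventually hint)
    hint.self_of_nhds.injective (hint.mono fun u hu => hu.finrank_eq) hf
    (by simpa using hrank) (hp.trans (congrArg i (c.symm_apply_apply hps).symm))
  have hgc : Tendsto g (𝓝 a) (𝓝 (c p)) := hg ▸ hg'.self_of_nhds.1.continuousAt.tendsto
  refine ⟨c.symm ∘ g, (congrArg c.symm hg).trans (c.symm_apply_apply hps), ?_⟩
  filter_upwards [hg', hgc.eventually hc] with e h1 h2
  exact ⟨(c.contMDiffAt_symm h2).comp e h1.1.contMDiffAt, h1.2⟩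

/-- Local uniqueness of integral manifolds. -/
theorem exists_lift_of_isImmersedAt {D : Set (LocalVectorField m M)} {k : ℕ} {P : Type*}
    [TopologicalSpace P] [ChartedSpace (EuclideanSpace ℝ (Fin k)) P] [IsManifold (𝓡 k) ∞ P]
    {j : P → M} (hi : ∀ p, IsImmersedAt n (spannedBy D) i p)
    (hj : ∀ q, IsImmersedAt k (spannedBy D) j q) {p : N} {q : P} (h : j q = i p) :
    ∃ g : P → N, g q = p ∧ ∀ᶠ q' in 𝓝 q, ContMDiffAt (𝓡 k) (𝓡 n) ∞ g q' ∧ i (g q') = j q' := by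
  set c := chartDiffeo k q
  have hqs : q ∈ c.source := mem_chartDiffeo_source q
  have hc : ∀ᶠ u in 𝓝 (c q), u ∈ c.target := c.open_target.mem_nhds (c.map_source hqs)
  have hint : ∀ᶠ u in 𝓝 (c q), IsIntegralAt (spannedBy D) (j ∘ c.symm) u :=
    hc.mono fun u hu => isIntegralAt_chart_symm hj hu
  have hkn : k = n := by
    rw [← (hj q).finrank_eq, h, (hi p).finrank_eq]
  obtain ⟨g, hg, hg'⟩ := exists_lift hi (isTangentAt_of_eventually hint)
    (hint.mono fun u hu => hu.finrank_eq.trans (by simp [hkn]))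
    ((congrArg j (c.symm_apply_apply hqs)).trans h)
  have hgc : ∀ᶠ q' in 𝓝 q, q' ∈ c.source ∧ ContMDiffAt (𝓡 k) (𝓡 n) ∞ g (c q') ∧
      i (g (c q')) = (j ∘ c.symm) (c q') :=
    (c.open_source.eventually_mem hqs).and ((c.contMDiffAt hqs).continuousAt.eventually hg')
  refine ⟨g ∘ c, hg, ?_⟩
  filter_upwards [hgc] with q' h1
  exact ⟨h1.2.1.comp q' (c.contMDiffAt h1.1),
    h1.2.2.trans (congrArg j (c.symm_apply_apply h1.1))⟩

end Immersion

end SingularFoliation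

/-! ### The leaf manifold structure -/

namespace SingularFoliation

variable {m : ℕ} {M : Type u} [TopologicalSpace M] [ChartedSpace (EuclideanSpace ℝ (Fin m)) M]
  {n : ℕ} {L : Type v}

section Leaf

variable (n) in
/-- Charts of a leaf: inverses of integral manifolds of `H`. -/
def leafAtlas (H : Distribution m M) (i : L → M) : Set (PartialEquiv L (EuclideanSpace ℝ (Fin n))) :=
  {e | IsOpen e.target ∧ ∀ u ∈ e.target, IsIntegralAt H (i ∘ e.symm) u}

variable {i : L → M}

theorem isTangentAt_of_mem_leafAtlas {H : Distribution m M}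
    {e : PartialEquiv L (EuclideanSpace ℝ (Fin n))} (he : e ∈ leafAtlas n H i)
    {u : EuclideanSpace ℝ (Fin n)} (hu : u ∈ e.target) :
    IsTangentAt H (i ∘ e.symm) u ∧
      ∀ᶠ w in 𝓝 u, Module.finrank ℝ (H ((i ∘ e.symm) w)) =
        Module.finrank ℝ (EuclideanSpace ℝ (Fin n)) := by
  have h := (he.1.eventually_mem hu).mono he.2
  exact ⟨isTangentAt_of_eventually h, h.mono fun w hw => hw.finrank_eq⟩

variable [IsManifold (𝓡 m) ∞ M] {D : Set (LocalVectorField m M)}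

/-- Local uniqueness factors one parametrization through the other, and injectivity of `i`
identifies the smooth factor with the transition map. No topology on `L` is given beforehand: the
openness of transition domains proved here is what defines it. -/
theorem transition_of_mem_leafAtlas (hi : Function.Injective i)
    {e e' : PartialEquiv L (EuclideanSpace ℝ (Fin n))} (he : e ∈ leafAtlas n (spannedBy D) i)
    (he' : e' ∈ leafAtlas n (spannedBy D) i) {u : EuclideanSpace ℝ (Fin n)}
    (hu : u ∈ (e.symm.trans e').source) :
    (∀ᶠ w in 𝓝 u, w ∈ (e.symm.trans e').source) ∧ ContDiffAt ℝ ∞ (e.symm.trans e') u := by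
  obtain ⟨hu1, hu2⟩ : u ∈ e.target ∧ e.symm u ∈ e'.source := hu
  have hu3 := e'.map_source hu2
  obtain ⟨h1, h2⟩ := isTangentAt_of_mem_leafAtlas he hu1
  obtain ⟨h1', h2'⟩ := isTangentAt_of_mem_leafAtlas he' hu3
  obtain ⟨g, hg, hg'⟩ := exists_factorization h1' (he'.2 _ hu3).injective h2' h1 h2
    (congrArg i (e'.left_inv hu2).symm)
  have hgc : Tendsto g (𝓝 u) (𝓝 (e' (e.symm u))) := hg ▸ hg'.self_of_nhds.1.continuousAt.tendsto
  have key : ∀ᶠ w in 𝓝 u, w ∈ (e.symm.trans e').source ∧ e' (e.symm w) = g w := by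
    filter_upwards [hg', he.1.eventually_mem hu1, hgc.eventually_mem (he'.1.mem_nhds hu3)]
      with w h3 h4 h5
    have h6 : e'.symm (g w) = e.symm w := hi h3.2
    refine ⟨⟨h4, ?_⟩, ?_⟩
    · change e.symm w ∈ e'.source
      rw [← h6]
      exact e'.map_target h5
    · rw [← h6, e'.right_inv h5]
  exact ⟨key.mono fun w hw => hw.1,
    hg'.self_of_nhds.1.congr_of_eventuallyEq (key.mono fun w hw => hw.2)⟩

/-- The charted space structure of a leaf. -/
noncomputable def leafCore (hi : Function.Injective i)
    (hc : ∀ p, ∃ e ∈ leafAtlas n (spannedBy D) i, p ∈ e.source) :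
    ChartedSpaceCore (EuclideanSpace ℝ (Fin n)) L where
  atlas := leafAtlas n (spannedBy D) i
  chartAt p := (hc p).choose
  mem_chart_source p := (hc p).choose_spec.2
  chart_mem_atlas p := (hc p).choose_spec.1
  open_source _ _ he he' := isOpen_iff_mem_nhds.mpr fun _ hu =>
    (transition_of_mem_leafAtlas hi he he' hu).1
  continuousOn_toFun _ _ he he' _ hu :=
    (transition_of_mem_leafAtlas hi he he' hu).2.continuousAt.continuousWithinAt

/-- A set that is covered by integral manifolds of a distribution carries the structure of an
immersed manifold. -/
theorem exists_leaf (hi : Function.Injective i)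
    (hc : ∀ p, ∃ e ∈ leafAtlas n (spannedBy D) i, p ∈ e.source) :
    ∃ (_ : TopologicalSpace L) (_ : ChartedSpace (EuclideanSpace ℝ (Fin n)) L),
      IsManifold (𝓡 n) ∞ L ∧ ∀ p, IsImmersedAt n (spannedBy D) i p := by
  let core := leafCore hi hc
  let _ : TopologicalSpace L := core.toTopologicalSpace
  let _ : ChartedSpace (EuclideanSpace ℝ (Fin n)) L := core.toChartedSpace
  have hatlas : ∀ e ∈ atlas (EuclideanSpace ℝ (Fin n)) L,
      e.toPartialEquiv ∈ leafAtlas n (spannedBy D) i := by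
    intro e he
    obtain ⟨e', he', rfl⟩ : ∃ (e' : PartialEquiv L _) (he' : e' ∈ core.atlas),
        e = core.openPartialHomeomorph e' he' := by
      have h : e ∈ ⋃ (e' : PartialEquiv L _) (he' : e' ∈ core.atlas),
        {core.openPartialHomeomorph e' he'} := he
      simpa using h
    exact he'
  have hman : IsManifold (𝓡 n) ∞ L := by
    refine isManifold_of_contDiffOn (𝓡 n) ∞ L fun e e' he he' u hu => ?_
    exact (transition_of_mem_leafAtlas hi (hatlas e he) (hatlas e' he') hu.1).2.contDiffWithinAt
  refine ⟨inferInstance, inferInstance, hman, fun p => ?_⟩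
  have h := (hatlas _ (chart_mem_atlas (EuclideanSpace ℝ (Fin n)) p)).2 _
    ((chartDiffeo n p).map_source (mem_chartDiffeo_source p))
  have h1 := (isImmersedAt_iff_comp_symm (chartDiffeo n p) (H := spannedBy D) (i := i)
    ((chartDiffeo n p).map_source (mem_chartDiffeo_source p))).mpr h
  rwa [PartialDiffeomorph.symm_apply_apply _ (mem_chartDiffeo_source p)] at h1

end Leaf

/-! ### Orbits as leaves: charts and connectedness -/

section Orbit

variable [IsManifold (𝓡 m) ∞ M] [T2Space M] {V : Set (LocalVectorField m M)} {x : M}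

theorem finrank_of_mem_orbit
    (hn : Module.finrank ℝ (spannedBy (stableHull V) x) = n) (y : orbit (flowPseudogroup V) x) :
    Module.finrank ℝ (spannedBy (stableHull V) (y : M)) = n :=
  (finrank_eq_of_mem_orbit y.2).trans hn

/-- Orbits are covered by integral manifolds. -/
theorem exists_mem_leafAtlas_orbit
    (hn : Module.finrank ℝ (spannedBy (stableHull V) x) = n) (y : orbit (flowPseudogroup V) x) :
    ∃ e ∈ leafAtlas n (spannedBy (stableHull V)) (Subtype.val : orbit (flowPseudogroup V) x → M),
      y ∈ e.source := by
  classical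
  obtain ⟨f, hf0, hft, hfo, hfi⟩ := exists_isOrbitPlaque V (y : M) (finrank_of_mem_orbit hn y)
  have hfo' : ∀ᶠ u in 𝓝 0, f u ∈ orbit (flowPseudogroup V) x :=
    hfo.mono fun u hu => mem_orbit_trans y.2 hu
  have hrank : ∀ᶠ u in 𝓝 0, Module.finrank ℝ (spannedBy (stableHull V) (f u)) =
      Module.finrank ℝ (EuclideanSpace ℝ (Fin n)) :=
    hfo'.mono fun u hu => (finrank_of_mem_orbit hn ⟨f u, hu⟩).trans (by simp)
  have hint : ∀ᶠ u in 𝓝 0, IsIntegralAt (spannedBy (stableHull V)) f u := by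
    filter_upwards [hft.contMDiffAt, hft.eventually_injective hfi,
      hft.eventually_range_eq hfi hrank] with u h1 h2 h3
    exact ⟨h1, h2, h3⟩
  obtain ⟨s, hs, hsinj⟩ := eventually_smallSets.mp
    (exists_injOn_of_injective_mfderiv hft.contMDiffAt hfi)
  obtain ⟨B, hB, hBo, hB0⟩ := mem_nhds_iff.mp
    ((show ∀ᶠ u in 𝓝 0, u ∈ s from hs).and (hfo'.and hint))
  let p : EuclideanSpace ℝ (Fin n) → orbit (flowPseudogroup V) x := fun u =>
    if h : f u ∈ orbit (flowPseudogroup V) x then ⟨f u, h⟩ else y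
  have hp : ∀ u ∈ B, (p u : M) = f u := fun u hu => by simp only [p, dif_pos (hB hu).2.1]
  have hpinj : InjOn p B := fun u hu w hw huw =>
    hsinj s subset_rfl (hB hu).1 (hB hw).1 (by rw [← hp u hu, ← hp w hw, huw])
  refine ⟨(hpinj.toPartialEquiv p B).symm, ⟨hBo, fun u hu => ?_⟩, 0, hB0, ?_⟩
  · exact (hB hu).2.2.congr ((hBo.eventually_mem hu).mono hp)
  · exact Subtype.ext ((hp 0 hB0).trans hf0)

/-- Flow lines are smooth and tangent to the distribution. -/
theorem isTangentAt_of_flowsTo {X : LocalVectorField m M} {D : Set (LocalVectorField m M)}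
    (hX : X ∈ D) {γ : ℝ → M} {y : M} {s : ℝ} (hγ : ∀ᶠ r in 𝓝 s, FlowsTo X r y (γ r)) :
    IsTangentAt (spannedBy D) γ s := by
  constructor
  · filter_upwards [hγ.eventually_nhds] with s hs
    obtain ⟨F, hF⟩ := exists_localFlow X hs.self_of_nhds.mem_dom_right
    have hc : Tendsto (fun r => (r - s, γ s)) (𝓝 s) (𝓝 ((0 : ℝ), γ s)) := by
      have : Continuous (fun r : ℝ => (r - s, γ s)) := by fun_prop
      simpa using this.tendsto s
    -- By the group law, the curve near time `s` is a short flow line restarted at `γ s`, where the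
    -- flow is known to be smooth.
    have h1 : γ =ᶠ[𝓝 s] F ∘ fun r => (r - s, γ s) := by
      filter_upwards [hs, hc.eventually hF] with r h2 h3
      have h4 := hs.self_of_nhds.symm.trans h2
      rw [neg_add_eq_sub] at h4
      exact h4.unique h3.2
    refine ContMDiffAt.congr_of_eventuallyEq ?_ h1
    refine ContMDiffAt.comp (I' := 𝓘(ℝ, ℝ).prod (𝓡 m)) s
      (hc.eventually hF.eventually_nhds).self_of_nhds.self_of_nhds.1
      (ContMDiffAt.prodMk ?_ contMDiffAt_const)
    exact (contDiff_id.sub contDiff_const).contMDiff.contMDiffAt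
  · filter_upwards [hγ.eventually_nhds] with s hs v
    rw [(hasMFDerivAt_of_eventually_flowsTo hs).mfderiv]
    exact Submodule.smul_mem _ (show ℝ from v) (Submodule.subset_span ⟨X, hX, hs.self_of_nhds.mem_dom_right, rfl⟩)

variable {L : Type*} [TopologicalSpace L] [ChartedSpace (EuclideanSpace ℝ (Fin n)) L]
  [IsManifold (𝓡 n) ∞ L] {i : L → M}

/-- A flow line of a field in `V` stays in the orbit, hence has a pointwise lift to `L`. The leaf
topology may be finer than that of `M`, so continuity is not automatic: near each time the lift
agrees, by injectivity of `i`, with a smooth local lift. -/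
theorem connectedComponent_eq_of_flowsTo (hi : Function.Injective i)
    (hrange : range i = orbit (flowPseudogroup V) x)
    (himm : ∀ p, IsImmersedAt n (spannedBy (stableHull V)) i p) {X : LocalVectorField m M}
    (hX : X ∈ V) {t : ℝ} {p q : L} (h : FlowsTo X t (i p) (i q)) :
    connectedComponent p = connectedComponent q := by
  obtain ⟨γ, a, b, ha, hb, ht, h0, h1, hd, hγ⟩ := h
  have hflow : ∀ s ∈ Ioo a b, FlowsTo X s (i p) (γ s) := fun s hs =>
    ⟨γ, a, b, ha, hb, hs, h0, rfl, hd, hγ⟩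
  have hmem : ∀ s ∈ Ioo a b, ∃ r, i r = γ s := by
    intro s hs
    have h2 : i p ∈ orbit (flowPseudogroup V) x := hrange ▸ mem_range_self p
    have h3 : γ s ∈ orbit (flowPseudogroup V) (i p) :=
      ⟨flowDiffeo X s, (isFlowAt_flowDiffeo X s).mem_flowPseudogroup hX,
        (isFlowAt_flowDiffeo X s).mem_source (hflow s hs),
        (isFlowAt_flowDiffeo X s).apply_eq (hflow s hs)⟩
    exact (Set.ext_iff.mp hrange _).mpr (mem_orbit_trans h2 h3)
  have : Nonempty L := ⟨p⟩
  choose! c hc using hmem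
  have hcont : ContinuousOn c (Ioo a b) := by
    intro s hs
    have hev : ∀ᶠ r in 𝓝 s, r ∈ Ioo a b := isOpen_Ioo.eventually_mem hs
    obtain ⟨g, hg, hg'⟩ := exists_lift himm
      (isTangentAt_of_flowsTo (subset_stableHull V hX) (hev.mono hflow))
      (hev.mono fun r hr => by
        rw [← hc r hr]
        exact (himm (c r)).finrank_eq) (hc s hs).symm
    have hgc : c =ᶠ[𝓝 s] g := by
      filter_upwards [hg', hev] with r h2 h3
      exact hi ((hc r h3).trans h2.2.symm)
    exact (hg'.self_of_nhds.1.continuousAt.congr hgc.symm).continuousWithinAt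
  have h00 : (0 : ℝ) ∈ Ioo a b := ⟨ha, hb⟩
  have hp : c 0 = p := hi ((hc 0 h00).trans h0)
  have hq : c t = q := hi ((hc t ht).trans h1)
  have hpre : IsPreconnected (c '' Ioo a b) := isPreconnected_Ioo.image c hcont
  refine connectedComponent_eq ?_
  exact hpre.subset_connectedComponent ⟨0, h00, hp⟩ ⟨t, ht, hq⟩

/-- Orbits are connected in the leaf topology. -/
theorem connectedSpace_of_range_eq_orbit (hi : Function.Injective i)
    (hrange : range i = orbit (flowPseudogroup V) x)
    (himm : ∀ p, IsImmersedAt n (spannedBy (stableHull V)) i p) : ConnectedSpace L := by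
  -- Equality of leaf components, phrased as an equivalence relation on `M` so that it extends from
  -- flow lines to the pseudogroup. The first clause supplies the intermediate point of `L` for
  -- transitivity.
  let R : M → M → Prop := fun y z => (y ∈ range i ↔ z ∈ range i) ∧
    ∀ p q, i p = y → i q = z → connectedComponent p = connectedComponent q
  have hR : Equivalence R := by
    refine ⟨fun y => ⟨Iff.rfl, fun p q hp hq => by rw [hi (hp.trans hq.symm)]⟩,
      fun h => ⟨h.1.symm, fun p q hp hq => (h.2 q p hq hp).symm⟩, ?_⟩
    intro y z w h1 h2
    refine ⟨h1.1.trans h2.1, fun p q hp hq => ?_⟩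
    obtain ⟨r, hr⟩ := h1.1.mp ⟨p, hp⟩
    exact (h1.2 p r hp hr).trans (h2.2 r q hr hq)
  have hflow : ∀ X ∈ V, ∀ t y z, FlowsTo X t y z → R y z := by
    intro X hX t y z h
    have hz : z ∈ orbit (flowPseudogroup V) y :=
      ⟨flowDiffeo X t, (isFlowAt_flowDiffeo X t).mem_flowPseudogroup hX,
        (isFlowAt_flowDiffeo X t).mem_source h, (isFlowAt_flowDiffeo X t).apply_eq h⟩
    refine ⟨?_, ?_⟩
    · rw [hrange]
      exact ⟨fun hy => mem_orbit_trans hy hz, fun hz' => mem_orbit_trans hz' (mem_orbit_symm hz)⟩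
    · rintro p q rfl rfl
      exact connectedComponent_eq_of_flowsTo hi hrange himm hX h
  obtain ⟨p, hp⟩ : x ∈ range i := hrange ▸ mem_orbit_self V x
  refine connectedSpace_iff_connectedComponent.mpr ⟨p, eq_univ_of_forall fun q => ?_⟩
  obtain ⟨φ, hφ, hx, hφx⟩ : i q ∈ orbit (flowPseudogroup V) x := hrange ▸ mem_range_self q
  rw [(rel_of_mem_flowPseudogroup hR hflow hφ hx).2 p q hp hφx.symm]
  exact mem_connectedComponent

end Orbit

end SingularFoliation

/-! ### Countability: the theorem of Poincaré and Volterra -/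

section CountableCovers

open TopologicalSpace

/-- A connected space with an open cover each member of which meets only countably many others is
covered by countably many members. -/
theorem exists_countable_cover_of_countable_inter {X ι : Type*} [TopologicalSpace X]
    [PreconnectedSpace X] {U : ι → Set X} (hU : ∀ a, IsOpen (U a)) (hcov : ⋃ a, U a = univ)
    (hcount : ∀ a, {b | (U a ∩ U b).Nonempty}.Countable) :
    ∃ s : Set ι, s.Countable ∧ ⋃ a ∈ s, U a = univ := by
  rcases isEmpty_or_nonempty X with hX | ⟨⟨x⟩⟩
  · exact ⟨∅, countable_empty, Subsingleton.elim _ _⟩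
  obtain ⟨a, ha⟩ := mem_iUnion.mp (hcov.symm ▸ mem_univ x)
  -- `S k` lists the members reached from `a` by `k` successive overlaps. The union of all reached
  -- members is open, and so is its complement: a member containing a point outside it but meeting
  -- it would have been reached.
  let S : ℕ → Set ι := fun k => Nat.rec {a} (fun _ T => ⋃ b ∈ T, {c | (U b ∩ U c).Nonempty}) k
  have hS : ∀ k, (S k).Countable := by
    intro k
    induction k with
    | zero => exact countable_singleton a
    | succ k ih => exact ih.biUnion fun b _ => hcount b
  refine ⟨⋃ k, S k, countable_iUnion hS, ?_⟩
  refine IsClopen.eq_univ ⟨⟨?_⟩, isOpen_biUnion fun b _ => hU b⟩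
    ⟨x, mem_biUnion (mem_iUnion.mpr ⟨0, mem_singleton a⟩) ha⟩
  refine isOpen_iff_mem_nhds.mpr fun y hy => ?_
  obtain ⟨b, hb⟩ := mem_iUnion.mp (hcov.symm ▸ mem_univ y)
  filter_upwards [(hU b).mem_nhds hb] with z hz hz'
  obtain ⟨c, hc, hzc⟩ := mem_iUnion₂.mp hz'
  obtain ⟨k, hk⟩ := mem_iUnion.mp hc
  exact hy (mem_biUnion (mem_iUnion.mpr ⟨k + 1, mem_biUnion hk ⟨z, hzc, hz⟩⟩) hb)

/-- A continuous image of a connected space in a paracompact locally compact, locally second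
countable space lies in a second countable open subset. -/
theorem exists_secondCountable_of_connected {X Y : Type*} [TopologicalSpace X] [PreconnectedSpace X]
    [TopologicalSpace Y] [T2Space Y] [ParacompactSpace Y] [LocallyCompactSpace Y]
    (hY : ∀ y : Y, ∃ s ∈ 𝓝 y, SecondCountableTopology s) {f : X → Y} (hf : Continuous f) :
    ∃ W : Set Y, range f ⊆ W ∧ SecondCountableTopology W := by
  have h : ∀ y : Y, ∃ W : Set Y, IsOpen W ∧ y ∈ W ∧ IsCompact (closure W) ∧
      SecondCountableTopology W := by
    intro y
    obtain ⟨s, hs, _⟩ := hY y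
    obtain ⟨K, hK, hKs, hKc⟩ := LocallyCompactSpace.local_compact_nhds y s hs
    refine ⟨interior K, isOpen_interior, mem_interior_iff_mem_nhds.mpr hK,
      hKc.closure_of_subset interior_subset, ?_⟩
    exact (IsEmbedding.inclusion (interior_subset.trans hKs)).secondCountableTopology
  choose W hWo hW hWc hWs using h
  obtain ⟨T, hTo, hTc, hTf, hTW⟩ := precise_refinement W hWo
    (eq_univ_of_forall fun y => mem_iUnion.mpr ⟨y, hW y⟩)
  obtain ⟨s, hs, hsX⟩ := exists_countable_cover_of_countable_inter (U := fun y => f ⁻¹' T y)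
    (fun y => (hTo y).preimage hf) (by rw [← preimage_iUnion, hTc, preimage_univ]) (by
      intro y
      -- `T y` lies in a compact set, which meets only finitely many members of a locally finite
      -- cover.
      refine (hTf.finite_nonempty_inter_compact (hWc y)).countable.mono ?_
      rintro z ⟨x, hx, hx'⟩
      exact ⟨f x, hx', subset_closure (hTW y hx)⟩)
  refine ⟨⋃ y ∈ s, T y, ?_, ?_⟩
  · rintro _ ⟨x, rfl⟩
    have h1 : x ∈ ⋃ a ∈ s, f ⁻¹' T a := hsX ▸ mem_univ x
    simpa using h1
  · have := hs.to_subtype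
    let S : s → Set (⋃ y ∈ s, T y : Set Y) := fun y => Subtype.val ⁻¹' T y
    have hS : ∀ y, SecondCountableTopology (S y) := by
      intro y
      have := hWs y
      let g : S y → W y := fun z => ⟨z.1.1, hTW (y : Y) z.2⟩
      have hg : Continuous g := by fun_prop
      have hgv := (IsEmbedding.subtypeVal (p := (· ∈ ⋃ y ∈ s, T y))).comp
        (IsEmbedding.subtypeVal (p := (· ∈ S y)))
      exact (IsEmbedding.of_comp (f := g) hg continuous_subtype_val hgv).secondCountableTopology
    exact secondCountableTopology_of_countable_cover (U := S)
      (fun y => (hTo (y : Y)).preimage continuous_subtype_val)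
      (eq_univ_of_forall fun z => by
        obtain ⟨y, hy, hz⟩ := mem_iUnion₂.mp z.2
        exact mem_iUnion.mpr ⟨⟨y, hy⟩, hz⟩)

/-- The theorem of Poincaré and Volterra. -/
theorem secondCountableTopology_of_injective {X Y : Type*} [TopologicalSpace X]
    [PreconnectedSpace X] [T2Space X] [LocallyConnectedSpace X] [LocallyCompactSpace X]
    (hX : ∀ x : X, ∃ s ∈ 𝓝 x, SecondCountableTopology s)
    [TopologicalSpace Y] [T2Space Y] [SecondCountableTopology Y] {f : X → Y} (hf : Continuous f)
    (hinj : Function.Injective f) : SecondCountableTopology X := by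
  -- The cover consists of the second countable components of preimages of basic open sets.
  let ι := {A : Set X // ∃ B ∈ countableBasis Y, ∃ x, f x ∈ B ∧
    A = connectedComponentIn (f ⁻¹' B) x ∧ SecondCountableTopology A}
  have hopen (A : ι) : IsOpen (A : Set X) := by
    obtain ⟨A, B, hB, x, hx, rfl, hA⟩ := A
    exact ((isOpen_of_mem_countableBasis hB).preimage hf).connectedComponentIn
  have hcov : ⋃ A : ι, (A : Set X) = univ := by
    refine eq_univ_of_forall fun x => ?_
    obtain ⟨s, hs, _⟩ := hX x
    obtain ⟨K, hK, hKs, hKc⟩ := LocallyCompactSpace.local_compact_nhds x s hs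
    have hxK : x ∈ interior K := mem_interior_iff_mem_nhds.mpr hK
    -- By injectivity `f x` avoids the compact image of the frontier of `K`. A basic `B` around `f
    -- x` missing that image has a preimage whose component at `x` cannot leave `K`, hence is second
    -- countable.
    have hfr : IsClosed (f '' frontier K) :=
      ((hKc.of_isClosed_subset isClosed_frontier hKc.isClosed.frontier_subset).image hf).isClosed
    have hfx : f x ∉ f '' frontier K := by
      rintro ⟨z, hz, hzx⟩
      rw [hinj hzx] at hz
      exact hz.2 hxK
    obtain ⟨B, hB, hxB, hBK⟩ := (isBasis_countableBasis Y).exists_subset_of_mem_open hfx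
      hfr.isOpen_compl
    have hsub : connectedComponentIn (f ⁻¹' B) x ⊆ interior K := by
      refine isPreconnected_connectedComponentIn.subset_left_of_subset_union isOpen_interior
        hKc.isClosed.isOpen_compl (disjoint_compl_right.mono_left interior_subset) ?_
        ⟨x, mem_connectedComponentIn hxB, hxK⟩
      intro z hz
      by_cases hzK : z ∈ K
      · refine Or.inl (by_contra fun hzi => ?_)
        have hzB : z ∈ f ⁻¹' B := connectedComponentIn_subset _ _ hz
        exact hBK hzB ⟨z, ⟨subset_closure hzK, hzi⟩, rfl⟩
      · exact Or.inr hzK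
    refine mem_iUnion.mpr ⟨⟨_, B, hB, x, hxB, rfl, ?_⟩, mem_connectedComponentIn hxB⟩
    exact (IsEmbedding.inclusion
      (hsub.trans (interior_subset.trans hKs))).secondCountableTopology
  have hsc (A : ι) : SecondCountableTopology (A : Set X) := by
    obtain ⟨A, B, hB, x, hx, hAx, hA⟩ := A
    exact hA
  have hcount (A : ι) : {A' : ι | ((A : Set X) ∩ A').Nonempty}.Countable := by
    -- For a fixed `B` the components are disjoint and open, so only countably many meet the second
    -- countable set `A`.
    have h1 : (⋃ B ∈ countableBasis Y, {A' : Set X | (∃ x, A' = connectedComponentIn (f ⁻¹' B) x) ∧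
        ((A : Set X) ∩ A').Nonempty}).Countable := by
      refine (countable_countableBasis Y).biUnion fun B hB => ?_
      refine PairwiseDisjoint.countable_of_isOpen
        (s := fun A' : Set X => (Subtype.val ⁻¹' A' : Set (A : Set X))) ?_ ?_ ?_
      · rintro _ ⟨⟨x, rfl⟩, -⟩ _ ⟨⟨y, rfl⟩, -⟩ hne
        refine disjoint_left.mpr fun z hz hz' => hne ?_
        rw [connectedComponentIn_eq hz, connectedComponentIn_eq hz']
      · rintro _ ⟨⟨x, rfl⟩, -⟩
        exact (((isOpen_of_mem_countableBasis hB).preimage hf).connectedComponentIn).preimage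
          continuous_subtype_val
      · rintro A' ⟨-, z, hz, hz'⟩
        exact ⟨⟨z, hz⟩, hz'⟩
    refine MapsTo.countable_of_injOn (f := fun A' : ι => (A' : Set X)) (fun A' hA' => ?_)
      Subtype.val_injective.injOn h1
    obtain ⟨A', B, hB, x, hx, hAx, hA⟩ := A'
    exact mem_biUnion hB ⟨⟨x, hAx⟩, hA'⟩
  obtain ⟨s, hs, hsX⟩ := exists_countable_cover_of_countable_inter hopen hcov hcount
  have := hs.to_subtype
  exact secondCountableTopology_of_countable_cover (U := fun A : s => ((A : ι) : Set X))
    (fun A => hopen A) (by rw [← hsX, biUnion_eq_iUnion])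

/-- A connected locally Euclidean space which injects continuously into a paracompact manifold is
paracompact. -/
theorem paracompactSpace_of_injective {X Y E F : Type*} [NormedAddCommGroup E] [NormedSpace ℝ E]
    [FiniteDimensional ℝ E] [NormedAddCommGroup F] [NormedSpace ℝ F] [FiniteDimensional ℝ F]
    [TopologicalSpace X] [ChartedSpace E X] [T2Space X] [PreconnectedSpace X]
    [TopologicalSpace Y] [ChartedSpace F Y] [T2Space Y] [ParacompactSpace Y] {f : X → Y}
    (hf : Continuous f) (hinj : Function.Injective f) : ParacompactSpace X := by
  have : LocallyCompactSpace X := ChartedSpace.locallyCompactSpace E X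
  have : LocallyConnectedSpace X := ChartedSpace.locallyConnectedSpace E X
  have : LocallyCompactSpace Y := ChartedSpace.locallyCompactSpace F Y
  have hX (x : X) : ∃ s ∈ 𝓝 x, SecondCountableTopology s :=
    ⟨_, chart_source_mem_nhds E x, (chartAt E x).secondCountableTopology_source⟩
  have hY (y : Y) : ∃ s ∈ 𝓝 y, SecondCountableTopology s :=
    ⟨_, chart_source_mem_nhds F y, (chartAt F y).secondCountableTopology_source⟩
  -- A paracompact `Y` may have uncountably many components, so it is first cut down to a second
  -- countable subset containing the image.
  obtain ⟨W, hW, _⟩ := exists_secondCountable_of_connected hY hf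
  have := secondCountableTopology_of_injective hX
    (f := fun x => (⟨f x, hW (mem_range_self x)⟩ : W)) (hf.subtype_mk _)
    fun x y hxy => hinj (congrArg Subtype.val hxy)
  infer_instance

end CountableCovers

/-! ### Comparison of integral manifolds and the main theorem -/

namespace SingularFoliation

variable {m : ℕ} {M : Type u} [TopologicalSpace M] [ChartedSpace (EuclideanSpace ℝ (Fin m)) M]
  {n k : ℕ} {N P : Type*} [TopologicalSpace N] [ChartedSpace (EuclideanSpace ℝ (Fin n)) N]
  [TopologicalSpace P] [ChartedSpace (EuclideanSpace ℝ (Fin k)) P] {i : N → M} {j : P → M}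

theorem IsIntegralManifold.isImmersedAt {H : Distribution m M} (h : IsIntegralManifold H n i)
    (p : N) : IsImmersedAt n H i p :=
  ⟨h.contMDiff p, h.injective_mfderiv p, h.range_mfderiv p⟩

variable [IsManifold (𝓡 m) ∞ M]

/-- A map between integral manifolds over the ambient manifold is smooth. -/
theorem IsIntegralManifold.contMDiff_of_comp_eq {D : Set (LocalVectorField m M)}
    (hi : IsIntegralManifold (spannedBy D) n i) (hj : IsIntegralManifold (spannedBy D) k j)
    {Φ : P → N} (hΦ : ∀ q, i (Φ q) = j q) : ContMDiff (𝓡 k) (𝓡 n) ∞ Φ := by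
  have := hi.isManifold
  have := hj.isManifold
  intro q
  obtain ⟨g, -, hg⟩ := exists_lift_of_isImmersedAt hi.isImmersedAt hj.isImmersedAt (hΦ q).symm
  -- Injectivity of `i` makes `Φ` equal near `q` to the smooth local lift, so its continuity need
  -- not be assumed.
  refine hg.self_of_nhds.1.congr_of_eventuallyEq ?_
  filter_upwards [hg] with q' hq'
  exact hi.injective ((hΦ q').trans hq'.2.symm)

/-- Integral manifolds with the same image are diffeomorphic. -/
theorem IsIntegralManifold.exists_diffeomorph {D : Set (LocalVectorField m M)}
    (hi : IsIntegralManifold (spannedBy D) n i) (hj : IsIntegralManifold (spannedBy D) k j)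
    (hij : range j = range i) : ∃ Φ : P ≃ₘ⟮𝓡 k, 𝓡 n⟯ N, ∀ p, i (Φ p) = j p := by
  have h1 : ∀ q, ∃ p, i p = j q := fun q => hij.subset (mem_range_self q)
  have h2 : ∀ p, ∃ q, j q = i p := fun p => hij.superset (mem_range_self p)
  choose Φ hΦ using h1
  choose Ψ hΨ using h2
  exact ⟨⟨⟨Φ, Ψ, fun q => hj.injective ((hΨ _).trans (hΦ q)),
    fun p => hi.injective ((hΦ _).trans (hΨ p))⟩, hi.contMDiff_of_comp_eq hj hΦ,
    hj.contMDiff_of_comp_eq hi hΨ⟩, hΦ⟩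

variable [T2Space M] [ParacompactSpace M]

/-- Orbits are integral manifolds. -/
theorem exists_isIntegralManifold_orbit (V : Set (LocalVectorField m M)) (x : M) :
    ∃ (n : ℕ) (L : Type u) (_ : TopologicalSpace L)
      (_ : ChartedSpace (EuclideanSpace ℝ (Fin n)) L) (i : L → M),
      range i = orbit (flowPseudogroup V) x ∧
        IsIntegralManifold (spannedBy (stableHull V)) n i := by
  obtain ⟨n, hn⟩ : ∃ n, Module.finrank ℝ (spannedBy (stableHull V) x) = n := ⟨_, rfl⟩
  obtain ⟨L, i, hi, hrange, hcov⟩ : ∃ (L : Type u) (i : L → M), Function.Injective i ∧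
      range i = orbit (flowPseudogroup V) x ∧
      ∀ p, ∃ e ∈ leafAtlas n (spannedBy (stableHull V)) i, p ∈ e.source :=
    ⟨orbit (flowPseudogroup V) x, Subtype.val, Subtype.val_injective, Subtype.range_coe,
      exists_mem_leafAtlas_orbit hn⟩
  obtain ⟨_, _, hman, himm⟩ := exists_leaf hi hcov
  have hsm : ContMDiff (𝓡 n) (𝓡 m) ∞ i := fun p => (himm p).contMDiffAt
  have hT2 : T2Space L := .of_injective_continuous hi hsm.continuous
  have hconn := connectedSpace_of_range_eq_orbit hi hrange himm
  exact ⟨n, L, _, _, i, hrange, hman, hT2, paracompactSpace_of_injective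
    (E := EuclideanSpace ℝ (Fin n)) (F := EuclideanSpace ℝ (Fin m)) hsm.continuous hi, hconn, hi,
    hsm, fun p => (himm p).injective, fun p => (himm p).range_eq⟩

/-- Integral manifolds through a point are contained in the orbit. -/
theorem IsIntegralManifold.range_subset_orbit {V : Set (LocalVectorField m M)} {x : M}
    (hj : IsIntegralManifold (spannedBy (stableHull V)) k j) (hx : x ∈ range j) :
    range j ⊆ orbit (flowPseudogroup V) x := by
  have := hj.isManifold
  have := hj.connected
  -- Near `q` the map `j` lifts to the leaf on the orbit of `j q`. As orbits partition `M`,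
  -- preimages of orbits are clopen in the connected `P`.
  have hopen : ∀ q, ∀ᶠ q' in 𝓝 q, j q' ∈ orbit (flowPseudogroup V) (j q) := by
    intro q
    obtain ⟨n, L, _, _, i, hi, hL⟩ := exists_isIntegralManifold_orbit V (j q)
    have := hL.isManifold
    obtain ⟨p, hp⟩ : j q ∈ range i := hi ▸ mem_orbit_self V (j q)
    obtain ⟨g, -, hg⟩ := exists_lift_of_isImmersedAt hL.isImmersedAt hj.isImmersedAt hp.symm
    filter_upwards [hg] with q' hq'
    rw [← hi, ← hq'.2]
    exact mem_range_self _
  have hclopen : IsClopen (j ⁻¹' orbit (flowPseudogroup V) x) := by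
    refine ⟨⟨isOpen_iff_mem_nhds.mpr fun q hq => ?_⟩, isOpen_iff_mem_nhds.mpr fun q hq => ?_⟩
    · filter_upwards [hopen q] with q' hq' hq''
      exact hq (mem_orbit_trans hq'' (mem_orbit_symm hq'))
    · filter_upwards [hopen q] with q' hq'
      exact mem_orbit_trans hq hq'
  obtain ⟨q, rfl⟩ := hx
  have huniv := hclopen.eq_univ ⟨q, mem_orbit_self V (j q)⟩
  rintro _ ⟨q', rfl⟩
  exact huniv.superset (mem_univ q')

end SingularFoliation

theorem mainTheorem7 (m : ℕ) (M : Type u) [TopologicalSpace M] [T2Space M] [ParacompactSpace M]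
    [ChartedSpace (EuclideanSpace ℝ (Fin m)) M] [IsManifold (𝓡 m) ∞ M]
    (V : Set (SingularFoliation.LocalVectorField m M)) (x : M) :
    ∃ (n : ℕ) (L : Type u) (_ : TopologicalSpace L)
      (_ : ChartedSpace (EuclideanSpace ℝ (Fin n)) L) (i : L → M),
      range i = SingularFoliation.orbit (SingularFoliation.flowPseudogroup V) x ∧
      x ∈ range i ∧
      SingularFoliation.IsMaximalIntegralManifold
        (SingularFoliation.spannedBy (SingularFoliation.stableHull V)) n i ∧
      (∀ (k : ℕ) (P : Type u) [TopologicalSpace P]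
        [ChartedSpace (EuclideanSpace ℝ (Fin k)) P] (j : P → M),
        SingularFoliation.IsIntegralManifold
          (SingularFoliation.spannedBy (SingularFoliation.stableHull V)) k j →
        x ∈ range j → range j ⊆ range i) ∧
      (∀ (k : ℕ) (P : Type u) [TopologicalSpace P]
        [ChartedSpace (EuclideanSpace ℝ (Fin k)) P] (j : P → M),
        SingularFoliation.IsMaximalIntegralManifold
          (SingularFoliation.spannedBy (SingularFoliation.stableHull V)) k j →
        x ∈ range j →
        ∃ Φ : P ≃ₘ⟮𝓡 k, 𝓡 n⟯ L, ∀ p, i (Φ p) = j p) := by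
  obtain ⟨n, L, _, _, i, hi, hL⟩ := SingularFoliation.exists_isIntegralManifold_orbit V x
  have hx : x ∈ range i := hi ▸ SingularFoliation.mem_orbit_self V x
  refine ⟨n, L, _, _, i, hi, hx, ⟨hL, ?_⟩, ?_, ?_⟩
  · intro k P _ _ j hj hij
    exact (hi ▸ hj.range_subset_orbit (hij hx)).antisymm hij
  · intro k P _ _ j hj hxj
    exact hi ▸ hj.range_subset_orbit hxj
  · intro k P _ _ j hj hxj
    have hsub : range j ⊆ range i := hi ▸ hj.isIntegralManifold.range_subset_orbit hxj
    -- Maximality of `j`, applied to the orbit that contains its image, gives equal images.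
    exact hL.exists_diffeomorph hj.isIntegralManifold (hj.maximal n L i hL hsub).symm
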